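/- Let $G$ be a Hausdorff, locally compact (topological) groupoid with object space $G^0$, range and source maps $r,s\colon G\to G^0$ and unit map $u\colon G^0\to G$. Write $G^2=\{(g,h)\in G\times G: s(g)=r(h)\}$. All fields of Banach spaces and of C*-algebras are upper semicontinuous and have enough continuous sections (this is automatic over locally compact Hausdorff spaces). **Fell bundles.** A Fell bundle over $G$ is a field of Banach spaces $\mathcal A=(\mathcal A_g)_{g\in G}$ with bilinear multiplications $\mathcal A_g\times\mathcal A_h\to\mathcal A_{gh}$ for $(g,h)\in G^2$ and conjugate-linear involutions $\mathcal A_g\to\mathcal A_{g^{-1}}$ that are continuous and satisfy $(ab)c=a(bc)$, $(ab)^*=b^*a^*$, $a^{**}=a$, $\|ab\|\le\|a\|\,\|b\|$, $\|a^*a\|=\|a\|^2$, and: for each $a\in\mathcal A_g$ there is $b\in\mathcal A_{u(s(g))}$ with $b^*b=a^*a$. (It need not be saturated.) Its restriction $\mathfrak A=u^*\mathcal A$ to the units is a field of C*-algebras over $G^0$. Each $\mathcal A_g$ is a left Hilbert $\mathfrak A_{r(g)}$-module with inner product $ab^*$ and a right Hilbert $\mathfrak A_{s(g)}$-module with inner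 product $a^*b$. An isomorphism of Fell bundles is a homeomorphism of the total spaces that consists of linear isometric isomorphisms of the fibres and respects multiplication and involution. **Fields of ideals.** For a field of C*-algebras $\mathfrak B$ over $G^0$ and a continuous map $f\colon Y\to G^0$, a continuous field of ideals in $f^*\mathfrak B$ is a family of closed two-sided ideals $D_y\subseteq\mathfrak B_{f(y)}$ such that for each $y\in Y$ and $a\in D_y$ there is a continuous section $\sigma$ of $f^*\mathfrak B$ with $\sigma(y)=a$ and $\sigma(z)\in D_z$ for all $z\in Y$. It carries the subspace topology. An ideal is a left (right) Hilbert module with inner product $ab^*$ (respectively $a^*b$). An isomorphism of fields of left (right) Hilbert modules is a homeomorphism of the total spaces that consists of linear bijections of the fibres preserving the module structure and the inner product. **Twisted partial actions.** A twisted partial action of $G$ consists of a field of C*-algebras $\mathfrak B$ over $G^0$, closed ideals $D_g\subseteq\mathfrak B_{r(g)}$ and *-isomorphisms $\alpha_g\colon D_{g^{-1}}\to D_g$ for $g\in G$, and unitary multipliers $w(g,h)$ of $D_g\cap D_{gh}$ for $(g,h)\in G^2$, such that * $D_{u(x)}=\mathfrak B_x$ and $\alpha_{u(x)}=\mathrm{id}$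 for $x\in G^0$, and $w(g,u(s(g)))=1$ and $w(u(r(g)),g)=1$ for $g\in G$; * $\alpha_g(D_{g^{-1}}\cap D_h)\subseteq D_{gh}$ for $(g,h)\in G^2$; * $\alpha_g(\alpha_h(a))=w(g,h)\,\alpha_{gh}(a)\,w(g,h)^*$ for $(g,h)\in G^2$ and $a\in\alpha_{h^{-1}}(D_{g^{-1}}\cap D_h)$; * $\alpha_g(a\,w(h,k))\,w(g,hk)=\alpha_g(a)\,w(g,h)\,w(gh,k)$ for composable $g,h,k$ and $a\in D_{g^{-1}}\cap D_h\cap D_{hk}$; * $(D_g)_{g\in G}$ is a continuous field of ideals $D$ in $r^*\mathfrak B$; the maps $\alpha_g$ form an isomorphism of fields $\mathrm{inv}^*D\cong D$, where $\mathrm{inv}$ is the inversion of $G$; and pointwise multiplication on the left and on the right by the $w(g,h)$ maps $\mathrm C_0$-sections over $G^2$ of the field of ideals $(D_g\cap D_{gh})_{(g,h)}$ to $\mathrm C_0$-sections. It is a twisted action if $D_g=\mathfrak B_{r(g)}$ for all $g\in G$. The Fell bundle defined by it has the underlying field $D$, the multiplication $a\cdot b=\alpha_g(\alpha_g^{-1}(a)\,b)\,w(g,h)$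 for $a\in D_g$, $b\in D_h$, and the involution $D_g\ni a\mapsto\alpha_g^{-1}(a^*)\,w(g^{-1},g)^*\in D_{g^{-1}}$. **Theorem.** Let $\mathcal A$ be a Fell bundle over $G$ with restriction $\mathfrak A$ to the units. 1. The following are equivalent: (a) $\mathcal A$ is isomorphic to the Fell bundle defined by a twisted partial action of $G$; (b) $\mathcal A$ is isomorphic to a continuous field of ideals in $r^*\mathfrak A$ as a field of left Hilbert $r^*\mathfrak A$-modules; (c) $\mathcal A$ is isomorphic to a continuous field of ideals in $s^*\mathfrak A$ as a field of right Hilbert $s^*\mathfrak A$-modules. 2. The following are equivalent: (a) $\mathcal A$ is isomorphic to the Fell bundle defined by a twisted action of $G$; (b) $\mathcal A$ is isomorphic to $r^*\mathfrak A$ as a field of left Hilbert $r^*\mathfrak A$-modules; (c) $\mathcal A$ is isomorphic to $s^*\mathfrak A$ as a field of right Hilbert $s^*\mathfrak A$-modules. -/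

import Mathlib

open scoped Topology MultiplierAlgebra
open Filter

universe uG uX uY w w'

/-! ### Fields of Banach spaces and of C*-algebras -/

/-- The total space of a family `B` of sets over `X`.  It carries no topology by default: the
topology on the total space is part of the data of a field of Banach spaces. -/
@[ext] structure Tot {X : Type uX} (B : X → Type w) where
  base : X
  val : B base

/-- The pull-back topology: the total space of the pull-back of `B` along `f : Y → X` is the fibre
product of `Y` and `Tot B` over `X`, with the subspace topology from `Y × Tot B`. -/
@[reducible] def pullbackTop {X : Type uX} {Y : Type uY} [TopologicalSpace Y] (f : Y → X) (B : X → Type w)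
    [TopologicalSpace (Tot B)] : TopologicalSpace (Tot fun y => B (f y)) :=
  TopologicalSpace.induced (fun p => (p.base, (⟨f p.base, p.val⟩ : Tot B))) inferInstance

/-- The fibre product of the total space with itself over `X`, as a set of triples `(x, a, b)` with
`a, b ∈ B x`, with the subspace topology from `Tot B × Tot B`. -/
@[reducible] def pairTop {X : Type uX} (B : X → Type w) [TopologicalSpace (Tot B)] :
    TopologicalSpace (Tot fun x => B x × B x) :=
  TopologicalSpace.induced
    (fun p => ((⟨p.base, p.val.1⟩ : Tot B), (⟨p.base, p.val.2⟩ : Tot B))) inferInstance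

/-- `σ` is a continuous section of the pull-back of `B` along `f` (take `f = id` for sections of
`B` itself). -/
def IsContSection {X : Type uX} {Y : Type uY} [TopologicalSpace Y] (f : Y → X) (B : X → Type w)
    [TopologicalSpace (Tot B)] (σ : ∀ y, B (f y)) : Prop :=
  Continuous fun y => (⟨f y, σ y⟩ : Tot B)

/-- A `C₀`-section: a continuous section whose norm vanishes at infinity. -/
def IsC0Section {X : Type uX} {Y : Type uY} [TopologicalSpace Y] (f : Y → X) (B : X → Type w)
    [∀ x, Norm (B x)] [TopologicalSpace (Tot B)] (σ : ∀ y, B (f y)) : Prop :=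
  IsContSection f B σ ∧ Tendsto (fun y => ‖σ y‖) (cocompact Y) (𝓝 0)

/-- The family `B` of normed spaces with the given topology on the total space is an upper
semicontinuous field of Banach spaces over `X`.  The last condition, that there are enough
continuous sections, is automatic when `X` is locally compact and Hausdorff (theorem of Hofmann and
Lazar); it also belongs to the description of a field through its continuous sections. -/
structure IsBanachField {X : Type uX} [TopologicalSpace X] (B : X → Type w)
    [∀ x, NormedAddCommGroup (B x)] [∀ x, NormedSpace ℂ (B x)] [TopologicalSpace (Tot B)] :
    Prop where
  complete : ∀ x, CompleteSpace (B x)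
  continuous_base : Continuous (Tot.base : Tot B → X)
  isOpenMap_base : IsOpenMap (Tot.base : Tot B → X)
  continuous_add : @Continuous _ _ (pairTop B) _
    fun p : Tot (fun x => B x × B x) => (⟨p.base, p.val.1 + p.val.2⟩ : Tot B)
  continuous_smul : Continuous fun p : ℂ × Tot B => (⟨p.2.base, p.1 • p.2.val⟩ : Tot B)
  usc_norm : UpperSemicontinuous fun p : Tot B => ‖p.val‖
  /-- If `x_i → x` and `‖b_i‖ → 0` for `b_i ∈ B x_i`, then `b_i → 0 ∈ B x`. -/
  nhds_zero : ∀ x, comap (Tot.base : Tot B → X) (𝓝 x) ⊓ comap (fun p : Tot B => ‖p.val‖) (𝓝 0)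
    ≤ 𝓝 (⟨x, 0⟩ : Tot B)
  exists_section : ∀ x (b : B x), ∃ σ : ∀ y, B y, IsContSection id B σ ∧ σ x = b

/-- The family `B` of C*-algebras with the given topology on the total space is an upper
semicontinuous field of C*-algebras over `X`. -/
structure IsCStarField {X : Type uX} [TopologicalSpace X] (B : X → Type w)
    [∀ x, NonUnitalCStarAlgebra (B x)] [TopologicalSpace (Tot B)] : Prop
    extends IsBanachField B where
  continuous_mul : @Continuous _ _ (pairTop B) _
    fun p : Tot (fun x => B x × B x) => (⟨p.base, p.val.1 * p.val.2⟩ : Tot B)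
  continuous_star : Continuous fun p : Tot B => (⟨p.base, star p.val⟩ : Tot B)

/-! ### Ideals and their multipliers -/

/-- A closed two-sided (hence self-adjoint) ideal of a C*-algebra. -/
structure ClosedIdeal (B : Type w) [NonUnitalCStarAlgebra B] extends
    NonUnitalStarSubalgebra ℂ B where
  mul_mem_left : ∀ b a : B, a ∈ carrier → b * a ∈ carrier
  mul_mem_right : ∀ a b : B, a ∈ carrier → a * b ∈ carrier
  isClosed : IsClosed carrier

namespace ClosedIdeal

variable {B : Type w} [NonUnitalCStarAlgebra B]

theorem toSub_injective : Function.Injective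
    (ClosedIdeal.toNonUnitalStarSubalgebra : ClosedIdeal B → NonUnitalStarSubalgebra ℂ B) := by
  rintro ⟨I, _, _, _⟩ ⟨J, _, _, _⟩ h
  cases h
  rfl

instance : SetLike (ClosedIdeal B) B where
  coe I := I.carrier
  coe_injective := fun _ _ h => toSub_injective (SetLike.coe_injective h)

instance : NonUnitalSubringClass (ClosedIdeal B) B where
  add_mem {I} := I.add_mem'
  zero_mem I := I.zero_mem'
  mul_mem {I} := I.mul_mem'
  neg_mem {I} _ ha := neg_mem (S := NonUnitalStarSubalgebra ℂ B)
    (s := I.toNonUnitalStarSubalgebra) ha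

instance : SMulMemClass (ClosedIdeal B) ℂ B where
  smul_mem {I} c _ ha := I.smul_mem' c ha

instance : StarMemClass (ClosedIdeal B) B where
  star_mem {I} _ ha := I.star_mem' ha

instance (I : ClosedIdeal B) : IsClosed (I : Set B) := I.isClosed

/-- The intersection of two closed ideals. -/
instance : Min (ClosedIdeal B) where
  min I J :=
    { toNonUnitalStarSubalgebra := I.toNonUnitalStarSubalgebra ⊓ J.toNonUnitalStarSubalgebra
      mul_mem_left := fun b a h => ⟨I.mul_mem_left b a h.1, J.mul_mem_left b a h.2⟩
      mul_mem_right := fun a b h => ⟨I.mul_mem_right a b h.1, J.mul_mem_right a b h.2⟩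
      isClosed := I.isClosed.inter J.isClosed }

/-- The whole C*-algebra as an ideal in itself. -/
instance : Top (ClosedIdeal B) where
  top :=
    { toNonUnitalStarSubalgebra := ⊤
      mul_mem_left := fun _ _ _ => trivial
      mul_mem_right := fun _ _ _ => trivial
      isClosed := isClosed_univ }

theorem mem_inf {I J : ClosedIdeal B} {b : B} : b ∈ I ⊓ J ↔ b ∈ I ∧ b ∈ J := Iff.rfl

open Classical in
/-- Left multiplication `m · b` of an element `b` of the ideal `I` by a multiplier `m` of `I`
(with value `0` if `b ∉ I`; this case never matters). -/
noncomputable def lmul (I : ClosedIdeal B) (m : 𝓜(ℂ, I)) (b : B) : B :=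
  if h : b ∈ I then (m.fst ⟨b, h⟩ : I) else 0

open Classical in
/-- Right multiplication `b · m` of an element `b` of the ideal `I` by a multiplier `m` of `I`
(with value `0` if `b ∉ I`; this case never matters). -/
noncomputable def rmul (I : ClosedIdeal B) (m : 𝓜(ℂ, I)) (b : B) : B :=
  if h : b ∈ I then (m.snd ⟨b, h⟩ : I) else 0

theorem rmul_mem (I : ClosedIdeal B) (m : 𝓜(ℂ, I)) (b : B) : I.rmul m b ∈ I := by
  unfold rmul
  split
  · exact SetLike.coe_mem _
  · exact zero_mem I

end ClosedIdeal

/-- A family of closed ideals `D y` in the fibres `B (f y)` of the pull-back of `B` along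
`f : Y → X`.  Transport along equalities `f y = x` is built in: `D y h` is the ideal of `B x`
that corresponds to `D y rfl`. -/
abbrev IdealFamily {X : Type uX} {Y : Type uY} (f : Y → X) (B : X → Type w)
    [∀ x, NonUnitalCStarAlgebra (B x)] :=
  ∀ (y : Y) ⦃x : X⦄, f y = x → ClosedIdeal (B x)

namespace IdealFamily

variable {X : Type uX} {Y : Type uY} {f : Y → X} {B : X → Type w}
  [∀ x, NonUnitalCStarAlgebra (B x)]

/-- The fibres of a family of ideals. -/
abbrev Fib (D : IdealFamily f B) (y : Y) : Type w := ↥(D y rfl)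

/-- The family is continuous: each element of an ideal extends to a continuous section of the
pull-back of `B` with values in the ideals. -/
def IsCont [TopologicalSpace Y] [TopologicalSpace (Tot B)] (D : IdealFamily f B) : Prop :=
  ∀ (y : Y) (a : B (f y)), a ∈ D y rfl →
    ∃ σ : ∀ z, B (f z), IsContSection f B σ ∧ σ y = a ∧ ∀ z, σ z ∈ D z rfl

/-- The topology on the total space of a family of ideals: the subspace topology from the total
space of the pull-back of `B`. -/
@[reducible] def totTop [TopologicalSpace Y] [TopologicalSpace (Tot B)] (D : IdealFamily f B) :
    TopologicalSpace (Tot D.Fib) :=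
  TopologicalSpace.induced (fun p => (⟨p.base, (p.val : B (f p.base))⟩ : Tot fun y => B (f y)))
    (pullbackTop f B)

/-- The family consisting of the whole fibres: this is the pull-back of `B` itself. -/
def whole (f : Y → X) (B : X → Type w) [∀ x, NonUnitalCStarAlgebra (B x)] : IdealFamily f B :=
  fun _ _ _ => ⊤

end IdealFamily

/-! ### Topological groupoids -/

/-- A topological groupoid with arrow space `G` and object space `X`.  The product `g * h` is
defined if the source of `g` is the range of `h`. -/
structure TopGroupoid (G : Type uG) (X : Type uX) [TopologicalSpace G] [TopologicalSpace X] where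
  r : G → X
  s : G → X
  u : X → G
  inv : G → G
  mul : ∀ g h : G, s g = r h → G
  r_u : ∀ x, r (u x) = x
  s_u : ∀ x, s (u x) = x
  r_inv : ∀ g, r (inv g) = s g
  s_inv : ∀ g, s (inv g) = r g
  r_mul : ∀ g h (c : s g = r h), r (mul g h c) = r g
  s_mul : ∀ g h (c : s g = r h), s (mul g h c) = s h
  mul_assoc : ∀ g h k (c : s g = r h) (d : s h = r k),
    mul (mul g h c) k ((s_mul g h c).trans d) = mul g (mul h k d) (c.trans (r_mul h k d).symm)
  u_mul : ∀ g, mul (u (r g)) g (s_u (r g)) = g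
  mul_u : ∀ g, mul g (u (s g)) (r_u (s g)).symm = g
  inv_mul : ∀ g, mul (inv g) g (s_inv g) = u (s g)
  mul_inv : ∀ g, mul g (inv g) (r_inv g).symm = u (r g)
  continuous_r : Continuous r
  continuous_s : Continuous s
  continuous_u : Continuous u
  continuous_inv : Continuous inv
  continuous_mul : Continuous fun p : {p : G × G // s p.1 = r p.2} => mul p.1.1 p.1.2 p.2

namespace TopGroupoid

variable {G : Type uG} {X : Type uX} [TopologicalSpace G] [TopologicalSpace X]
  (𝒢 : TopGroupoid G X)

/-- `g` and `h` are composable and `k` is their product. -/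
def IsComp (g h k : G) : Prop := ∃ c : 𝒢.s g = 𝒢.r h, 𝒢.mul g h c = k

/-- The space `G²` of composable pairs. -/
abbrev Pairs := {p : G × G // 𝒢.s p.1 = 𝒢.r p.2}

variable {𝒢}

theorem inv_eq {g h : G} {x : X} (h1 : 𝒢.IsComp g h (𝒢.u x)) : h = 𝒢.inv g := by
  obtain ⟨c, hc⟩ := h1
  have hr : 𝒢.r g = x := by rw [← 𝒢.r_mul g h c, hc, 𝒢.r_u]
  have hs : 𝒢.s h = x := by rw [← 𝒢.s_mul g h c, hc, 𝒢.s_u]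
  subst hr
  have key := 𝒢.mul_assoc (𝒢.inv g) g h (𝒢.s_inv g) c
  have e1 : 𝒢.mul (𝒢.mul (𝒢.inv g) g (𝒢.s_inv g)) h
      ((𝒢.s_mul _ _ _).trans c) = h := by
    have : ∀ (k : G) (hk : k = 𝒢.u (𝒢.r h)) (c' : 𝒢.s k = 𝒢.r h), 𝒢.mul k h c' = h := by
      rintro k rfl c'
      exact 𝒢.u_mul h
    exact this _ (by rw [𝒢.inv_mul, c]) _
  have e2 : 𝒢.mul (𝒢.inv g) (𝒢.mul g h c) ((𝒢.s_inv g).trans (𝒢.r_mul g h c).symm)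
      = 𝒢.inv g := by
    have : ∀ (k : G) (hk : k = 𝒢.u (𝒢.s (𝒢.inv g))) (c' : 𝒢.s (𝒢.inv g) = 𝒢.r k),
        𝒢.mul (𝒢.inv g) k c' = 𝒢.inv g := by
      rintro k rfl c'
      exact 𝒢.mul_u _
    exact this _ (by rw [hc, 𝒢.s_inv]) _
  rw [e1, e2] at key
  exact key

theorem comp_u_left (g : G) : 𝒢.IsComp (𝒢.u (𝒢.r g)) g g := ⟨𝒢.s_u _, 𝒢.u_mul g⟩

theorem comp_u_right (g : G) : 𝒢.IsComp g (𝒢.u (𝒢.s g)) g := ⟨(𝒢.r_u _).symm, 𝒢.mul_u g⟩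

theorem comp_mul_inv (g : G) : 𝒢.IsComp g (𝒢.inv g) (𝒢.u (𝒢.r g)) :=
  ⟨(𝒢.r_inv g).symm, 𝒢.mul_inv g⟩

theorem comp_inv_mul (g : G) : 𝒢.IsComp (𝒢.inv g) g (𝒢.u (𝒢.s g)) :=
  ⟨𝒢.s_inv g, 𝒢.inv_mul g⟩

theorem comp_u_u (x : X) : 𝒢.IsComp (𝒢.u x) (𝒢.u x) (𝒢.u x) := by
  have h := comp_u_left (𝒢 := 𝒢) (𝒢.u x)
  rwa [𝒢.r_u] at h

theorem u_eq_inv (x : X) : 𝒢.u x = 𝒢.inv (𝒢.u x) := inv_eq (comp_u_u x)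

theorem IsComp.r_eq {g h k : G} (c : 𝒢.IsComp g h k) : 𝒢.r k = 𝒢.r g := by
  obtain ⟨c, rfl⟩ := c
  exact 𝒢.r_mul g h c

end TopGroupoid

/-! ### Fell bundles -/

/-- The data of a Fell bundle, without its laws: normed spaces `fib g`, a topology on their total
space, multiplication maps `fib g × fib h → fib (g * h)` and involutions `fib g → fib g⁻¹`.
The index of the target fibre is a variable `k` with a proof of `k = g * h` or `k = g⁻¹`, so that
the laws need no transport between fibres. -/
structure FellData {G : Type uG} {X : Type uX} [TopologicalSpace G] [TopologicalSpace X]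
    (𝒢 : TopGroupoid G X) where
  fib : G → Type w
  [instNACG : ∀ g, NormedAddCommGroup (fib g)]
  [instNS : ∀ g, NormedSpace ℂ (fib g)]
  [instTop : TopologicalSpace (Tot fib)]
  mul : ∀ {g h k : G}, 𝒢.IsComp g h k → fib g → fib h → fib k
  star : ∀ {g k : G}, k = 𝒢.inv g → fib g → fib k

attribute [instance] FellData.instNACG FellData.instNS FellData.instTop

/-- A (possibly unsaturated, upper semicontinuous) Fell bundle over a groupoid. -/
structure FellBundle {G : Type uG} {X : Type uX} [TopologicalSpace G] [TopologicalSpace X]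
    (𝒢 : TopGroupoid G X) extends FellData.{uG, uX, w} 𝒢 where
  isBanachField : IsBanachField fib
  add_mul : ∀ {g h k : G} (c : 𝒢.IsComp g h k) (a a' : fib g) (b : fib h),
    mul c (a + a') b = mul c a b + mul c a' b
  mul_add : ∀ {g h k : G} (c : 𝒢.IsComp g h k) (a : fib g) (b b' : fib h),
    mul c a (b + b') = mul c a b + mul c a b'
  smul_mul : ∀ {g h k : G} (c : 𝒢.IsComp g h k) (z : ℂ) (a : fib g) (b : fib h),
    mul c (z • a) b = z • mul c a b
  mul_smul : ∀ {g h k : G} (c : 𝒢.IsComp g h k) (z : ℂ) (a : fib g) (b : fib h),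
    mul c a (z • b) = z • mul c a b
  star_add : ∀ {g k : G} (i : k = 𝒢.inv g) (a b : fib g), star i (a + b) = star i a + star i b
  star_smul : ∀ {g k : G} (i : k = 𝒢.inv g) (z : ℂ) (a : fib g),
    star i (z • a) = (starRingEnd ℂ z) • star i a
  mul_assoc : ∀ {g h k gh hk ghk : G} (c : 𝒢.IsComp g h gh) (d : 𝒢.IsComp gh k ghk)
    (c' : 𝒢.IsComp h k hk) (d' : 𝒢.IsComp g hk ghk) (a₁ : fib g) (a₂ : fib h) (a₃ : fib k),
    mul d (mul c a₁ a₂) a₃ = mul d' a₁ (mul c' a₂ a₃)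
  star_mul : ∀ {g h k g' h' k' : G} (c : 𝒢.IsComp g h k) (c' : 𝒢.IsComp h' g' k')
    (ig : g' = 𝒢.inv g) (ih : h' = 𝒢.inv h) (ik : k' = 𝒢.inv k) (a : fib g) (b : fib h),
    star ik (mul c a b) = mul c' (star ih b) (star ig a)
  star_star : ∀ {g k : G} (i : k = 𝒢.inv g) (i' : g = 𝒢.inv k) (a : fib g),
    star i' (star i a) = a
  norm_mul_le : ∀ {g h k : G} (c : 𝒢.IsComp g h k) (a : fib g) (b : fib h),
    ‖mul c a b‖ ≤ ‖a‖ * ‖b‖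
  norm_star_mul : ∀ {g : G} (a : fib g),
    ‖mul (𝒢.comp_inv_mul g) (star rfl a) a‖ = ‖a‖ ^ 2
  pos : ∀ {g : G} (a : fib g), ∃ b : fib (𝒢.u (𝒢.s g)),
    mul (𝒢.comp_u_u (𝒢.s g)) (star (𝒢.u_eq_inv _) b) b = mul (𝒢.comp_inv_mul g) (star rfl a) a
  continuous_mul : Continuous
    fun p : {p : Tot fib × Tot fib // 𝒢.s p.1.base = 𝒢.r p.2.base} =>
      (⟨𝒢.mul p.1.1.base p.1.2.base p.2, mul ⟨p.2, rfl⟩ p.1.1.val p.1.2.val⟩ : Tot fib)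
  continuous_star : Continuous fun p : Tot fib => (⟨𝒢.inv p.base, star rfl p.val⟩ : Tot fib)

/-- An isomorphism of Fell bundles (formulated for the underlying data): fibrewise linear isometric
isomorphisms that form a homeomorphism of the total spaces and preserve multiplication and
involution. -/
structure FellData.Iso {G : Type uG} {X : Type uX} [TopologicalSpace G] [TopologicalSpace X]
    {𝒢 : TopGroupoid G X} (A : FellData.{uG, uX, w} 𝒢) (A' : FellData.{uG, uX, w'} 𝒢) where
  φ : ∀ g, A.fib g ≃ₗᵢ[ℂ] A'.fib g
  map_mul : ∀ {g h k : G} (c : 𝒢.IsComp g h k) (a : A.fib g) (b : A.fib h),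
    φ k (A.mul c a b) = A'.mul c (φ g a) (φ h b)
  map_star : ∀ {g k : G} (i : k = 𝒢.inv g) (a : A.fib g), φ k (A.star i a) = A'.star i (φ g a)
  continuous_toFun : Continuous fun p : Tot A.fib => (⟨p.base, φ p.base p.val⟩ : Tot A'.fib)
  continuous_invFun : Continuous
    fun p : Tot A'.fib => (⟨p.base, (φ p.base).symm p.val⟩ : Tot A.fib)

namespace FellBundle

variable {G : Type uG} {X : Type uX} [TopologicalSpace G] [TopologicalSpace X]
  {𝒢 : TopGroupoid G X} (A : FellBundle.{uG, uX, w} 𝒢)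

/-- The fibre of the Fell bundle at a unit. -/
def UFib (x : X) : Type w := A.fib (𝒢.u x)

instance (x : X) : NormedAddCommGroup (A.UFib x) := A.instNACG (𝒢.u x)

instance (x : X) : NormedSpace ℂ (A.UFib x) := A.instNS (𝒢.u x)

/-- The unit fibres are C*-algebras: the norm and vector space structure are those of the fibre,
the multiplication and the involution are those of the Fell bundle. -/
noncomputable instance instUFib (x : X) : NonUnitalCStarAlgebra (A.UFib x) where
  toNorm := inferInstance
  toAddCommGroup := NormedAddCommGroup.toAddCommGroup
  toMetricSpace := NormedAddCommGroup.toMetricSpace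
  dist_eq := NormedAddCommGroup.dist_eq
  mul a b := A.mul (𝒢.comp_u_u x) a b
  left_distrib := A.mul_add _
  right_distrib := A.add_mul _
  zero_mul b := by
    have h := A.smul_mul (𝒢.comp_u_u x) 0 0 b
    rwa [zero_smul, zero_smul] at h
  mul_zero a := by
    have h := A.mul_smul (𝒢.comp_u_u x) 0 a 0
    rwa [zero_smul, zero_smul] at h
  mul_assoc := A.mul_assoc _ _ _ _
  norm_mul_le := A.norm_mul_le _
  star a := A.star (𝒢.u_eq_inv x) a
  star_involutive := A.star_star _ _
  star_mul := A.star_mul _ _ _ _ _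
  star_add := A.star_add _
  complete := (A.isBanachField.complete (𝒢.u x)).complete
  norm_mul_self_le a := by
    have key : ∀ (y : X) (hy : x = y) (i : G) (hi : 𝒢.u x = i) (e : i = 𝒢.inv (𝒢.u x))
        (c : 𝒢.IsComp i (𝒢.u x) (𝒢.u y)),
        ‖A.mul (𝒢.comp_u_u x) (A.star (𝒢.u_eq_inv x) a) a‖ = ‖A.mul c (A.star e a) a‖ := by
      rintro y rfl i rfl e c
      rfl
    have h := key (𝒢.s (𝒢.u x)) (𝒢.s_u x).symm _ (𝒢.u_eq_inv x) rfl (𝒢.comp_inv_mul _)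
    have h2 := A.norm_star_mul a
    change ‖a‖ * ‖a‖ ≤ ‖A.mul (𝒢.comp_u_u x) (A.star (𝒢.u_eq_inv x) a) a‖
    rw [h, h2, sq]
    exact le_rfl
  smul := fun z a => z • a
  one_smul := one_smul ℂ
  mul_smul := fun y z (a : A.UFib x) => SemigroupAction.mul_smul y z a
  smul_zero := smul_zero
  smul_add := smul_add
  add_smul := fun y z (a : A.UFib x) => Module.add_smul y z a
  zero_smul := zero_smul ℂ
  norm_smul_le := NormedSpace.norm_smul_le
  smul_assoc z a b := A.smul_mul _ z a b
  smul_comm z a b := (A.mul_smul _ z a b).symm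
  star_smul z a := A.star_smul _ z a

/-- The topology on the restriction of the Fell bundle to the units. -/
instance instTopUFib : TopologicalSpace (Tot A.UFib) := pullbackTop 𝒢.u A.fib

/-- An isomorphism of fields of left Hilbert modules from the Fell bundle `A`, with the left inner
product `(a, b) ↦ a * b⋆`, to a family `D` of ideals in the pull-back along `r` of the field
of unit fibres, also with the inner product `(a, b) ↦ a * b⋆`. -/
structure LeftIso (D : IdealFamily 𝒢.r A.UFib) where
  ψ : ∀ g, A.fib g ≃ₗ[ℂ] D.Fib g
  map_smul : ∀ (g : G) (c : A.UFib (𝒢.r g)) (a : A.fib g),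
    (ψ g (A.mul (𝒢.comp_u_left g) c a) : A.UFib (𝒢.r g)) = c * ψ g a
  map_inner : ∀ (g : G) (a b : A.fib g),
    (ψ g a : A.UFib (𝒢.r g)) * star (ψ g b : A.UFib (𝒢.r g))
      = A.mul (𝒢.comp_mul_inv g) a (A.star rfl b)
  continuous_toFun : Continuous[A.instTop, D.totTop]
    fun p : Tot A.fib => (⟨p.base, ψ p.base p.val⟩ : Tot D.Fib)
  continuous_invFun : Continuous[D.totTop, A.instTop]
    fun p : Tot D.Fib => (⟨p.base, (ψ p.base).symm p.val⟩ : Tot A.fib)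

/-- An isomorphism of fields of right Hilbert modules from the Fell bundle `A`, with the right inner
product `(a, b) ↦ a⋆ * b`, to a family `D` of ideals in the pull-back along `s` of the field
of unit fibres, also with the inner product `(a, b) ↦ a⋆ * b`. -/
structure RightIso (D : IdealFamily 𝒢.s A.UFib) where
  ψ : ∀ g, A.fib g ≃ₗ[ℂ] D.Fib g
  map_smul : ∀ (g : G) (a : A.fib g) (c : A.UFib (𝒢.s g)),
    (ψ g (A.mul (𝒢.comp_u_right g) a c) : A.UFib (𝒢.s g)) = ψ g a * c
  map_inner : ∀ (g : G) (a b : A.fib g),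
    star (ψ g a : A.UFib (𝒢.s g)) * (ψ g b : A.UFib (𝒢.s g))
      = A.mul (𝒢.comp_inv_mul g) (A.star rfl a) b
  continuous_toFun : Continuous[A.instTop, D.totTop]
    fun p : Tot A.fib => (⟨p.base, ψ p.base p.val⟩ : Tot D.Fib)
  continuous_invFun : Continuous[D.totTop, A.instTop]
    fun p : Tot D.Fib => (⟨p.base, (ψ p.base).symm p.val⟩ : Tot A.fib)

end FellBundle

/-! ### Twisted partial actions -/

/-- The underlying data of a twisted partial action: a field of C*-algebras `B` over the objects,
ideals `D g` in the fibres `B (r g)`, isomorphisms `D g⁻¹ ≃ D g`, and unitary multipliers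
`w(g, h)` of the ideals `D g ∩ D (g * h)`.  As in `IdealFamily`, indices may be replaced by equal
ones. -/
structure TwistedPartialActionData {G : Type uG} {X : Type uX} [TopologicalSpace G]
    [TopologicalSpace X] (𝒢 : TopGroupoid G X) where
  B : X → Type w
  [instCStar : ∀ x, NonUnitalCStarAlgebra (B x)]
  [instTop : TopologicalSpace (Tot B)]
  isCStarField : IsCStarField B
  D : IdealFamily 𝒢.r B
  α : ∀ ⦃g g' : G⦄ ⦃x y : X⦄, g' = 𝒢.inv g → ∀ (hx : 𝒢.r g' = x) (hy : 𝒢.r g = y),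
    D g' hx ≃⋆ₐ[ℂ] D g hy
  w : ∀ ⦃g h k : G⦄ ⦃y : X⦄, 𝒢.IsComp g h k → ∀ (hg : 𝒢.r g = y) (hk : 𝒢.r k = y),
    unitary 𝓜(ℂ, ↥(D g hg ⊓ D k hk))

attribute [instance] TwistedPartialActionData.instCStar TwistedPartialActionData.instTop

namespace TwistedPartialActionData

variable {G : Type uG} {X : Type uX} [TopologicalSpace G] [TopologicalSpace X]
  {𝒢 : TopGroupoid G X} (T : TwistedPartialActionData.{uG, uX, w} 𝒢)

open Classical in
/-- The partial map `α g : B (s g) ⊇ D g⁻¹ → D g ⊆ B (r g)`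
(with value `0` outside its domain; this case never matters). -/
noncomputable def act {g g' : G} {x y : X} (i : g' = 𝒢.inv g) (hx : 𝒢.r g' = x)
    (hy : 𝒢.r g = y) (a : T.B x) : T.B y :=
  if h : a ∈ T.D g' hx then (T.α i hx hy ⟨a, h⟩ : T.D g hy) else 0

open Classical in
/-- The inverse partial map `(α g)⁻¹ : B (r g) ⊇ D g → D g⁻¹ ⊆ B (s g)`
(with value `0` outside its domain; this case never matters). -/
noncomputable def actInv {g g' : G} {x y : X} (i : g' = 𝒢.inv g) (hx : 𝒢.r g' = x)
    (hy : 𝒢.r g = y) (a : T.B y) : T.B x :=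
  if h : a ∈ T.D g hy then ((T.α i hx hy).symm ⟨a, h⟩ : T.D g' hx) else 0

/-- The product `w(g, h) · b` for `b ∈ D g ∩ D (g * h)`. -/
noncomputable def wmul {g h k : G} {y : X} (c : 𝒢.IsComp g h k) (hg : 𝒢.r g = y)
    (hk : 𝒢.r k = y) (b : T.B y) : T.B y :=
  (T.D g hg ⊓ T.D k hk).lmul (T.w c hg hk : 𝓜(ℂ, ↥(T.D g hg ⊓ T.D k hk))) b

/-- The product `b · w(g, h)` for `b ∈ D g ∩ D (g * h)`. -/
noncomputable def mulw {g h k : G} {y : X} (c : 𝒢.IsComp g h k) (hg : 𝒢.r g = y)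
    (hk : 𝒢.r k = y) (b : T.B y) : T.B y :=
  (T.D g hg ⊓ T.D k hk).rmul (T.w c hg hk : 𝓜(ℂ, ↥(T.D g hg ⊓ T.D k hk))) b

/-- The product `b · w(g, h)⋆` for `b ∈ D g ∩ D (g * h)`. -/
noncomputable def mulwStar {g h k : G} {y : X} (c : 𝒢.IsComp g h k) (hg : 𝒢.r g = y)
    (hk : 𝒢.r k = y) (b : T.B y) : T.B y :=
  (T.D g hg ⊓ T.D k hk).rmul (star (T.w c hg hk : 𝓜(ℂ, ↥(T.D g hg ⊓ T.D k hk)))) b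

/-- The family of ideals `D g⁻¹` in the fibres `B (r g⁻¹)`, the pull-back of `D` along inversion. -/
def invD : IdealFamily (fun g => 𝒢.r (𝒢.inv g)) T.B := fun g _ h => T.D (𝒢.inv g) h

/-- The family of ideals `D g ∩ D (g * h)` in the fibres `B (r g)` over the space of composable
pairs. -/
def J : IdealFamily (fun p : 𝒢.Pairs => 𝒢.r p.1.1) T.B :=
  fun p _ h => T.D p.1.1 h ⊓ T.D (𝒢.mul p.1.1 p.1.2 p.2) ((𝒢.r_mul _ _ _).trans h)

end TwistedPartialActionData

/-- A twisted partial action of a topological groupoid. -/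
structure TwistedPartialAction {G : Type uG} {X : Type uX} [TopologicalSpace G]
    [TopologicalSpace X] (𝒢 : TopGroupoid G X)
    extends TwistedPartialActionData.{uG, uX, w} 𝒢 where
  D_unit : ∀ (x : X) (h : 𝒢.r (𝒢.u x) = x), D (𝒢.u x) h = ⊤
  act_unit : ∀ (x : X) (i : 𝒢.u x = 𝒢.inv (𝒢.u x)) (h : 𝒢.r (𝒢.u x) = x) (a : B x),
    toTwistedPartialActionData.act i h h a = a
  w_unit_right : ∀ (g : G) (y : X) (hg : 𝒢.r g = y), w (𝒢.comp_u_right g) hg hg = 1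
  w_unit_left : ∀ (g : G) (y : X) (hu : 𝒢.r (𝒢.u (𝒢.r g)) = y) (hg : 𝒢.r g = y),
    w (𝒢.comp_u_left g) hu hg = 1
  /-- `α g (D g⁻¹ ∩ D h) ⊆ D (g * h)` -/
  act_mem : ∀ {g h k g' : G} {x y : X} (_ : 𝒢.IsComp g h k) (i : g' = 𝒢.inv g)
    (hx : 𝒢.r g' = x) (hh : 𝒢.r h = x) (hy : 𝒢.r g = y) (hk : 𝒢.r k = y) (a : B x),
    a ∈ D g' hx → a ∈ D h hh → toTwistedPartialActionData.act i hx hy a ∈ D k hk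
  /-- `α g (α h a) = w(g, h) · α (g * h) a · w(g, h)⋆` for `a = α h⁻¹ b` and `b ∈ D g⁻¹ ∩ D h`;
  here `g'`, `h'`, `k'` are the inverses of `g`, `h` and `k = g * h`. -/
  act_act : ∀ {g h k g' h' k' : G} {x y z : X} (c : 𝒢.IsComp g h k)
    (ig : g' = 𝒢.inv g) (ih : h' = 𝒢.inv h) (ih' : h = 𝒢.inv h') (ik : k' = 𝒢.inv k)
    (hg : 𝒢.r g = z) (hk : 𝒢.r k = z) (hg' : 𝒢.r g' = y) (hh : 𝒢.r h = y)
    (hh' : 𝒢.r h' = x) (hk' : 𝒢.r k' = x) (a : B x) (b : B y),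
    b ∈ D g' hg' → b ∈ D h hh → a = toTwistedPartialActionData.act ih' hh hh' b →
    toTwistedPartialActionData.act ig hg' hg (toTwistedPartialActionData.act ih hh' hh a)
      = toTwistedPartialActionData.wmul c hg hk
          (toTwistedPartialActionData.mulwStar c hg hk
            (toTwistedPartialActionData.act ik hk' hk a))
  /-- `α g (a · w(h, k)) · w(g, h * k) = α g a · w(g, h) · w(g * h, k)` for
  `a ∈ D g⁻¹ ∩ D h ∩ D (h * k)` -/
  cocycle : ∀ {g h k gh hk ghk g' : G} {x y : X} (c : 𝒢.IsComp g h gh) (d : 𝒢.IsComp gh k ghk)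
    (c' : 𝒢.IsComp h k hk) (d' : 𝒢.IsComp g hk ghk) (i : g' = 𝒢.inv g)
    (hg' : 𝒢.r g' = x) (hh : 𝒢.r h = x) (hhk : 𝒢.r hk = x)
    (hg : 𝒢.r g = y) (hgh : 𝒢.r gh = y) (hghk : 𝒢.r ghk = y) (a : B x),
    a ∈ D g' hg' → a ∈ D h hh → a ∈ D hk hhk →
    toTwistedPartialActionData.mulw d' hg hghk
        (toTwistedPartialActionData.act i hg' hg
          (toTwistedPartialActionData.mulw c' hh hhk a))
      = toTwistedPartialActionData.mulw d hgh hghk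
          (toTwistedPartialActionData.mulw c hg hgh
            (toTwistedPartialActionData.act i hg' hg a))
  D_cont : D.IsCont
  /-- The isomorphisms `α g` form an isomorphism of fields from the pull-back of `D` along inversion
  to `D`. -/
  continuous_act : Continuous[toTwistedPartialActionData.invD.totTop, D.totTop]
    fun p : Tot toTwistedPartialActionData.invD.Fib => (⟨p.base, α rfl rfl rfl p.val⟩ : Tot D.Fib)
  continuous_actInv : Continuous[D.totTop, toTwistedPartialActionData.invD.totTop]
    fun p : Tot D.Fib =>
      (⟨p.base, (α rfl rfl rfl).symm p.val⟩ : Tot toTwistedPartialActionData.invD.Fib)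
  /-- Pointwise left and right multiplication by the unitaries `w(g, h)` preserve the space of
  `C₀`-sections of the family of ideals `D g ∩ D (g * h)`, that is, these unitaries form a unitary
  multiplier of the C*-algebra of `C₀`-sections. -/
  w_cont : ∀ σ : ∀ p : 𝒢.Pairs, B (𝒢.r p.1.1), IsC0Section (fun p : 𝒢.Pairs => 𝒢.r p.1.1) B σ →
    (∀ p, σ p ∈ toTwistedPartialActionData.J p rfl) →
    IsC0Section (fun p : 𝒢.Pairs => 𝒢.r p.1.1) B
      (fun p => toTwistedPartialActionData.wmul ⟨p.2, rfl⟩ rfl (𝒢.r_mul _ _ p.2) (σ p)) ∧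
    IsC0Section (fun p : 𝒢.Pairs => 𝒢.r p.1.1) B
      (fun p => toTwistedPartialActionData.mulw ⟨p.2, rfl⟩ rfl (𝒢.r_mul _ _ p.2) (σ p))

namespace TwistedPartialAction

variable {G : Type uG} {X : Type uX} [TopologicalSpace G] [TopologicalSpace X]
  {𝒢 : TopGroupoid G X} (T : TwistedPartialAction.{uG, uX, w} 𝒢)

/-- A twisted action is a twisted partial action with `D g = B (r g)` for all `g`. -/
def IsGlobal : Prop := ∀ g, T.D g rfl = ⊤

/-- The Fell bundle associated to a twisted partial action.  Its fibres are the ideals `D g` with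
the subspace topology, and
`a * b = α g ((α g)⁻¹ a · b) · w(g, h)` for `a ∈ D g`, `b ∈ D h`, and
`a⋆ = (α g)⁻¹ (a⋆) · w(g⁻¹, g)⋆` for `a ∈ D g`. -/
noncomputable def fell : FellData.{uG, uX, w} 𝒢 where
  fib := T.D.Fib
  instTop := T.D.totTop
  mul {g h k} c a b :=
    ⟨T.mulw c c.r_eq.symm rfl
      (T.act rfl ((𝒢.r_inv g).trans c.1) c.r_eq.symm
        (T.actInv rfl ((𝒢.r_inv g).trans c.1) rfl (a : T.B (𝒢.r g)) * (b : T.B (𝒢.r h)))),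
      (ClosedIdeal.mem_inf.1 (ClosedIdeal.rmul_mem _ _ _)).2⟩
  star {g k} i a :=
    ⟨T.mulwStar (g := k) (h := g) (k := 𝒢.u (𝒢.s g)) (by rw [i]; exact 𝒢.comp_inv_mul g) rfl
      (by rw [𝒢.r_u, i, 𝒢.r_inv])
      (T.actInv i rfl rfl (star (a : T.B (𝒢.r g)))),
      (ClosedIdeal.mem_inf.1 (ClosedIdeal.rmul_mem _ _ _)).1⟩

end TwistedPartialAction

namespace FellBundle

variable {G : Type uG} {X : Type uX} [TopologicalSpace G] [TopologicalSpace X]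
  {𝒢 : TopGroupoid G X} (A : FellBundle.{uG, uX, w} 𝒢)

/-- `A` is isomorphic to the Fell bundle of a twisted partial action. -/
def IsFromTwistedPartialAction : Prop :=
  ∃ T : TwistedPartialAction.{uG, uX, w} 𝒢, Nonempty (A.toFellData.Iso T.fell)

/-- `A` is isomorphic to the Fell bundle of a twisted action. -/
def IsFromTwistedAction : Prop :=
  ∃ T : TwistedPartialAction.{uG, uX, w} 𝒢, T.IsGlobal ∧ Nonempty (A.toFellData.Iso T.fell)

end FellBundle

/-! ### C*-algebras, closed ideals and multipliers -/

/-! Taking adjoints, `a ↦ Ψ(a⋆)⋆`, exchanges left and right trivialisations (`toRightTriv`,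
`toLeftTriv`), so it suffices to study left ones: linear bijections `Ψ` from the fibre at `g` onto
an ideal `D_g` of the unit fibre at `r(g)`, with `Ψ(c a) = c Ψ(a)` and `Ψ(a) Ψ(b)⋆ = a b⋆`.

A Fell bundle defined by a twisted partial action has such a trivialisation because its fibres are
ideals. Its left module structure is the usual one since twists with a unit are trivial. Its left
inner product is the usual one since the cocycle identity for `(g, g⁻¹, g)` cancels the twist in the
involution against the twist in the product (`mulw_act_mulwStar`, `unitFun_inner`).

Conversely, let `Ψ` be given. Composing with the inverse of `Ψ` over the units makes it the identity
there (`normalize`). The identity `m (a⋆ b) = (m a⋆) b` gives `Ψ(m (a⋆ b)) = Ψ(m) Ψ(a)⋆ Ψ(b)`, so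
right multiplication by `a⋆ b` becomes right multiplication by `Ψ(a)⋆ Ψ(b)`. This defines `α_g(a⋆ b)
= Ψ(a)⋆ Ψ(b)` (`isAct_inner`, `actEquiv`). The families `Ψ(a Ψ(b))` and `Ψ(a b)` have the same left
inner products (`mulTriv_mul_star`) and both span `D_g ∩ D_{gh}`, so a unitary multiplier `w(g, h)`
carries the first to the second (`exists_unitary_multiplier`, `exists_twist`). The laws of a twisted
partial action follow by testing on these generators and using associativity in the bundle.
Continuity follows because sections of the bundle provide continuous families of generators, while
`α` and `w` are isometric (`tendsto_isAct`, `continuous_mulw`).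

No limits are needed in the spanning arguments: every element of a C*-algebra is a finite sum of
products (`CStarAlgebra.induction_mul`). -/

section CStar

variable {E : Type w} [NonUnitalCStarAlgebra E]

/-- The positive elements `y⋆ y` span a C*-algebra linearly, without closure. Spanning arguments
therefore work with finite sums of products. -/
theorem CStarAlgebra.induction_mul {p : E → Prop} (h0 : p 0)
    (hadd : ∀ a b, p a → p b → p (a + b)) (hmul : ∀ a b, p (a * b)) (c : E) : p c := by
  let _ := CStarAlgebra.spectralOrder E
  let _ := CStarAlgebra.spectralOrderedRing E
  have key : ∀ x ∈ Submodule.span ℂ {a : E | 0 ≤ a}, p x := by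
    intro x hx
    -- `p` is not assumed stable under scalars, so all multiples are treated at once; `z (y⋆ y) = (z
    -- y⋆) y` is again a product.
    have : ∀ z : ℂ, p (z • x) := by
      induction hx using Submodule.span_induction with
      | mem x hx =>
        intro z
        obtain ⟨y, rfl⟩ := CStarAlgebra.nonneg_iff_eq_star_mul_self.1 (Set.mem_ofPred_eq ▸ hx)
        rw [← smul_mul_assoc]
        exact hmul _ _
      | zero => intro z; rwa [smul_zero]
      | add x y _ _ hx hy => intro z; rw [smul_add]; exact hadd _ _ (hx z) (hy z)
      | smul a x _ hx => intro z; rw [smul_smul]; exact hx _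
    simpa using this 1
  exact key c (by rw [CStarAlgebra.span_nonneg]; trivial)

theorem eq_of_forall_mul_left {x y : E} (h : ∀ z, z * x = z * y) : x = y := by
  rw [← sub_eq_zero, ← CStarRing.star_mul_self_eq_zero_iff, mul_sub, h, sub_self]

theorem eq_of_forall_mul_right {x y : E} (h : ∀ z, x * z = y * z) : x = y := by
  rw [← sub_eq_zero, ← CStarRing.mul_star_self_eq_zero_iff, sub_mul, h, sub_self]

theorem norm_eq_of_mul_star_eq {F : Type w'} [NonUnitalCStarAlgebra F] {x : E} {y : F}
    (h : ‖x * star x‖ = ‖y * star y‖) : ‖x‖ = ‖y‖ := by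
  rw [CStarRing.norm_self_mul_star, CStarRing.norm_self_mul_star] at h
  exact (mul_self_inj (norm_nonneg _) (norm_nonneg _)).1 h

/-- Two spanning families with the same left inner products differ by a unitary multiplier. -/
theorem exists_unitary_multiplier {ι : Type*} (p q : ι → E)
    (hpq : ∀ i j, p i * star (p j) = q i * star (q j))
    (hp : Submodule.span ℂ (Set.range p) = ⊤) (hq : Submodule.span ℂ (Set.range q) = ⊤) :
    ∃ m : unitary 𝓜(ℂ, E), ∀ i, (m : 𝓜(ℂ, E)).snd (p i) = q i := by
  classical
  set P := Finsupp.linearCombination ℂ p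
  set Q := Finsupp.linearCombination ℂ q
  have hP : Function.Surjective P := by
    rw [← LinearMap.range_eq_top, Finsupp.range_linearCombination, hp]
  have hQ : Function.Surjective Q := by
    rw [← LinearMap.range_eq_top, Finsupp.range_linearCombination, hq]
  have inner : ∀ f f', P f * star (P f') = Q f * star (Q f') := by
    intro f f'
    simp only [P, Q, Finsupp.linearCombination_apply, Finsupp.sum, star_sum, star_smul,
      Finset.sum_mul_sum, smul_mul_smul_comm, hpq]
  -- Equal inner products give equal norms, hence equal kernels. So `P f ↦ Q f` is a well-defined
  -- isometry `R`, with inverse `S`.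
  have norm_eq : ∀ f, ‖P f‖ = ‖Q f‖ := fun f => norm_eq_of_mul_star_eq (by rw [inner])
  have hPQ : ∀ f f', P f = P f' ↔ Q f = Q f' := by
    intro f f'
    rw [← sub_eq_zero, ← map_sub, ← norm_eq_zero, norm_eq, norm_eq_zero, map_sub, sub_eq_zero]
  let R : E → E := fun x => Q (Function.surjInv hP x)
  let S : E → E := fun x => P (Function.surjInv hQ x)
  have hR : ∀ f, R (P f) = Q f := fun f => (hPQ _ _).1 (Function.surjInv_eq hP _)
  have hS : ∀ f, S (Q f) = P f := fun f => (hPQ _ _).2 (Function.surjInv_eq hQ _)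
  have RS : ∀ x, R (S x) = x := fun x => by obtain ⟨f, rfl⟩ := hQ x; rw [hS, hR]
  have SR : ∀ x, S (R x) = x := fun x => by obtain ⟨f, rfl⟩ := hP x; rw [hR, hS]
  let Rc : E →L[ℂ] E := LinearMap.mkContinuous
    { toFun := R
      map_add' := fun x y => by
        obtain ⟨f, rfl⟩ := hP x
        obtain ⟨f', rfl⟩ := hP y
        rw [← map_add, hR, hR, hR, map_add]
      map_smul' := fun z x => by
        obtain ⟨f, rfl⟩ := hP x
        rw [← map_smul, hR, hR, map_smul]; rfl } 1 fun x => by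
          obtain ⟨f, rfl⟩ := hP x
          change ‖R (P f)‖ ≤ _
          rw [hR, norm_eq, one_mul]
  -- The left half of the multiplier is forced by `m y = (y⋆ m⋆)⋆`, where right multiplication by
  -- `m⋆` has to be the inverse `S` of `R`.
  let Sc : E →L[ℂ] E := LinearMap.mkContinuous
    { toFun := fun x => star (S (star x))
      map_add' := fun x y => by
        obtain ⟨f, hf⟩ := hQ (star x)
        obtain ⟨f', hf'⟩ := hQ (star y)
        rw [star_add, ← hf, ← hf', ← map_add, hS, hS, hS, map_add, star_add]
      map_smul' := fun z x => by
        obtain ⟨f, hf⟩ := hQ (star x)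
        rw [star_smul, ← hf, ← map_smul, hS, hS, map_smul, star_smul, star_star]; rfl }
    1 fun x => by
      obtain ⟨f, hf⟩ := hQ (star x)
      change ‖star (S (star x))‖ ≤ _
      rw [one_mul, ← norm_star x, ← hf, hS, norm_star, norm_eq]
  have central : ∀ x y, Rc x * y = x * Sc y := by
    intro x y
    change R x * y = x * star (S (star y))
    obtain ⟨f, rfl⟩ := hP x
    obtain ⟨f', hf'⟩ := hQ (star y)
    rw [← hf', hS, hR, inner, hf', star_star]
  let m : 𝓜(ℂ, E) := ⟨(Sc, Rc), central⟩
  have h1 : star m * m = 1 := by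
    ext x
    · change star (R (star (star (S (star x))))) = x
      rw [star_star, RS, star_star]
    · change R (star (star (S (star (star x))))) = x
      rw [star_star, star_star, RS]
  have h2 : m * star m = 1 := by
    ext x
    · change star (S (star (star (R (star x))))) = x
      rw [star_star, SR, star_star]
    · change star (star (S (star (star (R x))))) = x
      rw [star_star, star_star, SR]
  refine ⟨⟨m, Unitary.mem_iff.2 ⟨h1, h2⟩⟩, fun i => ?_⟩
  have := hR (Finsupp.single i 1)
  simp only [P, Q, Finsupp.linearCombination_single, one_smul] at this
  exact this

/-- The identity `z (m y) = (z m) y` recovers the left action from the right one. -/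
theorem unitary_multiplier_eq_one {m : unitary 𝓜(ℂ, E)}
    (h : ∀ x, (m : 𝓜(ℂ, E)).snd x = x) : m = 1 := by
  apply Subtype.ext
  have h1 : ∀ y, (m : 𝓜(ℂ, E)).fst y = y := fun y =>
    eq_of_forall_mul_left fun z => by rw [← DoubleCentralizer.central, h]
  ext x
  · exact h1 x
  · exact h x

end CStar

/-! ### Multipliers of an ideal as partial maps on the ambient algebra -/

namespace ClosedIdeal

variable {B : Type w} [NonUnitalCStarAlgebra B]

theorem mul_mem_l (I : ClosedIdeal B) (b : B) {a : B} (h : a ∈ I) : b * a ∈ I :=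
  I.mul_mem_left b a h

theorem mul_mem_r (I : ClosedIdeal B) (b : B) {a : B} (h : a ∈ I) : a * b ∈ I :=
  I.mul_mem_right a b h

/-- Every element of a closed ideal is a finite sum of products of elements of the ideal. -/
theorem induction (I : ClosedIdeal B) {p : B → Prop} (h0 : p 0)
    (hadd : ∀ a b, a ∈ I → b ∈ I → p a → p b → p (a + b))
    (hmul : ∀ a b, a ∈ I → b ∈ I → p (a * b)) {c : B} (hc : c ∈ I) : p c :=
  CStarAlgebra.induction_mul (E := I) (p := fun x => p x) h0
    (fun a b => hadd a b a.2 b.2) (fun a b => hmul a b a.2 b.2) ⟨c, hc⟩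

theorem eq_of_forall_mul_left {I : ClosedIdeal B} {x y : B} (hx : x ∈ I) (hy : y ∈ I)
    (h : ∀ z ∈ I, z * x = z * y) : x = y := by
  have := _root_.eq_of_forall_mul_left (E := I) (x := ⟨x, hx⟩) (y := ⟨y, hy⟩)
    fun z => Subtype.ext (h z z.2)
  exact congrArg Subtype.val this

theorem eq_of_forall_mul_right {I : ClosedIdeal B} {x y : B} (hx : x ∈ I) (hy : y ∈ I)
    (h : ∀ z ∈ I, x * z = y * z) : x = y := by
  have := _root_.eq_of_forall_mul_right (E := I) (x := ⟨x, hx⟩) (y := ⟨y, hy⟩)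
    fun z => Subtype.ext (h z z.2)
  exact congrArg Subtype.val this

section Mult

variable {I : ClosedIdeal B} (m : 𝓜(ℂ, I))

theorem lmul_of_mem {b : B} (h : b ∈ I) : I.lmul m b = (m.fst ⟨b, h⟩ : I) := dif_pos h

theorem rmul_of_mem {b : B} (h : b ∈ I) : I.rmul m b = (m.snd ⟨b, h⟩ : I) := dif_pos h

theorem lmul_mem (b : B) : I.lmul m b ∈ I := by
  unfold lmul
  split
  · exact SetLike.coe_mem _
  · exact zero_mem I

theorem rmul_zero : I.rmul m 0 = 0 := by
  rw [rmul_of_mem m (zero_mem I)]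
  exact congrArg Subtype.val (map_zero m.snd)

theorem rmul_add {a b : B} (ha : a ∈ I) (hb : b ∈ I) :
    I.rmul m (a + b) = I.rmul m a + I.rmul m b := by
  rw [rmul_of_mem m ha, rmul_of_mem m hb, rmul_of_mem m (add_mem ha hb)]
  exact congrArg Subtype.val (map_add m.snd ⟨a, ha⟩ ⟨b, hb⟩)

theorem central_mul {a b : B} (ha : a ∈ I) (hb : b ∈ I) :
    I.rmul m a * b = a * I.lmul m b := by
  rw [rmul_of_mem m ha, lmul_of_mem m hb]
  exact congrArg Subtype.val (m.central ⟨a, ha⟩ ⟨b, hb⟩)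

/-- Testing against `z` in the ideal moves the multiplier onto `z`, after which only associativity
in the ambient algebra is needed. Hence `a` may lie outside the ideal. -/
theorem rmul_mul (a : B) {b : B} (hb : b ∈ I) : I.rmul m (a * b) = a * I.rmul m b :=
  eq_of_forall_mul_right (I := I) (rmul_mem _ _ _) (I.mul_mem_l _ (rmul_mem _ _ _)) fun z hz => by
    rw [central_mul m (I.mul_mem_l a hb) hz, mul_assoc, mul_assoc, central_mul m hb hz]

theorem lmul_eq_star {b : B} (hb : b ∈ I) : I.lmul m b = star (I.rmul (star m) (star b)) := by
  rw [lmul_of_mem m hb, rmul_of_mem _ (star_mem hb), DoubleCentralizer.star_snd]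
  change _ = star (star (m.fst (star ⟨star b, _⟩) : I) : B)
  rw [star_star, show (star ⟨star b, star_mem hb⟩ : I) = ⟨b, hb⟩ from Subtype.ext (star_star b)]

theorem rmul_one {b : B} (hb : b ∈ I) : I.rmul (1 : 𝓜(ℂ, I)) b = b := by
  rw [rmul_of_mem _ hb]; rfl

theorem rmul_rmul (m m' : 𝓜(ℂ, I)) {b : B} (hb : b ∈ I) :
    I.rmul m' (I.rmul m b) = I.rmul (m * m') b := by
  rw [rmul_of_mem _ hb, rmul_of_mem _ hb, rmul_of_mem _ (SetLike.coe_mem _)]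
  rfl

variable (v : unitary 𝓜(ℂ, I))

theorem rmul_star_rmul {b : B} (hb : b ∈ I) :
    I.rmul (star (v : 𝓜(ℂ, I))) (I.rmul (v : 𝓜(ℂ, I)) b) = b := by
  rw [rmul_rmul _ _ hb, Unitary.mul_star_self_of_mem v.2, rmul_one hb]

theorem rmul_rmul_star {b : B} (hb : b ∈ I) :
    I.rmul (v : 𝓜(ℂ, I)) (I.rmul (star (v : 𝓜(ℂ, I))) b) = b := by
  rw [rmul_rmul _ _ hb, Unitary.star_mul_self_of_mem v.2, rmul_one hb]

/-- Moving `v` to the other factor turns it into `v⋆`, which undoes the `v` already there. -/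
theorem rmul_mul_star {a b : B} (ha : a ∈ I) (hb : b ∈ I) :
    I.rmul (v : 𝓜(ℂ, I)) a * star (I.rmul (v : 𝓜(ℂ, I)) b) = a * star b := by
  rw [central_mul _ ha (star_mem (rmul_mem _ _ _)), lmul_eq_star _ (star_mem (rmul_mem _ _ _)),
    star_star, rmul_star_rmul v hb]

theorem norm_rmul {b : B} (hb : b ∈ I) : ‖I.rmul (v : 𝓜(ℂ, I)) b‖ = ‖b‖ :=
  norm_eq_of_mul_star_eq (by rw [rmul_mul_star v hb hb])

theorem norm_lmul {b : B} (hb : b ∈ I) : ‖I.lmul (v : 𝓜(ℂ, I)) b‖ = ‖b‖ := by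
  rw [lmul_eq_star _ hb, norm_star]
  exact (norm_rmul (star v) (star_mem hb)).trans (norm_star b)

theorem rmul_sub {a b : B} (ha : a ∈ I) (hb : b ∈ I) :
    I.rmul m (a - b) = I.rmul m a - I.rmul m b := by
  have := rmul_add m (sub_mem ha hb) hb
  rw [sub_add_cancel] at this
  rw [this, add_sub_cancel_right]

/-- If `(x f) v = (x v) e` for all `x` in the ideal, then `f = v e v⋆`. -/
theorem eq_conj {f e : B} (hf : f ∈ I) (he : e ∈ I)
    (h : ∀ x ∈ I, I.rmul (v : 𝓜(ℂ, I)) (x * f) = I.rmul (v : 𝓜(ℂ, I)) x * e) :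
    f = I.lmul (v : 𝓜(ℂ, I)) (I.rmul (star (v : 𝓜(ℂ, I))) e) := by
  refine eq_of_forall_mul_left (I := I) hf (lmul_mem _ _) fun z hz => ?_
  rw [← central_mul _ hz (rmul_mem _ _ _), ← rmul_mul _ _ he, ← h z hz,
    rmul_star_rmul v (I.mul_mem_l z hf)]

/-- Elements of `I ⊓ J` are sums of products `a b` with both factors in `I ⊓ J`, and `(a b) m = a (b
m)` stays in `J` because `a` does. This allows applying twists inside intersections of several
ideals. -/
theorem rmul_mem_of_mem {J : ClosedIdeal B} {b : B} (hb : b ∈ I) (hb' : b ∈ J) :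
    I.rmul m b ∈ J := by
  refine (I ⊓ J).induction (p := fun b => I.rmul m b ∈ J) ?_ ?_ ?_ (mem_inf.2 ⟨hb, hb'⟩)
  · rw [rmul_zero]; exact zero_mem J
  · intro a b ha hb h h'
    rw [rmul_add m ha.1 hb.1]
    exact add_mem h h'
  · intro a b ha hb
    rw [rmul_mul m a hb.1]
    exact J.mul_mem_r _ ha.2

end Mult

/-- Two spanning families of an ideal with the same left inner products differ by a unitary
multiplier. -/
theorem exists_unitary {ι : Type*} (I : ClosedIdeal B) (p q : ι → B)
    (hpq : ∀ i j, p i * star (p j) = q i * star (q j))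
    (hp : ∀ i, p i ∈ I) (hq : ∀ i, q i ∈ I)
    (hp' : ∀ P : B → Prop, P 0 → (∀ a b, P a → P b → P (a + b)) →
      (∀ i, P (p i)) → ∀ x ∈ I, P x)
    (hq' : ∀ P : B → Prop, P 0 → (∀ a b, P a → P b → P (a + b)) →
      (∀ i, P (q i)) → ∀ x ∈ I, P x) :
    ∃ m : unitary 𝓜(ℂ, I), ∀ i, I.rmul (m : 𝓜(ℂ, I)) (p i) = q i := by
  -- The spanning hypothesis is an induction principle in the ambient algebra; here it is carried
  -- over to a linear span inside the ideal.
  have span : ∀ (p : ι → B) (hp : ∀ i, p i ∈ I)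
      (_ : ∀ P : B → Prop, P 0 → (∀ a b, P a → P b → P (a + b)) →
      (∀ i, P (p i)) → ∀ x ∈ I, P x),
      Submodule.span ℂ (Set.range fun i => (⟨p i, hp i⟩ : I)) = ⊤ := by
    intro p hp hp'
    rw [eq_top_iff]
    rintro ⟨x, hx⟩ -
    obtain ⟨_, h⟩ := hp' (fun x => ∃ h : x ∈ I, (⟨x, h⟩ : I) ∈
      Submodule.span ℂ (Set.range fun i => (⟨p i, hp i⟩ : I)))
      ⟨zero_mem I, Submodule.zero_mem _⟩
      (fun a b ⟨h1, h2⟩ ⟨h3, h4⟩ => ⟨add_mem h1 h3, Submodule.add_mem _ h2 h4⟩)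
      (fun i => ⟨hp i, Submodule.subset_span ⟨i, rfl⟩⟩) x hx
    exact h
  obtain ⟨m, hm⟩ := exists_unitary_multiplier (E := I) (fun i => ⟨p i, hp i⟩)
    (fun i => ⟨q i, hq i⟩) (fun i j => Subtype.ext (hpq i j)) (span p hp hp') (span q hq hq')
  exact ⟨m, fun i => by rw [rmul_of_mem _ (hp i), hm]⟩

end ClosedIdeal

/-! ### Convergence in fields of Banach spaces -/

section Fields

variable {X : Type uX} {Y : Type uY} {Z : Type*} {l : Filter Z}

theorem tendsto_pullbackTop [TopologicalSpace Y] {f : Y → X} {B : X → Type w}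
    [TopologicalSpace (Tot B)] {F : Z → Tot fun y => B (f y)} {p : Tot fun y => B (f y)} :
    Tendsto F l (@nhds _ (pullbackTop f B) p) ↔ Tendsto (fun z => (F z).base) l (𝓝 p.base) ∧
      Tendsto (fun z => (⟨f (F z).base, (F z).val⟩ : Tot B)) l (𝓝 ⟨f p.base, p.val⟩) := by
  rw [pullbackTop, nhds_induced, tendsto_comap_iff, nhds_prod_eq, tendsto_prod_iff']
  rfl

theorem tendsto_pairTop {B : X → Type w} [TopologicalSpace (Tot B)]
    {F : Z → Tot fun x => B x × B x} {p : Tot fun x => B x × B x} :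
    Tendsto F l (@nhds _ (pairTop B) p) ↔
      Tendsto (fun z => (⟨(F z).base, (F z).val.1⟩ : Tot B)) l (𝓝 ⟨p.base, p.val.1⟩) ∧
      Tendsto (fun z => (⟨(F z).base, (F z).val.2⟩ : Tot B)) l (𝓝 ⟨p.base, p.val.2⟩) := by
  rw [pairTop, nhds_induced, tendsto_comap_iff, nhds_prod_eq, tendsto_prod_iff']
  rfl

theorem IdealFamily.tendsto_totTop [TopologicalSpace Y] {f : Y → X} {B : X → Type w}
    [∀ x, NonUnitalCStarAlgebra (B x)] [TopologicalSpace (Tot B)] {D : IdealFamily f B}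
    {F : Z → Tot D.Fib} {p : Tot D.Fib} :
    Tendsto F l (@nhds _ D.totTop p) ↔ Tendsto (fun z => (F z).base) l (𝓝 p.base) ∧
      Tendsto (fun z => (⟨f (F z).base, (F z).val⟩ : Tot B)) l (𝓝 ⟨f p.base, p.val⟩) := by
  rw [IdealFamily.totTop, @nhds_induced _ _ (pullbackTop f B), tendsto_comap_iff,
    tendsto_pullbackTop]
  rfl

namespace IsBanachField

variable [TopologicalSpace X] {B : X → Type w} [∀ x, NormedAddCommGroup (B x)] [∀ x, NormedSpace ℂ (B x)]
  [TopologicalSpace (Tot B)]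

variable {x : Z → X} {x0 : X} {a b : ∀ z, B (x z)} {a0 b0 : B x0}

theorem tendsto_base (hB : IsBanachField B) {F : Z → Tot B} {p : Tot B} (h : Tendsto F l (𝓝 p)) :
    Tendsto (fun z => (F z).base) l (𝓝 p.base) :=
  (hB.continuous_base.tendsto p).comp h

theorem tendsto_add (hB : IsBanachField B)
    (ha : Tendsto (fun z => (⟨x z, a z⟩ : Tot B)) l (𝓝 ⟨x0, a0⟩))
    (hb : Tendsto (fun z => (⟨x z, b z⟩ : Tot B)) l (𝓝 ⟨x0, b0⟩)) :
    Tendsto (fun z => (⟨x z, a z + b z⟩ : Tot B)) l (𝓝 ⟨x0, a0 + b0⟩) := by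
  have h := @Continuous.tendsto _ _ (pairTop B) _ _ hB.continuous_add ⟨x0, (a0, b0)⟩
  exact h.comp (tendsto_pairTop (F := fun z => ⟨x z, (a z, b z)⟩).2 ⟨ha, hb⟩)

theorem tendsto_smul (hB : IsBanachField B)
    (c : ℂ) (ha : Tendsto (fun z => (⟨x z, a z⟩ : Tot B)) l (𝓝 ⟨x0, a0⟩)) :
    Tendsto (fun z => (⟨x z, c • a z⟩ : Tot B)) l (𝓝 ⟨x0, c • a0⟩) :=
  (hB.continuous_smul.tendsto (c, (⟨x0, a0⟩ : Tot B))).comp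
    ((tendsto_const_nhds (x := c)).prodMk_nhds ha)

theorem tendsto_sub (hB : IsBanachField B)
    (ha : Tendsto (fun z => (⟨x z, a z⟩ : Tot B)) l (𝓝 ⟨x0, a0⟩))
    (hb : Tendsto (fun z => (⟨x z, b z⟩ : Tot B)) l (𝓝 ⟨x0, b0⟩)) :
    Tendsto (fun z => (⟨x z, a z - b z⟩ : Tot B)) l (𝓝 ⟨x0, a0 - b0⟩) := by
  have := hB.tendsto_add ha (hB.tendsto_smul (-1) hb)
  simpa only [neg_smul, one_smul, ← sub_eq_add_neg] using this

theorem tendsto_zero (hB : IsBanachField B)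
    (hx : Tendsto x l (𝓝 x0)) (ha : Tendsto (fun z => ‖a z‖) l (𝓝 0)) :
    Tendsto (fun z => (⟨x z, a z⟩ : Tot B)) l (𝓝 ⟨x0, 0⟩) :=
  Tendsto.mono_right (tendsto_inf.2 ⟨tendsto_comap_iff (g := Tot.base).2 hx,
    tendsto_comap_iff (g := fun p : Tot B => ‖p.val‖).2 ha⟩) (hB.nhds_zero x0)

/-- Norms are nonnegative, so at a zero vector upper semicontinuity alone gives convergence of the
norm. -/
theorem tendsto_norm_zero (hB : IsBanachField B)
    (ha : Tendsto (fun z => (⟨x z, a z⟩ : Tot B)) l (𝓝 ⟨x0, 0⟩)) :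
    Tendsto (fun z => ‖a z‖) l (𝓝 0) := by
  refine tendsto_order.2 ⟨fun c hc => .of_forall fun z => hc.trans_le (norm_nonneg _), ?_⟩
  intro c hc
  exact ha.eventually (hB.usc_norm (⟨x0, 0⟩ : Tot B) c (by simpa using hc))

theorem tendsto_norm_sub (hB : IsBanachField B)
    (ha : Tendsto (fun z => (⟨x z, a z⟩ : Tot B)) l (𝓝 ⟨x0, a0⟩))
    (hb : Tendsto (fun z => (⟨x z, b z⟩ : Tot B)) l (𝓝 ⟨x0, a0⟩)) :
    Tendsto (fun z => ‖a z - b z‖) l (𝓝 0) :=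
  hB.tendsto_norm_zero (by simpa using hB.tendsto_sub ha hb)

/-- The comparison principle behind the continuity of `α` and `w`: a convergent family `b` plus a
difference that tends to zero in the sense of `nhds_zero`. -/
theorem tendsto_of_norm_sub (hB : IsBanachField B)
    (hb : Tendsto (fun z => (⟨x z, b z⟩ : Tot B)) l (𝓝 ⟨x0, a0⟩))
    (h : Tendsto (fun z => ‖a z - b z‖) l (𝓝 0)) :
    Tendsto (fun z => (⟨x z, a z⟩ : Tot B)) l (𝓝 ⟨x0, a0⟩) := by
  have := hB.tendsto_add hb (hB.tendsto_zero (hB.tendsto_base hb) h)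
  simpa using this

end IsBanachField

namespace IsCStarField

variable [TopologicalSpace X] {B : X → Type w} [∀ x, NonUnitalCStarAlgebra (B x)]
  [TopologicalSpace (Tot B)]

variable {x : Z → X} {x0 : X} {a b : ∀ z, B (x z)} {a0 b0 : B x0}

theorem tendsto_mul (hB : IsCStarField B)
    (ha : Tendsto (fun z => (⟨x z, a z⟩ : Tot B)) l (𝓝 ⟨x0, a0⟩))
    (hb : Tendsto (fun z => (⟨x z, b z⟩ : Tot B)) l (𝓝 ⟨x0, b0⟩)) :
    Tendsto (fun z => (⟨x z, a z * b z⟩ : Tot B)) l (𝓝 ⟨x0, a0 * b0⟩) := by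
  have h := @Continuous.tendsto _ _ (pairTop B) _ _ hB.continuous_mul ⟨x0, (a0, b0)⟩
  exact h.comp (tendsto_pairTop (F := fun z => ⟨x z, (a z, b z)⟩).2 ⟨ha, hb⟩)

theorem tendsto_star (hB : IsCStarField B)
    (ha : Tendsto (fun z => (⟨x z, a z⟩ : Tot B)) l (𝓝 ⟨x0, a0⟩)) :
    Tendsto (fun z => (⟨x z, star (a z)⟩ : Tot B)) l (𝓝 ⟨x0, star a0⟩) :=
  (hB.continuous_star.tendsto (⟨x0, a0⟩ : Tot B)).comp ha

end IsCStarField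

end Fields

/-! ### Composable arrows -/

namespace TopGroupoid

variable {G : Type uG} {X : Type uX} [TopologicalSpace G] [TopologicalSpace X]
  {𝒢 : TopGroupoid G X}

theorem inv_inv_eq (g : G) : 𝒢.inv (𝒢.inv g) = g := (inv_eq (comp_inv_mul g)).symm

theorem eq_inv_symm {g g' : G} (i : g' = 𝒢.inv g) : g = 𝒢.inv g' := by rw [i, inv_inv_eq]

theorem s_eq_of_inv {g g' : G} {x : X} (i : g' = 𝒢.inv g) (hx : 𝒢.r g' = x) : 𝒢.s g = x := by
  rw [← hx, i, 𝒢.r_inv]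

theorem comp_u_left_of {g : G} {y : X} (hy : 𝒢.r g = y) : 𝒢.IsComp (𝒢.u y) g g := by
  subst hy; exact comp_u_left g

theorem comp_u_right_of {g : G} {x : X} (hx : 𝒢.s g = x) : 𝒢.IsComp g (𝒢.u x) g := by
  subst hx; exact comp_u_right g

theorem comp_mul_inv_of {g g' : G} {y : X} (i : g' = 𝒢.inv g) (hy : 𝒢.r g = y) :
    𝒢.IsComp g g' (𝒢.u y) := by
  subst hy i; exact comp_mul_inv g

theorem comp_inv_mul_of {g g' : G} {x : X} (i : g' = 𝒢.inv g) (hx : 𝒢.r g' = x) :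
    𝒢.IsComp g' g (𝒢.u x) := comp_mul_inv_of (eq_inv_symm i) hx

namespace IsComp

variable {g h k gh hk ghk g' h' k' : G}

theorem s_eq (c : 𝒢.IsComp g h k) : 𝒢.s k = 𝒢.s h := by
  obtain ⟨c, rfl⟩ := c
  exact 𝒢.s_mul g h c

theorem eq (c : 𝒢.IsComp g h k) (c' : 𝒢.IsComp g h k') : k = k' := by
  obtain ⟨c, rfl⟩ := c
  exact c'.2

theorem assoc (c : 𝒢.IsComp g h gh) (d : 𝒢.IsComp gh k ghk) (c' : 𝒢.IsComp h k hk) :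
    𝒢.IsComp g hk ghk := by
  obtain ⟨c, rfl⟩ := c
  obtain ⟨c', rfl⟩ := c'
  obtain ⟨d, rfl⟩ := d
  exact ⟨c.trans (𝒢.r_mul h k c').symm, (𝒢.mul_assoc g h k c c').symm⟩

theorem assoc' (c : 𝒢.IsComp g h gh) (d : 𝒢.IsComp g hk ghk) (e : 𝒢.IsComp h k hk) :
    𝒢.IsComp gh k ghk := by
  obtain ⟨c, rfl⟩ := c
  obtain ⟨e, rfl⟩ := e
  obtain ⟨d, rfl⟩ := d
  exact ⟨(𝒢.s_mul g h c).trans e, 𝒢.mul_assoc g h k c e⟩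

/-- If `g h = k` then `g⁻¹ k = h`. -/
theorem inv_left (c : 𝒢.IsComp g h k) (i : g' = 𝒢.inv g) : 𝒢.IsComp g' k h :=
  assoc (comp_inv_mul_of i (by rw [i, 𝒢.r_inv, c.1])) (comp_u_left h) c

/-- If `g h = k` then `k h⁻¹ = g`. -/
theorem inv_right (c : 𝒢.IsComp g h k) (i : h' = 𝒢.inv h) : 𝒢.IsComp k h' g :=
  assoc' c (comp_u_right_of c.1) (comp_mul_inv_of i rfl)

/-- If `g h = k` then `h⁻¹ g⁻¹ = k⁻¹`. -/
theorem inv_rev (c : 𝒢.IsComp g h k) (ig : g' = 𝒢.inv g) (ih : h' = 𝒢.inv h)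
    (ik : k' = 𝒢.inv k) : 𝒢.IsComp h' g' k' :=
  ((c.inv_right ih).inv_left ik).inv_right ig

end IsComp

end TopGroupoid

/-! ### Elementary properties of Fell bundles -/

namespace FellBundle

open TopGroupoid

variable {G : Type uG} {X : Type uX} [TopologicalSpace G] [TopologicalSpace X]
  {𝒢 : TopGroupoid G X} (A : FellBundle.{uG, uX, w} 𝒢)

theorem zero_mul {g h k : G} (c : 𝒢.IsComp g h k) (b : A.fib h) : A.mul c 0 b = 0 := by
  have h := A.smul_mul c 0 0 b
  rwa [zero_smul, zero_smul] at h

theorem mul_zero {g h k : G} (c : 𝒢.IsComp g h k) (a : A.fib g) : A.mul c a 0 = 0 := by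
  have h := A.mul_smul c 0 a 0
  rwa [zero_smul, zero_smul] at h

theorem star_zero {g k : G} (i : k = 𝒢.inv g) : A.star i (0 : A.fib g) = 0 := by
  have h := A.star_smul i 0 0
  rwa [zero_smul, map_zero, zero_smul] at h

/-- The C*-identity and submultiplicativity give `‖a‖² ≤ ‖a⋆‖ ‖a‖`; apply this to `a` and to `a⋆`.
-/
theorem norm_star {g k : G} (i : k = 𝒢.inv g) (a : A.fib g) : ‖A.star i a‖ = ‖a‖ := by
  have key : ∀ {g k : G} (i : k = 𝒢.inv g) (a : A.fib g), ‖a‖ ≤ ‖A.star i a‖ := by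
    rintro g k rfl a
    have h := A.norm_mul_le (𝒢.comp_inv_mul g) (A.star rfl a) a
    rw [A.norm_star_mul, sq] at h
    rcases (norm_nonneg a).eq_or_lt with h0 | h0
    · rw [← h0]; exact norm_nonneg _
    · exact le_of_mul_le_mul_right h h0
  refine le_antisymm ?_ (key i a)
  have := key (eq_inv_symm i) (A.star i a)
  rwa [A.star_star] at this

theorem norm_mul_star {g k : G} {y : X} (i : k = 𝒢.inv g) (c : 𝒢.IsComp g k (𝒢.u y))
    (a : A.fib g) : ‖A.mul c a (A.star i a)‖ = ‖a‖ ^ 2 := by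
  rw [← A.norm_star i a]
  have hy : y = 𝒢.s k := by rw [← 𝒢.s_u y, c.s_eq]
  subst hy
  have ig := eq_inv_symm i
  subst ig
  have h := A.norm_star_mul (A.star i a)
  rwa [A.star_star] at h

variable {Z : Type*} {l : Filter Z}

theorem tendsto_mul {g h k : Z → G} {g0 h0 k0 : G} (c : ∀ z, 𝒢.IsComp (g z) (h z) (k z))
    (c0 : 𝒢.IsComp g0 h0 k0) {a : ∀ z, A.fib (g z)} {b : ∀ z, A.fib (h z)} {a0 : A.fib g0}
    {b0 : A.fib h0} (ha : Tendsto (fun z => (⟨g z, a z⟩ : Tot A.fib)) l (𝓝 ⟨g0, a0⟩))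
    (hb : Tendsto (fun z => (⟨h z, b z⟩ : Tot A.fib)) l (𝓝 ⟨h0, b0⟩)) :
    Tendsto (fun z => (⟨k z, A.mul (c z) (a z) (b z)⟩ : Tot A.fib)) l
      (𝓝 ⟨k0, A.mul c0 a0 b0⟩) := by
  -- The continuity axiom speaks about the literal product of two arrows, so the free target index
  -- is first replaced by it.
  have e : ∀ z, (⟨k z, A.mul (c z) (a z) (b z)⟩ : Tot A.fib) =
      ⟨𝒢.mul (g z) (h z) (c z).1, A.mul ⟨(c z).1, rfl⟩ (a z) (b z)⟩ := by
    intro z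
    generalize c z = cz
    generalize k z = kz at cz
    obtain ⟨_, rfl⟩ := cz
    rfl
  obtain ⟨d, rfl⟩ := c0
  simp only [e]
  have hc := A.continuous_mul.tendsto
    (⟨((⟨g0, a0⟩ : Tot A.fib), (⟨h0, b0⟩ : Tot A.fib)), d⟩ : {p : Tot A.fib × Tot A.fib //
      𝒢.s p.1.base = 𝒢.r p.2.base})
  have h2 : Tendsto (fun z => (⟨((⟨g z, a z⟩ : Tot A.fib), (⟨h z, b z⟩ : Tot A.fib)), (c z).1⟩ :
      {p : Tot A.fib × Tot A.fib // 𝒢.s p.1.base = 𝒢.r p.2.base})) l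
      (𝓝 ⟨((⟨g0, a0⟩ : Tot A.fib), (⟨h0, b0⟩ : Tot A.fib)), d⟩) :=
    tendsto_subtype_rng.2 (ha.prodMk_nhds hb)
  exact hc.comp h2

theorem tendsto_star {g k : Z → G} {g0 k0 : G} (i : ∀ z, k z = 𝒢.inv (g z))
    (i0 : k0 = 𝒢.inv g0) {a : ∀ z, A.fib (g z)} {a0 : A.fib g0}
    (ha : Tendsto (fun z => (⟨g z, a z⟩ : Tot A.fib)) l (𝓝 ⟨g0, a0⟩)) :
    Tendsto (fun z => (⟨k z, A.star (i z) (a z)⟩ : Tot A.fib)) l (𝓝 ⟨k0, A.star i0 a0⟩) := by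
  subst i0
  obtain rfl : k = fun z => 𝒢.inv (g z) := funext i
  exact (A.continuous_star.tendsto (⟨g0, a0⟩ : Tot A.fib)).comp ha

/-- The base points converge automatically, because `r ∘ u` is the identity. -/
theorem tendsto_UFib {F : Z → Tot A.UFib} {p : Tot A.UFib} :
    Tendsto F l (𝓝 p) ↔
      Tendsto (fun z => (⟨𝒢.u (F z).base, (F z).val⟩ : Tot A.fib)) l (𝓝 ⟨𝒢.u p.base, p.val⟩) := by
  refine (tendsto_pullbackTop (f := 𝒢.u) (B := A.fib)).trans ⟨And.right, fun h => ⟨?_, h⟩⟩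
  have := (𝒢.continuous_r.tendsto _).comp (A.isBanachField.tendsto_base h)
  simpa only [Function.comp_def, 𝒢.r_u] using this

/-- An element of a unit fibre, viewed as an element of the Fell bundle. -/
def ofU {x : X} (a : A.UFib x) : A.fib (𝒢.u x) := a

/-- An element of the Fell bundle over a unit, viewed as an element of a C*-algebra. -/
def toU {x : X} (a : A.fib (𝒢.u x)) : A.UFib x := a

theorem ofU_toU {x : X} (a : A.fib (𝒢.u x)) : A.ofU (A.toU a) = a := rfl

theorem ofU_inj {x : X} {a b : A.UFib x} (h : A.ofU a = A.ofU b) : a = b := h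

theorem ofU_mul {x : X} (c : 𝒢.IsComp (𝒢.u x) (𝒢.u x) (𝒢.u x)) (a b : A.UFib x) :
    A.ofU (a * b) = A.mul c (A.ofU a) (A.ofU b) := rfl

theorem ofU_star {x : X} (i : 𝒢.u x = 𝒢.inv (𝒢.u x)) (a : A.UFib x) :
    A.ofU (Star.star a) = A.star i (A.ofU a) := rfl

theorem ofU_add {x : X} (a b : A.UFib x) : A.ofU (a + b) = A.ofU a + A.ofU b := rfl

theorem ofU_zero {x : X} : A.ofU (0 : A.UFib x) = 0 := rfl

theorem ofU_smul {x : X} (z : ℂ) (a : A.UFib x) : A.ofU (z • a) = z • A.ofU a := rfl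

theorem norm_ofU {x : X} (a : A.UFib x) : ‖A.ofU a‖ = ‖a‖ := rfl

/-- The unit fibres of a Fell bundle form a field of C*-algebras. -/
theorem isCStarField_UFib : IsCStarField A.UFib where
  complete x := inferInstance
  continuous_base := continuous_iff_continuousAt.2 fun p =>
    ((tendsto_pullbackTop (f := 𝒢.u) (B := A.fib)).1 (tendsto_id (x := 𝓝 p))).1
  isOpenMap_base := IsOpenMap.of_nhds_le fun p => by
    obtain ⟨σ, hσ, h⟩ := A.isBanachField.exists_section _ p.val
    -- A section through `p` is a right inverse of the projection that is continuous at the base of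
    -- `p`, so neighbourhoods of `p` project onto neighbourhoods.
    have h1 : Tendsto (fun x => (⟨x, σ (𝒢.u x)⟩ : Tot A.UFib)) (𝓝 p.base) (𝓝 p) := by
      rw [tendsto_UFib, ← h]
      exact (Continuous.comp hσ 𝒢.continuous_u).tendsto p.base
    calc 𝓝 p.base = map Tot.base (map (fun x => (⟨x, σ (𝒢.u x)⟩ : Tot A.UFib)) (𝓝 p.base)) := by
          rw [map_map]; exact map_id.symm
      _ ≤ _ := map_mono h1
  continuous_add := (@continuous_iff_continuousAt _ _ (pairTop A.UFib) _ _).2 fun p => by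
    have h := tendsto_pairTop.1 (@tendsto_id _ (@nhds _ (pairTop A.UFib) p))
    exact A.tendsto_UFib.2 (A.isBanachField.tendsto_add (A.tendsto_UFib.1 h.1)
      (A.tendsto_UFib.1 h.2))
  continuous_smul := continuous_iff_continuousAt.2 fun p => by
    refine A.tendsto_UFib.2 ?_
    have h2 : Tendsto (fun q : ℂ × Tot A.UFib => (⟨𝒢.u q.2.base, q.2.val⟩ : Tot A.fib)) (𝓝 p)
        (𝓝 ⟨𝒢.u p.2.base, p.2.val⟩) := A.tendsto_UFib.1 (continuous_snd.tendsto p)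
    exact (A.isBanachField.continuous_smul.tendsto
      (p.1, (⟨𝒢.u p.2.base, p.2.val⟩ : Tot A.fib))).comp
      ((continuous_fst.tendsto p).prodMk_nhds h2)
  usc_norm := fun p c hc =>
    (A.tendsto_UFib.1 (tendsto_id (x := 𝓝 p))).eventually
      (A.isBanachField.usc_norm (⟨𝒢.u p.base, p.val⟩ : Tot A.fib) c hc)
  nhds_zero x := by
    rw [← tendsto_id']
    refine A.tendsto_UFib.2 (A.isBanachField.tendsto_zero ?_ ?_)
    · exact (𝒢.continuous_u.tendsto x).comp (tendsto_comap.mono_left inf_le_left)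
    · exact tendsto_comap.mono_left inf_le_right
  exists_section x b := by
    obtain ⟨σ, hσ, h⟩ := A.isBanachField.exists_section _ b
    refine ⟨fun y => σ (𝒢.u y), ?_, h⟩
    exact continuous_iff_continuousAt.2 fun y => A.tendsto_UFib.2
      ((Continuous.comp hσ 𝒢.continuous_u).tendsto y)
  continuous_mul := (@continuous_iff_continuousAt _ _ (pairTop A.UFib) _ _).2 fun p => by
    have h := tendsto_pairTop.1 (@tendsto_id _ (@nhds _ (pairTop A.UFib) p))
    exact A.tendsto_UFib.2 (A.tendsto_mul _ _ (A.tendsto_UFib.1 h.1) (A.tendsto_UFib.1 h.2))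
  continuous_star := continuous_iff_continuousAt.2 fun p =>
    A.tendsto_UFib.2 (A.tendsto_star _ _ (A.tendsto_UFib.1 tendsto_id))

end FellBundle

/-! ### Trivialisations by ideals -/

theorem Topology.IsInducing.of_involutive {X : Type*} [TopologicalSpace X] {f : X → X}
    (hf : Continuous f) (h : Function.Involutive f) : Topology.IsInducing f :=
  (Topology.IsEmbedding.of_leftInverse h.leftInverse hf hf).isInducing

namespace IdealFamily

variable {X : Type uX} {Y Y' : Type uY} {f : Y → X} {f' : Y' → X} {B : X → Type w}
  [∀ x, NonUnitalCStarAlgebra (B x)]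

/-- The pull-back of a family of ideals along `e : Y' → Y`. -/
def reindex (D : IdealFamily f B) (e : Y' → Y) (h : ∀ y, f (e y) = f' y) : IdealFamily f' B :=
  fun y _ hx => D (e y) ((h y).trans hx)

theorem IsCont.reindex [TopologicalSpace Y] [TopologicalSpace Y'] [TopologicalSpace (Tot B)]
    {D : IdealFamily f B} (hD : D.IsCont) {e : Y' → Y} (he : Continuous e)
    (h : ∀ y, f (e y) = f' y) : (D.reindex e h).IsCont := by
  obtain rfl : (fun y => f (e y)) = f' := funext h
  intro y a ha
  obtain ⟨σ, h1, h2, h3⟩ := hD (e y) a ha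
  exact ⟨fun z => σ (e z), Continuous.comp h1 he, h2, fun z => h3 (e z)⟩

theorem IsCont.whole [TopologicalSpace X] [TopologicalSpace Y] [TopologicalSpace (Tot B)]
    (hB : IsCStarField B) (hf : Continuous f) : (IdealFamily.whole f B).IsCont := by
  intro y a _
  obtain ⟨σ, h1, h2⟩ := hB.exists_section _ a
  exact ⟨fun z => σ (f z), Continuous.comp h1 hf, h2, fun z => trivial⟩

theorem isInducing_totTop [TopologicalSpace Y] [TopologicalSpace (Tot B)] (D : IdealFamily f B) :
    @Topology.IsInducing _ _ D.totTop _
      (fun p : Tot D.Fib => (p.base, (⟨f p.base, p.val⟩ : Tot B))) :=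
  @Topology.IsInducing.mk _ _ D.totTop _ _ (by
    rw [totTop, pullbackTop, induced_compose]
    rfl)

/-- Condenses the two continuity conditions of an isomorphism of fields into one inducing map, a
form that is easy to compose with changes of coordinates. -/
theorem isInducing_of_inverse {T : Type*} [TopologicalSpace T] [TopologicalSpace Y]
    [TopologicalSpace (Tot B)] {D : IdealFamily f B} {F : T → Tot D.Fib} {F' : Tot D.Fib → T}
    (hF : @Continuous _ _ _ D.totTop F) (hF' : @Continuous _ _ D.totTop _ F')
    (h : Function.LeftInverse F' F) : Topology.IsInducing
      (fun t => ((F t).base, (⟨f (F t).base, (F t).val⟩ : Tot B))) := by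
  let _ : TopologicalSpace (Tot D.Fib) := D.totTop
  exact D.isInducing_totTop.comp (Topology.IsEmbedding.of_leftInverse h hF' hF).isInducing

end IdealFamily

open TopGroupoid (comp_u_left_of comp_u_right_of comp_mul_inv_of comp_inv_mul_of inv_inv_eq
  eq_inv_symm s_eq_of_inv)

variable {G : Type uG} {X : Type uX} [TopologicalSpace G] [TopologicalSpace X]
  {𝒢 : TopGroupoid G X} {A : FellBundle.{uG, uX, w} 𝒢}

/-- An identification of the fibres of `A` with a family of ideals `D`, as left Hilbert modules. -/
structure LeftTriv (A : FellBundle.{uG, uX, w} 𝒢) (D : IdealFamily 𝒢.r A.UFib) where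
  toFun : ∀ {g : G} {y : X}, 𝒢.r g = y → A.fib g → A.UFib y
  map_add : ∀ {g : G} {y : X} (hy : 𝒢.r g = y) (a b : A.fib g),
    toFun hy (a + b) = toFun hy a + toFun hy b
  map_csmul : ∀ {g : G} {y : X} (hy : 𝒢.r g = y) (z : ℂ) (a : A.fib g),
    toFun hy (z • a) = z • toFun hy a
  mem : ∀ {g : G} {y : X} (hy : 𝒢.r g = y) (a : A.fib g), toFun hy a ∈ D g hy
  surj : ∀ {g : G} {y : X} (hy : 𝒢.r g = y) {d : A.UFib y}, d ∈ D g hy → ∃ a, toFun hy a = d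
  map_smul : ∀ {g : G} {y : X} (hy : 𝒢.r g = y) (c : 𝒢.IsComp (𝒢.u y) g g) (b : A.UFib y)
    (a : A.fib g), toFun hy (A.mul c (A.ofU b) a) = b * toFun hy a
  map_inner : ∀ {g g' : G} {y : X} (hy : 𝒢.r g = y) (i : g' = 𝒢.inv g)
    (c : 𝒢.IsComp g g' (𝒢.u y)) (a b : A.fib g),
    A.ofU (toFun hy a * star (toFun hy b)) = A.mul c a (A.star i b)
  isInducing : Topology.IsInducing fun p : Tot A.fib =>
    (p.base, (⟨𝒢.r p.base, toFun rfl p.val⟩ : Tot A.UFib))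

/-- An identification of the fibres of `A` with a family of ideals `D`, as right Hilbert modules. -/
structure RightTriv (A : FellBundle.{uG, uX, w} 𝒢) (D : IdealFamily 𝒢.s A.UFib) where
  toFun : ∀ {g : G} {x : X}, 𝒢.s g = x → A.fib g → A.UFib x
  map_add : ∀ {g : G} {x : X} (hx : 𝒢.s g = x) (a b : A.fib g),
    toFun hx (a + b) = toFun hx a + toFun hx b
  map_csmul : ∀ {g : G} {x : X} (hx : 𝒢.s g = x) (z : ℂ) (a : A.fib g),
    toFun hx (z • a) = z • toFun hx a
  mem : ∀ {g : G} {x : X} (hx : 𝒢.s g = x) (a : A.fib g), toFun hx a ∈ D g hx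
  surj : ∀ {g : G} {x : X} (hx : 𝒢.s g = x) {d : A.UFib x}, d ∈ D g hx → ∃ a, toFun hx a = d
  map_smul : ∀ {g : G} {x : X} (hx : 𝒢.s g = x) (c : 𝒢.IsComp g (𝒢.u x) g) (a : A.fib g)
    (b : A.UFib x), toFun hx (A.mul c a (A.ofU b)) = toFun hx a * b
  map_inner : ∀ {g g' : G} {x : X} (hx : 𝒢.s g = x) (i : g' = 𝒢.inv g)
    (c : 𝒢.IsComp g' g (𝒢.u x)) (a b : A.fib g),
    A.ofU (star (toFun hx a) * toFun hx b) = A.mul c (A.star i a) b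
  isInducing : Topology.IsInducing fun p : Tot A.fib =>
    (p.base, (⟨𝒢.s p.base, toFun rfl p.val⟩ : Tot A.UFib))

theorem FellBundle.isInducing_star (A : FellBundle.{uG, uX, w} 𝒢) : Topology.IsInducing
    fun p : Tot A.fib => (⟨𝒢.inv p.base, A.star rfl p.val⟩ : Tot A.fib) :=
  .of_involutive A.continuous_star fun p => by
    have key : ∀ {g g' : G} (e : g' = g) (i : g' = 𝒢.inv (𝒢.inv g)) (a : A.fib g),
        (⟨g', A.star i (A.star rfl a)⟩ : Tot A.fib) = ⟨g, a⟩ := by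
      rintro g _ rfl i a
      rw [A.star_star]
    exact key (inv_inv_eq _) rfl p.val

theorem FellBundle.isInducing_inv_star (A : FellBundle.{uG, uX, w} 𝒢) :
    Topology.IsInducing fun p : G × Tot A.UFib =>
      (𝒢.inv p.1, (⟨p.2.base, star p.2.val⟩ : Tot A.UFib)) :=
  (Topology.IsInducing.of_involutive 𝒢.continuous_inv inv_inv_eq).prodMap
    (.of_involutive A.isCStarField_UFib.continuous_star fun p => by simp)

namespace LeftTriv

variable {D : IdealFamily 𝒢.r A.UFib} (L : LeftTriv A D)

theorem map_zero {g : G} {y : X} (hy : 𝒢.r g = y) : L.toFun hy 0 = 0 := by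
  have := L.map_csmul hy 0 0
  rwa [zero_smul, zero_smul] at this

theorem map_sub {g : G} {y : X} (hy : 𝒢.r g = y) (a b : A.fib g) :
    L.toFun hy (a - b) = L.toFun hy a - L.toFun hy b := by
  rw [sub_eq_add_neg, L.map_add, ← neg_one_smul ℂ, L.map_csmul, neg_one_smul, ← sub_eq_add_neg]

/-- The C*-identities on both sides read the norm off the inner product, so a trivialisation is
automatically isometric and hence injective. -/
theorem norm_map {g : G} {y : X} (hy : 𝒢.r g = y) (a : A.fib g) : ‖L.toFun hy a‖ = ‖a‖ := by
  have h := A.norm_mul_star rfl (comp_mul_inv_of rfl hy) a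
  rw [← L.map_inner hy rfl (comp_mul_inv_of rfl hy), A.norm_ofU,
    CStarRing.norm_self_mul_star, ← sq] at h
  exact (sq_eq_sq₀ (norm_nonneg _) (norm_nonneg _)).1 h

theorem inj {g : G} {y : X} (hy : 𝒢.r g = y) {a b : A.fib g} (h : L.toFun hy a = L.toFun hy b) :
    a = b := by
  rw [← sub_eq_zero, ← norm_eq_zero, ← L.norm_map hy, L.map_sub, h, sub_self, norm_zero]

theorem tot_eq {g : G} {y : X} (hy : 𝒢.r g = y) (a : A.fib g) :
    (⟨𝒢.r g, L.toFun rfl a⟩ : Tot A.UFib) = ⟨y, L.toFun hy a⟩ := by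
  subst hy; rfl

theorem tendsto_iff {Z : Type*} {l : Filter Z} {g : Z → G} {y : Z → X} {g0 : G} {y0 : X}
    (hy : ∀ z, 𝒢.r (g z) = y z) (hy0 : 𝒢.r g0 = y0) {a : ∀ z, A.fib (g z)} {a0 : A.fib g0} :
    Tendsto (fun z => (⟨g z, a z⟩ : Tot A.fib)) l (𝓝 ⟨g0, a0⟩) ↔
      Tendsto g l (𝓝 g0) ∧ Tendsto (fun z => (⟨y z, L.toFun (hy z) (a z)⟩ : Tot A.UFib)) l
        (𝓝 ⟨y0, L.toFun hy0 a0⟩) := by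
  rw [L.isInducing.nhds_eq_comap, tendsto_comap_iff, nhds_prod_eq, tendsto_prod_iff']
  simp only [Function.comp_def, L.tot_eq hy0, L.tot_eq (hy _)]

/-- The fibrewise linear isomorphisms of a trivialisation. -/
noncomputable def equiv (g : G) : A.fib g ≃ₗ[ℂ] D.Fib g :=
  LinearEquiv.ofBijective
    { toFun := fun a => (⟨L.toFun rfl a, L.mem rfl a⟩ : D.Fib g)
      map_add' := fun a b => Subtype.ext (L.map_add rfl a b)
      map_smul' := fun z a => Subtype.ext (L.map_csmul rfl z a) }
    ⟨fun a b h => L.inj rfl (congrArg Subtype.val h), fun d => by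
      obtain ⟨a, ha⟩ := L.surj rfl d.2
      exact ⟨a, Subtype.ext ha⟩⟩

theorem equiv_apply {g : G} (a : A.fib g) : (L.equiv g a : A.UFib (𝒢.r g)) = L.toFun rfl a := rfl

theorem toFun_equiv_symm {g : G} (d : D.Fib g) : L.toFun rfl ((L.equiv g).symm d) = d := by
  rw [← equiv_apply, LinearEquiv.apply_symm_apply]

theorem continuous_equiv : Continuous[A.instTop, D.totTop]
    fun p : Tot A.fib => (⟨p.base, L.equiv p.base p.val⟩ : Tot D.Fib) :=
  (@continuous_iff_continuousAt _ _ _ D.totTop _).2 fun p =>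
    IdealFamily.tendsto_totTop.2 ((L.tendsto_iff (fun _ => rfl) rfl).1 (tendsto_id (x := 𝓝 p)))

theorem continuous_equiv_symm : Continuous[D.totTop, A.instTop]
    fun p : Tot D.Fib => (⟨p.base, (L.equiv p.base).symm p.val⟩ : Tot A.fib) :=
  (@continuous_iff_continuousAt _ _ D.totTop _ _).2 fun p => by
    refine (L.tendsto_iff (fun _ => rfl) rfl).2 ?_
    simp only [toFun_equiv_symm]
    exact IdealFamily.tendsto_totTop.1 (@tendsto_id _ (@nhds _ D.totTop p))

/-- A trivialisation as an isomorphism of fields of left Hilbert modules. -/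
noncomputable def toLeftIso : A.LeftIso D where
  ψ := L.equiv
  map_smul _ c a := L.map_smul rfl _ c a
  map_inner _ a b := L.map_inner rfl rfl _ a b
  continuous_toFun := L.continuous_equiv
  continuous_invFun := L.continuous_equiv_symm

/-- The left trivialisation given by an isomorphism of fields of left Hilbert modules. -/
noncomputable def ofLeftIso (Λ : A.LeftIso D) : LeftTriv A D where
  toFun {g y} hy a := hy ▸ (Λ.ψ g a : A.UFib (𝒢.r g))
  map_add := by rintro _ _ rfl a b; exact congrArg Subtype.val ((Λ.ψ _).map_add a b)
  map_csmul := by rintro _ _ rfl z a; exact congrArg Subtype.val ((Λ.ψ _).map_smul z a)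
  mem := by rintro g y rfl a; exact (Λ.ψ g a).2
  surj := by
    rintro g y rfl d hd
    exact ⟨(Λ.ψ g).symm ⟨d, hd⟩, congrArg Subtype.val ((Λ.ψ g).apply_symm_apply ⟨d, hd⟩)⟩
  map_smul := by rintro g y rfl c b a; exact Λ.map_smul g b a
  map_inner := by rintro g g' y rfl rfl c a b; exact Λ.map_inner g a b
  isInducing := IdealFamily.isInducing_of_inverse Λ.continuous_toFun Λ.continuous_invFun
    fun p => congrArg (Tot.mk p.base) ((Λ.ψ p.base).symm_apply_apply p.val)

/-- The right trivialisation obtained from a left trivialisation by taking adjoints. -/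
noncomputable def toRightTriv : RightTriv A (D.reindex 𝒢.inv 𝒢.r_inv) where
  toFun {g x} hx a := star (L.toFun ((𝒢.r_inv g).trans hx) (A.star rfl a))
  map_add hx a b := by rw [A.star_add, L.map_add, star_add]
  map_csmul hx z a := by rw [A.star_smul, L.map_csmul, star_smul]; simp
  mem hx a := star_mem (L.mem _ _)
  surj {g x} hx d hd := by
    obtain ⟨a, ha⟩ := L.surj _ (star_mem hd)
    refine ⟨A.star (inv_inv_eq g).symm a, ?_⟩
    rw [A.star_star, ha, star_star]
  map_smul {g x} hx c a b := by
    rw [A.star_mul c (comp_u_left_of ((𝒢.r_inv g).trans hx)) rfl (𝒢.u_eq_inv x) rfl,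
      ← A.ofU_star, L.map_smul, star_mul, star_star]
  map_inner {g g' x} hx i c a b := by
    subst i
    rw [star_star, L.map_inner _ (inv_inv_eq g).symm c, A.star_star]
  isInducing := by
    convert A.isInducing_inv_star.comp (L.isInducing.comp A.isInducing_star) using 1
    funext p
    refine Prod.ext (inv_inv_eq p.base).symm ?_
    have := L.tot_eq (𝒢.r_inv p.base) (A.star rfl p.val)
    exact congrArg (fun q : Tot A.UFib => (⟨q.base, star q.val⟩ : Tot A.UFib)) this.symm

end LeftTriv

/-! ### Right trivialisations and the passage back to left ones -/

namespace RightTriv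

variable {D : IdealFamily 𝒢.s A.UFib} (R : RightTriv A D)

theorem tot_eq {g : G} {x : X} (hx : 𝒢.s g = x) (a : A.fib g) :
    (⟨𝒢.s g, R.toFun rfl a⟩ : Tot A.UFib) = ⟨x, R.toFun hx a⟩ := by
  subst hx; rfl

/-- The left trivialisation obtained from a right trivialisation by taking adjoints. -/
noncomputable def toLeftTriv : LeftTriv A (D.reindex 𝒢.inv 𝒢.s_inv) where
  toFun {g y} hy a := star (R.toFun ((𝒢.s_inv g).trans hy) (A.star rfl a))
  map_add hy a b := by rw [A.star_add, R.map_add, star_add]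
  map_csmul hy z a := by rw [A.star_smul, R.map_csmul, star_smul]; simp
  mem hy a := star_mem (R.mem _ _)
  surj {g y} hy d hd := by
    obtain ⟨a, ha⟩ := R.surj _ (star_mem hd)
    refine ⟨A.star (inv_inv_eq g).symm a, ?_⟩
    rw [A.star_star, ha, star_star]
  map_smul {g y} hy c b a := by
    rw [A.star_mul c (comp_u_right_of ((𝒢.s_inv g).trans hy)) (𝒢.u_eq_inv y) rfl rfl,
      ← A.ofU_star, R.map_smul, star_mul, star_star]
  map_inner {g g' y} hy i c a b := by
    subst i
    rw [star_star, R.map_inner _ (inv_inv_eq g).symm c, A.star_star]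
  isInducing := by
    convert A.isInducing_inv_star.comp (R.isInducing.comp A.isInducing_star) using 1
    funext p
    refine Prod.ext (inv_inv_eq p.base).symm ?_
    have := R.tot_eq (𝒢.s_inv p.base) (A.star rfl p.val)
    exact congrArg (fun q : Tot A.UFib => (⟨q.base, star q.val⟩ : Tot A.UFib)) this.symm

theorem map_sub {g : G} {x : X} (hx : 𝒢.s g = x) (a b : A.fib g) :
    R.toFun hx (a - b) = R.toFun hx a - R.toFun hx b := by
  rw [sub_eq_add_neg, R.map_add, ← neg_one_smul ℂ, R.map_csmul, neg_one_smul, ← sub_eq_add_neg]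

theorem norm_map {g : G} {x : X} (hx : 𝒢.s g = x) (a : A.fib g) : ‖R.toFun hx a‖ = ‖a‖ := by
  have hx' := (𝒢.r_inv g).trans hx
  have h := A.norm_mul_star (eq_inv_symm rfl) (comp_inv_mul_of rfl hx') (A.star rfl a)
  rw [A.star_star, ← R.map_inner hx rfl (comp_inv_mul_of rfl hx'), A.norm_ofU,
    CStarRing.norm_star_mul_self, ← sq, A.norm_star] at h
  exact (sq_eq_sq₀ (norm_nonneg _) (norm_nonneg _)).1 h

theorem inj {g : G} {x : X} (hx : 𝒢.s g = x) {a b : A.fib g} (h : R.toFun hx a = R.toFun hx b) :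
    a = b := by
  rw [← sub_eq_zero, ← norm_eq_zero, ← R.norm_map hx, R.map_sub, h, sub_self, norm_zero]

/-- The fibrewise linear isomorphisms of a trivialisation. -/
noncomputable def equiv (g : G) : A.fib g ≃ₗ[ℂ] D.Fib g :=
  LinearEquiv.ofBijective
    { toFun := fun a => (⟨R.toFun rfl a, R.mem rfl a⟩ : D.Fib g)
      map_add' := fun a b => Subtype.ext (R.map_add rfl a b)
      map_smul' := fun z a => Subtype.ext (R.map_csmul rfl z a) }
    ⟨fun a b h => R.inj rfl (congrArg Subtype.val h), fun d => by
      obtain ⟨a, ha⟩ := R.surj rfl d.2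
      exact ⟨a, Subtype.ext ha⟩⟩

theorem equiv_apply {g : G} (a : A.fib g) : (R.equiv g a : A.UFib (𝒢.s g)) = R.toFun rfl a := rfl

theorem toFun_equiv_symm {g : G} (d : D.Fib g) : R.toFun rfl ((R.equiv g).symm d) = d := by
  rw [← equiv_apply, LinearEquiv.apply_symm_apply]

/-- A trivialisation as an isomorphism of fields of right Hilbert modules. -/
noncomputable def toRightIso : A.RightIso D where
  ψ := R.equiv
  map_smul g a c := R.map_smul rfl _ a c
  map_inner g a b := R.map_inner rfl rfl _ a b
  continuous_toFun := (@continuous_iff_continuousAt _ _ _ D.totTop _).2 fun p => by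
    refine IdealFamily.tendsto_totTop.2 ?_
    have h := R.isInducing.continuous.tendsto p
    rw [nhds_prod_eq, tendsto_prod_iff'] at h
    exact h
  continuous_invFun := (@continuous_iff_continuousAt _ _ D.totTop _ _).2 fun p => by
    unfold ContinuousAt
    rw [R.isInducing.nhds_eq_comap, tendsto_comap_iff, nhds_prod_eq, tendsto_prod_iff']
    simp only [Function.comp_def, toFun_equiv_symm]
    exact IdealFamily.tendsto_totTop.1 (@tendsto_id _ (@nhds _ D.totTop p))

/-- The right trivialisation given by an isomorphism of fields of right Hilbert modules. -/
noncomputable def ofRightIso (Λ : A.RightIso D) : RightTriv A D where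
  toFun {g y} hy a := hy ▸ (Λ.ψ g a : A.UFib (𝒢.s g))
  map_add := by rintro _ _ rfl a b; exact congrArg Subtype.val ((Λ.ψ _).map_add a b)
  map_csmul := by rintro _ _ rfl z a; exact congrArg Subtype.val ((Λ.ψ _).map_smul z a)
  mem := by rintro g y rfl a; exact (Λ.ψ g a).2
  surj := by
    rintro g y rfl d hd
    exact ⟨(Λ.ψ g).symm ⟨d, hd⟩, congrArg Subtype.val ((Λ.ψ g).apply_symm_apply ⟨d, hd⟩)⟩
  map_smul := by rintro g y rfl c a b; exact Λ.map_smul g a b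
  map_inner := by rintro g g' y rfl rfl c a b; exact Λ.map_inner g a b
  isInducing := IdealFamily.isInducing_of_inverse Λ.continuous_toFun Λ.continuous_invFun
    fun p => congrArg (Tot.mk p.base) ((Λ.ψ p.base).symm_apply_apply p.val)

end RightTriv

namespace LeftTriv

variable {D : IdealFamily 𝒢.r A.UFib} (L : LeftTriv A D)

/-! ### Normalisation at the units -/

/-- A trivialisation is unital if it is the identity on the unit fibres. -/
def IsUnital : Prop :=
  ∀ {y : X} (h : 𝒢.r (𝒢.u y) = y) (a : A.UFib y), L.toFun h (A.ofU a) = a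

theorem IsUnital.toFun_eq {L : LeftTriv A D} (hL : L.IsUnital) {y : X} (h : 𝒢.r (𝒢.u y) = y)
    (a : A.fib (𝒢.u y)) : L.toFun h a = A.toU a := hL h (A.toU a)

theorem unit_inner {y : X} (a b : A.UFib y) :
    L.toFun (𝒢.r_u y) (A.ofU a) * star (L.toFun (𝒢.r_u y) (A.ofU b)) = a * star b :=
  A.ofU_inj (L.map_inner (𝒢.r_u y) (𝒢.u_eq_inv y) (𝒢.comp_u_u y) _ _)

/-- Every product `a b` in a unit fibre equals `Ψ(a) Ψ(b⋆)⋆`, which lies in the ideal, and such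
products span the fibre. -/
theorem unit_mem (L : LeftTriv A D) {y : X} (d : A.UFib y) : d ∈ D (𝒢.u y) (𝒢.r_u y) := by
  refine (⊤ : ClosedIdeal (A.UFib y)).induction (p := (· ∈ D (𝒢.u y) (𝒢.r_u y))) (zero_mem _)
    (fun a b _ _ => add_mem) (fun a b _ _ => ?_) trivial
  rw [← star_star b, ← L.unit_inner]
  exact mul_mem (L.mem _ _) (star_mem (L.mem _ _))

theorem exists_unit_inv (L : LeftTriv A D) (y : X) (d : A.UFib y) :
    ∃ a : A.UFib y, L.toFun (𝒢.r_u y) (A.ofU a) = d := L.surj _ (L.unit_mem d)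

/-- The inverse of the trivialisation over a unit. -/
noncomputable def unitInv (y : X) (d : A.UFib y) : A.UFib y := (L.exists_unit_inv y d).choose

theorem toFun_unitInv {y : X} (d : A.UFib y) :
    L.toFun (𝒢.r_u y) (A.ofU (L.unitInv y d)) = d := (L.exists_unit_inv y d).choose_spec

theorem unitInv_unique {y : X} {a d : A.UFib y} (h : L.toFun (𝒢.r_u y) (A.ofU a) = d) :
    L.unitInv y d = a := A.ofU_inj (L.inj (𝒢.r_u y) ((L.toFun_unitInv d).trans h.symm))

theorem unit_mul {y : X} (b a : A.UFib y) :
    L.toFun (𝒢.r_u y) (A.ofU (b * a)) = b * L.toFun (𝒢.r_u y) (A.ofU a) :=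
  L.map_smul (𝒢.r_u y) (𝒢.comp_u_u y) b (A.ofU a)

theorem unitInv_zero (y : X) : L.unitInv y 0 = 0 := L.unitInv_unique (L.map_zero _)

theorem unitInv_add {y : X} (d e : A.UFib y) :
    L.unitInv y (d + e) = L.unitInv y d + L.unitInv y e :=
  L.unitInv_unique (by rw [A.ofU_add, L.map_add, toFun_unitInv, toFun_unitInv])

theorem unitInv_smul {y : X} (z : ℂ) (d : A.UFib y) :
    L.unitInv y (z • d) = z • L.unitInv y d :=
  L.unitInv_unique (by rw [A.ofU_smul, L.map_csmul, toFun_unitInv])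

theorem unitInv_mul {y : X} (b d : A.UFib y) : L.unitInv y (b * d) = b * L.unitInv y d :=
  L.unitInv_unique (by rw [unit_mul, toFun_unitInv])

/-- By left linearity, a product `a b` with `a ∈ I` goes to `a` times something. Hence normalising
at the units leaves the ideals `D_g` unchanged. -/
theorem unitInv_mem {y : X} {I : ClosedIdeal (A.UFib y)} {d : A.UFib y} (hd : d ∈ I) :
    L.unitInv y d ∈ I :=
  I.induction (p := fun d => L.unitInv y d ∈ I) (by rw [unitInv_zero]; exact zero_mem I)
    (fun a b _ _ ha hb => by rw [unitInv_add]; exact add_mem ha hb)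
    (fun a b ha _ => by rw [unitInv_mul]; exact I.mul_mem_r _ ha) hd

theorem unit_mem_of_mem {y : X} {I : ClosedIdeal (A.UFib y)} {d : A.UFib y} (hd : d ∈ I) :
    L.toFun (𝒢.r_u y) (A.ofU d) ∈ I :=
  I.induction (p := fun d => L.toFun (𝒢.r_u y) (A.ofU d) ∈ I)
    (by rw [A.ofU_zero, map_zero]; exact zero_mem I)
    (fun a b _ _ ha hb => by rw [A.ofU_add, map_add]; exact add_mem ha hb)
    (fun a b ha _ => by rw [unit_mul]; exact I.mul_mem_r _ ha) hd

theorem isInducing_unitInv : Topology.IsInducing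
    fun p : Tot A.UFib => (⟨p.base, L.unitInv p.base p.val⟩ : Tot A.UFib) := by
  have h1 : Continuous fun p : Tot A.UFib => (⟨p.base, L.unitInv p.base p.val⟩ : Tot A.UFib) := by
    refine continuous_iff_continuousAt.2 fun p => A.tendsto_UFib.2 ?_
    refine (L.tendsto_iff (fun z => 𝒢.r_u _) (𝒢.r_u _)
      (g := fun p : Tot A.UFib => 𝒢.u p.base)
      (a := fun p => A.ofU (L.unitInv p.base p.val))
      (a0 := A.ofU (L.unitInv _ p.val))).2 ⟨?_, ?_⟩
    · exact (𝒢.continuous_u.tendsto _).comp (A.isCStarField_UFib.tendsto_base tendsto_id)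
    · simp only [toFun_unitInv]
      exact tendsto_id
  have h2 : Continuous fun p : Tot A.UFib =>
      (⟨p.base, L.toFun (𝒢.r_u p.base) (A.ofU p.val)⟩ : Tot A.UFib) :=
    continuous_iff_continuousAt.2 fun p => ((L.tendsto_iff (fun z => 𝒢.r_u _) (𝒢.r_u _)).1
      (A.tendsto_UFib.1 (tendsto_id (x := 𝓝 p)))).2
  exact (Topology.IsEmbedding.of_leftInverse
    (fun p => congrArg (Tot.mk p.base) (L.toFun_unitInv p.val)) h2 h1).isInducing

/-- Every trivialisation can be changed so as to become the identity on the unit fibres. -/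
noncomputable def normalize : LeftTriv A D where
  toFun {g y} hy a := L.unitInv y (L.toFun hy a)
  map_add hy a b := by rw [L.map_add, unitInv_add]
  map_csmul hy z a := by rw [L.map_csmul, unitInv_smul]
  mem hy a := L.unitInv_mem (L.mem hy a)
  surj {g y} hy d hd := by
    obtain ⟨a, ha⟩ := L.surj hy (L.unit_mem_of_mem hd)
    exact ⟨a, L.unitInv_unique ha.symm⟩
  map_smul hy c b a := by rw [L.map_smul, unitInv_mul]
  map_inner {g g' y} hy i c a b := by
    -- Over a unit `Ψ` preserves inner products, hence so does its inverse.
    rw [← L.unit_inner, toFun_unitInv, toFun_unitInv, L.map_inner hy i c]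
  isInducing := (Topology.IsInducing.id.prodMap L.isInducing_unitInv).comp L.isInducing

theorem isUnital_normalize : L.normalize.IsUnital := fun _ _ => L.unitInv_unique rfl

/-! ### The partial maps of a trivialisation -/

variable {g g' : G} {x y : X}

/-- `d` acts on the image of the trivialisation as `c` acts from the right on the fibre. -/
def IsAct (hx : 𝒢.s g = x) (hy : 𝒢.r g = y) (c : A.UFib x) (d : A.UFib y) : Prop :=
  ∀ a : A.fib g, L.toFun hy (A.mul (comp_u_right_of hx) a (A.ofU c)) = L.toFun hy a * d

section

variable {L} {hx : 𝒢.s g = x} {hy : 𝒢.r g = y} {c c' : A.UFib x} {d d' : A.UFib y}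

theorem IsAct.zero : L.IsAct hx hy 0 0 := fun a => by
  rw [A.ofU_zero, A.mul_zero, L.map_zero, mul_zero]

theorem IsAct.add (h : L.IsAct hx hy c d) (h' : L.IsAct hx hy c' d') :
    L.IsAct hx hy (c + c') (d + d') := fun a => by
  rw [A.ofU_add, A.mul_add, L.map_add, h, h', mul_add]

theorem IsAct.smul (h : L.IsAct hx hy c d) (z : ℂ) : L.IsAct hx hy (z • c) (z • d) := fun a => by
  rw [A.ofU_smul, A.mul_smul, L.map_csmul, h, mul_smul_comm]

theorem IsAct.mul (h : L.IsAct hx hy c d) (h' : L.IsAct hx hy c' d') :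
    L.IsAct hx hy (c * c') (d * d') := fun a => by
  rw [A.ofU_mul (𝒢.comp_u_u x), ← A.mul_assoc (comp_u_right_of hx) (comp_u_right_of hx), h', h,
    mul_assoc]

end

/-- In `m (a⋆ b) = (m a⋆) b`, the factor `m a⋆ = Ψ(m) Ψ(a)⋆` lies in the unit fibre at `y`, so left
linearity applies. This is the source of `α_g`. -/
theorem isAct_inner (hx : 𝒢.s g = x) (hy : 𝒢.r g = y) (i : g' = 𝒢.inv g)
    (c : 𝒢.IsComp g' g (𝒢.u x)) (a b : A.fib g) :
    L.IsAct hx hy (A.toU (A.mul c (A.star i a) b)) (star (L.toFun hy a) * L.toFun hy b) := by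
  intro m
  rw [A.ofU_toU, ← A.mul_assoc (comp_mul_inv_of i hy) (comp_u_left_of hy) c,
    ← L.map_inner hy i (comp_mul_inv_of i hy), L.map_smul, mul_assoc]

/-- `a⋆ b` is the left inner product of `a⋆` and `b⋆` in the fibre at `g⁻¹`. -/
theorem mul_mem_of_inner (L : LeftTriv A D) (hx' : 𝒢.r g' = x) (i : g' = 𝒢.inv g)
    (c : 𝒢.IsComp g' g (𝒢.u x)) (a b : A.fib g) :
    A.toU (A.mul c (A.star i a) b) ∈ D g' hx' := by
  have h := L.map_inner hx' (eq_inv_symm i) c (A.star i a) (A.star i b)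
  rw [A.star_star] at h
  rw [← h]
  exact mul_mem (L.mem _ _) (star_mem (L.mem _ _))

/-- Every element of the ideal at `g⁻¹` is a sum of elements `a⋆ b` with `a` and `b` in the fibre
at `g`. -/
theorem induction_inner (L : LeftTriv A D) (hx' : 𝒢.r g' = x) (i : g' = 𝒢.inv g)
    (c : 𝒢.IsComp g' g (𝒢.u x)) {p : A.UFib x → Prop} (h0 : p 0)
    (hadd : ∀ a b, a ∈ D g' hx' → b ∈ D g' hx' → p a → p b → p (a + b))
    (h : ∀ a b : A.fib g, p (A.toU (A.mul c (A.star i a) b))) {e : A.UFib x}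
    (he : e ∈ D g' hx') : p e := by
  refine (D g' hx').induction h0 hadd (fun a b ha hb => ?_) he
  obtain ⟨m, rfl⟩ := L.surj hx' ha
  obtain ⟨n, hn⟩ := L.surj hx' (star_mem hb)
  have := h (A.star (eq_inv_symm i) m) (A.star (eq_inv_symm i) n)
  rw [A.star_star, ← L.map_inner hx' (eq_inv_symm i) c, hn, star_star] at this
  exact this

/-- Every element of the ideal at `g` is a sum of elements `Ψ(a)⋆ Ψ(b)`. -/
theorem induction_star_mul (hy : 𝒢.r g = y) {p : A.UFib y → Prop} (h0 : p 0)
    (hadd : ∀ a b, a ∈ D g hy → b ∈ D g hy → p a → p b → p (a + b))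
    (h : ∀ a b : A.fib g, p (star (L.toFun hy a) * L.toFun hy b)) {e : A.UFib y}
    (he : e ∈ D g hy) : p e := by
  refine (D g hy).induction h0 hadd (fun a b ha hb => ?_) he
  obtain ⟨m, hm⟩ := L.surj hy (star_mem ha)
  obtain ⟨n, rfl⟩ := L.surj hy hb
  have := h m n
  rwa [hm, star_star] at this

/-- On generators `c = a⋆ b` take `d = Ψ(a)⋆ Ψ(b)`. The adjoint pair is carried along because
`IsAct` does not mention the involution; it makes `α_g` preserve adjoints. -/
theorem exists_isAct (hx : 𝒢.s g = x) (hx' : 𝒢.r g' = x) (hy : 𝒢.r g = y) (i : g' = 𝒢.inv g)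
    {c : A.UFib x} (hc : c ∈ D g' hx') :
    ∃ d ∈ D g hy, L.IsAct hx hy c d ∧ L.IsAct hx hy (star c) (star d) := by
  have cc := comp_inv_mul_of i hx'
  refine L.induction_inner hx' i cc
    (p := fun c => ∃ d ∈ D g hy, L.IsAct hx hy c d ∧ L.IsAct hx hy (star c) (star d))
    ?_ ?_ ?_ hc
  · refine ⟨0, zero_mem _, IsAct.zero, ?_⟩
    rw [star_zero, star_zero]; exact IsAct.zero
  · rintro a b - - ⟨d, hd, h1, h2⟩ ⟨d', hd', h1', h2'⟩
    refine ⟨d + d', add_mem hd hd', h1.add h1', ?_⟩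
    rw [star_add, star_add]; exact h2.add h2'
  · intro a b
    refine ⟨_, mul_mem (star_mem (L.mem _ a)) (L.mem _ b), L.isAct_inner hx hy i cc a b, ?_⟩
    have h := L.isAct_inner hx hy i cc b a
    rw [star_mul, star_star]
    convert h using 1
    apply A.ofU_inj
    rw [A.ofU_star (𝒢.u_eq_inv x), A.ofU_toU,
      A.star_mul cc cc (eq_inv_symm i) i, A.star_star, A.ofU_toU]

theorem exists_isAct' (L : LeftTriv A D) (hx : 𝒢.s g = x) (hx' : 𝒢.r g' = x) (hy : 𝒢.r g = y) (i : g' = 𝒢.inv g)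
    {d : A.UFib y} (hd : d ∈ D g hy) : ∃ c ∈ D g' hx', L.IsAct hx hy c d := by
  refine L.induction_star_mul hy (p := fun d => ∃ c ∈ D g' hx', L.IsAct hx hy c d)
    ⟨0, zero_mem _, IsAct.zero⟩ ?_ ?_ hd
  · rintro a b - - ⟨d, hd, h1⟩ ⟨d', hd', h1'⟩
    exact ⟨d + d', add_mem hd hd', h1.add h1'⟩
  · intro a b
    exact ⟨_, L.mul_mem_of_inner hx' i (comp_inv_mul_of i hx') a b, L.isAct_inner _ _ _ _ _ _⟩

variable {L} in
-- The values `Ψ(a)` fill `D_g`, and an element of an ideal is determined by its left multiples by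
-- that ideal.
theorem IsAct.unique {hx : 𝒢.s g = x} {hy : 𝒢.r g = y} {c : A.UFib x} {d d' : A.UFib y}
    (h : L.IsAct hx hy c d) (h' : L.IsAct hx hy c d') (hd : d ∈ D g hy) (hd' : d' ∈ D g hy) :
    d = d' := by
  refine ClosedIdeal.eq_of_forall_mul_left hd hd' fun z hz => ?_
  obtain ⟨a, rfl⟩ := L.surj hy hz
  rw [← h, h']

variable {L} in
-- Injectivity of `Ψ` gives `b c = b c'` for all `b` in the fibre at `g`. Multiplying by `a⋆` from
-- the left gives equality of left multiples by the elements `a⋆ b`, which span the ideal at `g⁻¹`.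
theorem IsAct.unique' {hx : 𝒢.s g = x} (hx' : 𝒢.r g' = x) {hy : 𝒢.r g = y} (i : g' = 𝒢.inv g)
    {c c' : A.UFib x} {d : A.UFib y} (h : L.IsAct hx hy c d) (h' : L.IsAct hx hy c' d)
    (hc : c ∈ D g' hx') (hc' : c' ∈ D g' hx') : c = c' := by
  have key : ∀ a : A.fib g, A.mul (comp_u_right_of hx) a (A.ofU c) =
      A.mul (comp_u_right_of hx) a (A.ofU c') := fun a => L.inj hy (by rw [h, h'])
  refine ClosedIdeal.eq_of_forall_mul_left hc hc' fun z hz => ?_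
  have cc := comp_inv_mul_of i hx'
  refine L.induction_inner hx' i cc (p := fun z => z * c = z * c') (by simp)
    (fun a b _ _ ha hb => by rw [add_mul, ha, hb, add_mul]) (fun a b => ?_) hz
  apply A.ofU_inj
  rw [A.ofU_mul (𝒢.comp_u_u x), A.ofU_mul (𝒢.comp_u_u x), A.ofU_toU,
    A.mul_assoc cc (𝒢.comp_u_u x) (comp_u_right_of hx) cc, key,
    A.mul_assoc cc (𝒢.comp_u_u x) (comp_u_right_of hx) cc]

/-- The *-isomorphism between the ideals at `g⁻¹` and at `g`. -/
noncomputable def actEquiv (hx : 𝒢.r g' = x) (hy : 𝒢.r g = y) (i : g' = 𝒢.inv g) :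
    D g' hx ≃⋆ₐ[ℂ] D g hy := by
  choose f hf hf1 hf2 using fun c : D g' hx => L.exists_isAct (s_eq_of_inv i hx) hx hy i c.2
  choose f' hf' hf1' using fun d : D g hy => L.exists_isAct' (s_eq_of_inv i hx) hx hy i d.2
  exact
  { toFun := fun c => ⟨f c, hf c⟩
    invFun := fun d => ⟨f' d, hf' d⟩
    left_inv := fun c => Subtype.ext ((hf1' ⟨f c, hf c⟩).unique' hx i (hf1 c) (hf' _) c.2)
    right_inv := fun d => Subtype.ext ((hf1 ⟨f' d, hf' d⟩).unique (hf1' d) (hf _) d.2)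
    map_mul' := fun c c' => Subtype.ext ((hf1 (c * c')).unique ((hf1 c).mul (hf1 c')) (hf _)
      (mul_mem (hf c) (hf c')))
    map_add' := fun c c' => Subtype.ext ((hf1 (c + c')).unique ((hf1 c).add (hf1 c')) (hf _)
      (add_mem (hf c) (hf c')))
    map_star' := fun c => Subtype.ext ((hf1 (star c)).unique (hf2 c) (hf _) (star_mem (hf c)))
    map_smul' := fun z c => Subtype.ext ((hf1 (z • c)).unique ((hf1 c).smul z) (hf _)
      (SMulMemClass.smul_mem z (hf c))) }

theorem isAct_actEquiv (hx : 𝒢.r g' = x) (hy : 𝒢.r g = y) (i : g' = 𝒢.inv g) (c : D g' hx) :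
    L.IsAct (s_eq_of_inv i hx) hy c (L.actEquiv hx hy i c : D g hy) :=
  (L.exists_isAct (s_eq_of_inv i hx) hx hy i c.2).choose_spec.2.1

end LeftTriv

namespace LeftTriv

variable {D : IdealFamily 𝒢.r A.UFib} (L : LeftTriv A D)

/-! ### The twist of a trivialisation -/

variable {g h k g' h' k' : G} {x y z : X}

/-- The image of `a · Ψ(b)` for `a` in the fibre at `g` and `b` in the fibre at `h`. -/
def mulTriv (hx : 𝒢.s g = x) (hy : 𝒢.r g = y) (hh : 𝒢.r h = x) (a : A.fib g) (b : A.fib h) :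
    A.UFib y :=
  L.toFun hy (A.mul (comp_u_right_of hx) a (A.ofU (L.toFun hh b)))

/-- Both sides are `a b b'⋆ a'⋆`, because `Ψ(b) Ψ(b')⋆ = b b'⋆`. This identity produces the twist.
-/
theorem mulTriv_mul_star (c : 𝒢.IsComp g h k) (hx : 𝒢.s g = x) (hy : 𝒢.r g = y)
    (hh : 𝒢.r h = x) (hk : 𝒢.r k = y) (a a' : A.fib g) (b b' : A.fib h) :
    L.mulTriv hx hy hh a b * star (L.mulTriv hx hy hh a' b') =
      L.toFun hk (A.mul c a b) * star (L.toFun hk (A.mul c a' b')) := by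
  apply A.ofU_inj
  have cr := comp_u_right_of hx
  have cg := comp_mul_inv_of rfl hy
  have ck := comp_mul_inv_of rfl hk
  have ch := comp_mul_inv_of rfl hh
  have cl := comp_u_left_of ((𝒢.r_inv g).trans hx)
  have cv : 𝒢.IsComp (𝒢.inv h) (𝒢.inv g) (𝒢.inv k) := c.inv_rev rfl rfl rfl
  have cw : 𝒢.IsComp h (𝒢.inv k) (𝒢.inv g) := cv.inv_left (eq_inv_symm rfl)
  rw [mulTriv, mulTriv, L.map_inner hy rfl cg, L.map_inner hk rfl ck,
    A.star_mul cr cl rfl (𝒢.u_eq_inv x) rfl, A.star_mul c cv rfl rfl rfl,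
    A.mul_assoc cr cg cl cg, ← A.mul_assoc (𝒢.comp_u_u x) cl cl cl, ← A.ofU_star, ← A.ofU_mul,
    L.map_inner hh rfl ch, A.mul_assoc c ck cw cg, ← A.mul_assoc ch cl cv cw]

variable {L} in
/-- If `α_g(c) = Ψ(a)` then `α_g(c e) = Ψ(a · e)`. -/
theorem IsAct.mul_right {hx : 𝒢.s g = x} {hy : 𝒢.r g = y} {c : A.UFib x} {a : A.fib g}
    (H : L.IsAct hx hy c (L.toFun hy a)) (e : A.UFib x) :
    L.IsAct hx hy (c * e) (L.toFun hy (A.mul (comp_u_right_of hx) a (A.ofU e))) := by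
  intro m
  have cr := comp_u_right_of hx
  have cl := comp_u_left_of hy
  have key : A.mul cr m (A.ofU c) = A.mul cl (A.ofU (L.toFun hy m)) a :=
    L.inj hy (by rw [H, L.map_smul])
  rw [A.ofU_mul (𝒢.comp_u_u x), ← A.mul_assoc cr cr, key, A.mul_assoc cl cr cr cl, L.map_smul]

variable {L} in
theorem IsAct.star {hx : 𝒢.s g = x} (hx' : 𝒢.r g' = x) {hy : 𝒢.r g = y} (i : g' = 𝒢.inv g)
    {c : A.UFib x} {d : A.UFib y} (H : L.IsAct hx hy c d) (hc : c ∈ D g' hx') (hd : d ∈ D g hy) :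
    L.IsAct hx hy (star c) (star d) := by
  obtain ⟨d', hd', h1, h2⟩ := L.exists_isAct hx hx' hy i hc
  rwa [H.unique h1 hd hd']

/-- If `α_g(c) = Ψ(a)`, then `c Ψ(b)` is the required element. -/
theorem isAct_mulTriv (hx : 𝒢.s g = x) (hx' : 𝒢.r g' = x) (hy : 𝒢.r g = y) (i : g' = 𝒢.inv g)
    (hh : 𝒢.r h = x) (a : A.fib g) (b : A.fib h) :
    ∃ e ∈ D g' hx' ⊓ D h hh, L.IsAct hx hy e (L.mulTriv hx hy hh a b) := by
  obtain ⟨c, hc, H⟩ := L.exists_isAct' hx hx' hy i (L.mem hy a)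
  exact ⟨c * L.toFun hh b, ⟨(D g' hx').mul_mem_r _ hc, (D h hh).mul_mem_l _ (L.mem hh b)⟩,
    H.mul_right _⟩

/-- Write `e` as a sum of products `e₁ e₂` in `D_{g⁻¹} ∩ D_h`, and choose `a`, `b` with `α_g(e₁) =
Ψ(a)` and `e₂ = Ψ(b)`. Then `α_g(e₁ e₂) = Ψ(a Ψ(b))`. -/
theorem induction_act (hx : 𝒢.s g = x) (hx' : 𝒢.r g' = x) (hy : 𝒢.r g = y) (i : g' = 𝒢.inv g)
    (hh : 𝒢.r h = x) {p : A.UFib y → Prop} (h0 : p 0) (hadd : ∀ a b, p a → p b → p (a + b))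
    (hp : ∀ a b, p (L.mulTriv hx hy hh a b)) {e : A.UFib x} (he : e ∈ D g' hx')
    (he' : e ∈ D h hh) {d : A.UFib y} (hd : d ∈ D g hy) (H : L.IsAct hx hy e d) : p d := by
  obtain ⟨d', hd', H', h3⟩ : ∃ d ∈ D g hy, L.IsAct hx hy e d ∧ p d := by
    refine (D g' hx' ⊓ D h hh).induction (p := fun e => ∃ d ∈ D g hy, L.IsAct hx hy e d ∧ p d)
      ⟨0, zero_mem _, IsAct.zero, h0⟩ ?_ ?_ (ClosedIdeal.mem_inf.2 ⟨he, he'⟩)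
    · rintro a b - - ⟨d, hd, h1, h2⟩ ⟨d', hd', h1', h2'⟩
      exact ⟨d + d', add_mem hd hd', h1.add h1', hadd _ _ h2 h2'⟩
    · rintro e1 e2 he1 he2
      obtain ⟨d1, hd1, H1, -⟩ := L.exists_isAct hx hx' hy i he1.1
      obtain ⟨a, rfl⟩ := L.surj hy hd1
      obtain ⟨b, rfl⟩ := L.surj hh he2.2
      exact ⟨_, L.mem _ _, H1.mul_right _, hp a b⟩
  rwa [H.unique H' hd hd']

/-- The image of a product is an inner product of sums of elements `Ψ(a Ψ(b))`. By
`mulTriv_mul_star` it is a sum of terms `Ψ(a b) Ψ(a' b')⋆`, which lie in `D_{gh}`. -/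
theorem isAct_mem (c : 𝒢.IsComp g h k) (hx : 𝒢.s g = x) (hx' : 𝒢.r g' = x) (hy : 𝒢.r g = y)
    (i : g' = 𝒢.inv g) (hh : 𝒢.r h = x) (hk : 𝒢.r k = y) {e : A.UFib x} (he : e ∈ D g' hx')
    (he' : e ∈ D h hh) {d : A.UFib y} (hd : d ∈ D g hy) (H : L.IsAct hx hy e d) :
    d ∈ D k hk := by
  obtain ⟨d', hd', H', h3⟩ : ∃ d ∈ D g hy, L.IsAct hx hy e d ∧ d ∈ D k hk := by
    refine (D g' hx' ⊓ D h hh).induction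
      (p := fun e => ∃ d ∈ D g hy, L.IsAct hx hy e d ∧ d ∈ D k hk)
      ⟨0, zero_mem _, IsAct.zero, zero_mem _⟩ ?_ ?_ (ClosedIdeal.mem_inf.2 ⟨he, he'⟩)
    · rintro a b - - ⟨d, hd, h1, h2⟩ ⟨d', hd', h1', h2'⟩
      exact ⟨d + d', add_mem hd hd', h1.add h1', add_mem h2 h2'⟩
    · rintro e1 e2 he1 he2
      -- With `e₂ = (e₂⋆)⋆` the image of `e₁ e₂` takes the form `d₁ d₂⋆`, to which the inner product
      -- identity applies.
      have he2' := star_mem he2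
      obtain ⟨d1, hd1, H1, -⟩ := L.exists_isAct hx hx' hy i he1.1
      obtain ⟨d2, hd2, H2, H2'⟩ := L.exists_isAct hx hx' hy i he2'.1
      rw [star_star] at H2'
      refine ⟨d1 * star d2, mul_mem hd1 (star_mem hd2), H1.mul H2', ?_⟩
      refine L.induction_act hx hx' hy i hh (p := fun d1 => d1 * star d2 ∈ D k hk)
        (by rw [zero_mul]; exact zero_mem _) (fun a b ha hb => by rw [add_mul]; exact add_mem ha hb)
        (fun a b => ?_) he1.1 he1.2 hd1 H1
      refine L.induction_act hx hx' hy i hh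
        (p := fun d2 => L.mulTriv hx hy hh a b * star d2 ∈ D k hk)
        (by rw [star_zero, mul_zero]; exact zero_mem _)
        (fun a b ha hb => by rw [star_add, mul_add]; exact add_mem ha hb)
        (fun a' b' => ?_) he2'.1 he2'.2 hd2 H2
      rw [L.mulTriv_mul_star c hx hy hh hk]
      exact mul_mem (L.mem _ _) (star_mem (L.mem _ _))
  rwa [H.unique H' hd hd']

theorem mulTriv_mem (c : 𝒢.IsComp g h k) (hx : 𝒢.s g = x) (hy : 𝒢.r g = y) (hh : 𝒢.r h = x)
    (hk : 𝒢.r k = y) (a : A.fib g) (b : A.fib h) :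
    L.mulTriv hx hy hh a b ∈ D g hy ⊓ D k hk := by
  have hx' := (𝒢.r_inv g).trans hx
  obtain ⟨e, he, H⟩ := L.isAct_mulTriv hx hx' hy rfl hh a b
  exact ⟨L.mem _ _, L.isAct_mem c hx hx' hy rfl hh hk he.1 he.2 (L.mem _ _) H⟩

theorem toFun_mul_mem_right (c : 𝒢.IsComp g h k) (hx : 𝒢.s g = x) (hy : 𝒢.r g = y)
    (hh : 𝒢.r h = x) (hk : 𝒢.r k = y) (a : A.fib g) {e : A.UFib x} (he : e ∈ D h hh) :
    L.toFun hy (A.mul (comp_u_right_of hx) a (A.ofU e)) ∈ D g hy ⊓ D k hk := by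
  obtain ⟨b, rfl⟩ := L.surj hh he
  exact L.mulTriv_mem c hx hy hh hk a b

/-- Elements of the fibre at `g` are sums of `z m` with `z ∈ D_g`, and `Ψ(z m b) = z Ψ(m b)`. -/
theorem toFun_mul_mem (c : 𝒢.IsComp g h k) (hy : 𝒢.r g = y) (hk : 𝒢.r k = y) (a : A.fib g)
    (b : A.fib h) : L.toFun hk (A.mul c a b) ∈ D g hy ⊓ D k hk := by
  refine ⟨?_, L.mem _ _⟩
  refine (D g hy).induction
    (p := fun z => ∀ a, L.toFun hy a = z → L.toFun hk (A.mul c a b) ∈ D g hy) ?_ ?_ ?_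
    (L.mem hy a) a rfl
  · intro a ha
    rw [L.inj hy (ha.trans (L.map_zero hy).symm), A.zero_mul, L.map_zero]
    exact zero_mem _
  · intro z z' hz hz' h1 h2 a ha
    obtain ⟨m, rfl⟩ := L.surj hy hz
    obtain ⟨m', rfl⟩ := L.surj hy hz'
    rw [L.inj hy (ha.trans (L.map_add hy _ _).symm), A.add_mul, L.map_add]
    exact add_mem (h1 _ rfl) (h2 _ rfl)
  · intro z z' hz hz' a ha
    obtain ⟨m', rfl⟩ := L.surj hy hz'
    rw [L.inj hy (ha.trans (L.map_smul hy (comp_u_left_of hy) _ _).symm),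
      A.mul_assoc (comp_u_left_of hy) c c (comp_u_left_of hk), L.map_smul]
    exact (D g hy).mul_mem_r _ hz

/-- The ideal `D_g ∩ D_{gh}` is spanned by the images of products `a b`. -/
theorem induction_toFun_mul (c : 𝒢.IsComp g h k) (hy : 𝒢.r g = y) (hk : 𝒢.r k = y)
    {p : A.UFib y → Prop} (h0 : p 0) (hadd : ∀ a b, p a → p b → p (a + b))
    (hp : ∀ a b, p (L.toFun hk (A.mul c a b))) {e : A.UFib y} (he : e ∈ D g hy ⊓ D k hk) :
    p e := by
  refine (D g hy ⊓ D k hk).induction h0 (fun a b _ _ => hadd a b) (fun e1 e2 he1 he2 => ?_) he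
  obtain ⟨n, rfl⟩ := L.surj hk he2.2
  refine (D g hy).induction (p := fun z => p (z * L.toFun hk n)) (by rwa [zero_mul])
    (fun a b _ _ ha hb => by rw [add_mul]; exact hadd _ _ ha hb) (fun z1 z2 hz1 hz2 => ?_) he1.1
  obtain ⟨a, rfl⟩ := L.surj hy hz1
  obtain ⟨a', ha'⟩ := L.surj hy (star_mem hz2)
  have cl := comp_u_left_of hk
  have cg := comp_mul_inv_of rfl hy
  -- `Ψ(a) Ψ(a')⋆ Ψ(n) = Ψ(a (a'⋆ n))`, where `a'⋆ n` lies in the fibre at `h = g⁻¹ k`.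
  have := hp a (A.mul (c.inv_left rfl) (A.star rfl a') n)
  rwa [← A.mul_assoc cg cl (c.inv_left rfl) c, ← L.map_inner hy rfl cg, ha', star_star,
    L.map_smul] at this

/-- The ideal `D_g ∩ D_{gh}` is spanned by the images of elements `a · Ψ(b)`. -/
theorem induction_mulTriv (c : 𝒢.IsComp g h k) (hx : 𝒢.s g = x) (hy : 𝒢.r g = y)
    (hh : 𝒢.r h = x) (hk : 𝒢.r k = y) {p : A.UFib y → Prop} (h0 : p 0)
    (hadd : ∀ a b, p a → p b → p (a + b)) (hp : ∀ a b, p (L.mulTriv hx hy hh a b))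
    {e : A.UFib y} (he : e ∈ D g hy ⊓ D k hk) : p e := by
  -- The span is stable under right multiplication by `D_g`: if `d = α_g(e)`, then `Ψ(a Ψ(b)) d =
  -- Ψ(a (Ψ(b) e))`, and `Ψ(b) e` is again in `D_h`.
  have hp' : ∀ a b, ∀ d ∈ D g hy, p (L.mulTriv hx hy hh a b * d) := by
    intro a b d hd
    have hx' := (𝒢.r_inv g).trans hx
    obtain ⟨e, he, H⟩ := L.exists_isAct' hx hx' hy rfl hd
    obtain ⟨b', hb'⟩ := L.surj hh ((D h hh).mul_mem_r e (L.mem hh b))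
    have := hp a b'
    rwa [mulTriv, hb', A.ofU_mul (𝒢.comp_u_u x),
      ← A.mul_assoc (comp_u_right_of hx) (comp_u_right_of hx), H] at this
  refine (D g hy ⊓ D k hk).induction h0 (fun a b _ _ => hadd a b) (fun e1 e2 he1 he2 => ?_) he
  refine L.induction_toFun_mul c hy hk (p := fun e1 => p (e1 * e2)) (by rwa [zero_mul])
    (fun a b ha hb => by rw [add_mul]; exact hadd _ _ ha hb) (fun a b => ?_) he1
  rw [← star_star e2]
  refine L.induction_toFun_mul c hy hk (p := fun z => p (L.toFun hk (A.mul c a b) * star z))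
    (by rwa [star_zero, mul_zero]) (fun a b ha hb => by rw [star_add, mul_add]; exact hadd _ _ ha hb)
    (fun a' b' => ?_) (star_mem he2)
  rw [← L.mulTriv_mul_star c hx hy hh hk]
  exact hp' _ _ _ (star_mem (L.mem _ _))

/-- The two families of generators of `D_g ∩ D_{gh}` have equal left inner products, so a unitary
multiplier relates them. -/
theorem exists_twist (c : 𝒢.IsComp g h k) (hy : 𝒢.r g = y) (hk : 𝒢.r k = y) :
    ∃ m : unitary 𝓜(ℂ, ↥(D g hy ⊓ D k hk)), ∀ (a : A.fib g) (b : A.fib h),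
      (D g hy ⊓ D k hk).rmul (m : 𝓜(ℂ, ↥(D g hy ⊓ D k hk))) (L.mulTriv c.1 hy rfl a b) =
        L.toFun hk (A.mul c a b) := by
  obtain ⟨m, hm⟩ := (D g hy ⊓ D k hk).exists_unitary
    (fun q : A.fib g × A.fib h => L.mulTriv c.1 hy rfl q.1 q.2)
    (fun q => L.toFun hk (A.mul c q.1 q.2))
    (fun q q' => L.mulTriv_mul_star c c.1 hy rfl hk _ _ _ _)
    (fun q => L.mulTriv_mem c c.1 hy rfl hk _ _) (fun q => L.toFun_mul_mem c hy hk _ _)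
    (fun P h0 hadd hp e he => L.induction_mulTriv c c.1 hy rfl hk h0 hadd
      (fun a b => hp (a, b)) he)
    (fun P h0 hadd hp e he => L.induction_toFun_mul c hy hk h0 hadd (fun a b => hp (a, b)) he)
  exact ⟨m, fun a b => hm (a, b)⟩

/-- The data of the twisted partial action defined by a trivialisation. -/
@[reducible] noncomputable def data : TwistedPartialActionData.{uG, uX, w} 𝒢 where
  B := A.UFib
  isCStarField := A.isCStarField_UFib
  D := D
  α _ _ _ _ i hx hy := L.actEquiv hx hy i
  w _ _ _ _ c hy hk := (L.exists_twist c hy hk).choose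

/-- Apart from unitarity, this is the only property of the chosen multiplier that is used. -/
theorem mulw_mulTriv (c : 𝒢.IsComp g h k) (hx : 𝒢.s g = x) (hy : 𝒢.r g = y) (hh : 𝒢.r h = x)
    (hk : 𝒢.r k = y) (a : A.fib g) (b : A.fib h) :
    L.data.mulw c hy hk (L.mulTriv hx hy hh a b) = L.toFun hk (A.mul c a b) := by
  subst hh
  exact (L.exists_twist c hy hk).choose_spec a b

section

variable {L} {hy : 𝒢.r g = y} {hk : 𝒢.r k = y}

theorem act_mem (i : g' = 𝒢.inv g) (hx : 𝒢.r g' = x) {c : A.UFib x}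
    (hc : c ∈ D g' hx) : L.data.act i hx hy c ∈ D g hy := by
  rw [TwistedPartialActionData.act, dif_pos hc]
  exact SetLike.coe_mem _

theorem isAct_act (i : g' = 𝒢.inv g) (hx : 𝒢.r g' = x) {c : A.UFib x}
    (hc : c ∈ D g' hx) : L.IsAct (s_eq_of_inv i hx) hy c (L.data.act i hx hy c) := by
  rw [TwistedPartialActionData.act, dif_pos hc]
  exact L.isAct_actEquiv hx hy i ⟨c, hc⟩

theorem IsAct.act_eq (i : g' = 𝒢.inv g) (hx : 𝒢.r g' = x) {c : A.UFib x} {d : A.UFib y}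
    (H : L.IsAct (s_eq_of_inv i hx) hy c d) (hc : c ∈ D g' hx) (hd : d ∈ D g hy) :
    L.data.act i hx hy c = d := (isAct_act i hx hc).unique H (act_mem i hx hc) hd

theorem actInv_mem (i : g' = 𝒢.inv g) (hx : 𝒢.r g' = x) {d : A.UFib y}
    (hd : d ∈ D g hy) : L.data.actInv i hx hy d ∈ D g' hx := by
  rw [TwistedPartialActionData.actInv, dif_pos hd]
  exact SetLike.coe_mem _

theorem isAct_actInv (i : g' = 𝒢.inv g) (hx : 𝒢.r g' = x) {d : A.UFib y}
    (hd : d ∈ D g hy) : L.IsAct (s_eq_of_inv i hx) hy (L.data.actInv i hx hy d) d := by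
  rw [TwistedPartialActionData.actInv, dif_pos hd]
  have := L.isAct_actEquiv hx hy i ((L.actEquiv hx hy i).symm ⟨d, hd⟩)
  rwa [StarAlgEquiv.apply_symm_apply] at this

theorem IsAct.actInv_eq (i : g' = 𝒢.inv g) (hx : 𝒢.r g' = x) {c : A.UFib x} {d : A.UFib y}
    (H : L.IsAct (s_eq_of_inv i hx) hy c d) (hc : c ∈ D g' hx) (hd : d ∈ D g hy) :
    L.data.actInv i hx hy d = c :=
  (isAct_actInv i hx hd).unique' hx i H (actInv_mem i hx hd) hc

theorem act_add (i : g' = 𝒢.inv g) (hx : 𝒢.r g' = x) {c c' : A.UFib x}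
    (hc : c ∈ D g' hx) (hc' : c' ∈ D g' hx) : L.data.act i hx hy (c + c') =
      L.data.act i hx hy c + L.data.act i hx hy c' :=
  ((isAct_act i hx hc).add (isAct_act i hx hc')).act_eq i hx (add_mem hc hc')
    (add_mem (act_mem i hx hc) (act_mem i hx hc'))

theorem act_zero (i : g' = 𝒢.inv g) (hx : 𝒢.r g' = x) : L.data.act i hx hy 0 = 0 :=
  IsAct.zero.act_eq i hx (zero_mem _) (zero_mem _)

theorem mulw_add (c : 𝒢.IsComp g h k) {d d' : A.UFib y} (hd : d ∈ D g hy ⊓ D k hk)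
    (hd' : d' ∈ D g hy ⊓ D k hk) :
    L.data.mulw c hy hk (d + d') = L.data.mulw c hy hk d + L.data.mulw c hy hk d' :=
  ClosedIdeal.rmul_add _ hd hd'

theorem mulw_zero (c : 𝒢.IsComp g h k) : L.data.mulw c hy hk 0 = 0 :=
  ClosedIdeal.rmul_zero _

theorem mulw_mem (c : 𝒢.IsComp g h k) (d : A.UFib y) :
    L.data.mulw c hy hk d ∈ D g hy ⊓ D k hk := ClosedIdeal.rmul_mem _ _ _

theorem mulw_mem_of_mem (c : 𝒢.IsComp g h k) {d : A.UFib y} (hd : d ∈ D g hy ⊓ D k hk)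
    {I : ClosedIdeal (A.UFib y)} (hI : d ∈ I) :
    L.data.mulw c hy hk d ∈ I := ClosedIdeal.rmul_mem_of_mem _ hd hI

end

/-! ### The laws of the twisted partial action -/

theorem act_mem_of_comp (c : 𝒢.IsComp g h k) (i : g' = 𝒢.inv g) (hx : 𝒢.r g' = x)
    (hh : 𝒢.r h = x) (hy : 𝒢.r g = y) (hk : 𝒢.r k = y) {a : A.UFib x} (ha : a ∈ D g' hx)
    (ha' : a ∈ D h hh) : L.data.act i hx hy a ∈ D k hk :=
  L.isAct_mem c (s_eq_of_inv i hx) hx hy i hh hk ha ha' (act_mem i hx ha) (isAct_act i hx ha)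

/-- Let `f` and `e` be the images of `a` under `α_g α_h` and `α_{gh}`. For a generator `v = Ψ(m
Ψ(n))`, both `(v f) w` and `(v w) e` equal `Ψ(m n a)`, and `ClosedIdeal.eq_conj` concludes. -/
theorem act_act (c : 𝒢.IsComp g h k)
    (ig : g' = 𝒢.inv g) (ih : h' = 𝒢.inv h) (ih' : h = 𝒢.inv h') (ik : k' = 𝒢.inv k)
    (hg : 𝒢.r g = z) (hk : 𝒢.r k = z) (hg' : 𝒢.r g' = y) (hh : 𝒢.r h = y)
    (hh' : 𝒢.r h' = x) (hk' : 𝒢.r k' = x) (a : A.UFib x) (b : A.UFib y)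
    (hb : b ∈ D g' hg') (hb' : b ∈ D h hh) (hab : a = L.data.act ih' hh hh' b) :
    L.data.act ig hg' hg (L.data.act ih hh' hh a) =
      L.data.wmul c hg hk (L.data.mulwStar c hg hk (L.data.act ik hk' hk a)) := by
  have cv : 𝒢.IsComp h' g' k' := c.inv_rev ig ih ik
  have ha : a ∈ D h' hh' := by rw [hab]; exact act_mem ih' hh hb'
  -- This uses that `a` comes from an element of `D_{g⁻¹} ∩ D_h`: it puts `a` into the domain of
  -- `α_{gh}`.
  have ha' : a ∈ D k' hk' := by rw [hab]; exact L.act_mem_of_comp cv ih' hh hg' hh' hk' hb' hb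
  have h1 := act_mem (L := L) (hy := hh) ih hh' ha
  have h1' := L.act_mem_of_comp (cv.inv_left ih') ih hh' hk' hh hg' ha ha'
  have hf := act_mem (L := L) (hy := hg) ig hg' h1'
  have hf' := L.act_mem_of_comp c ig hg' hh hg hk h1' h1
  have he := act_mem (L := L) (hy := hk) ik hk' ha'
  have he' := L.act_mem_of_comp (c.inv_right ih) ik hk' hh' hk hg ha' ha
  have A1 := isAct_act (L := L) (hy := hh) ih hh' ha
  have A2 := isAct_act (L := L) (hy := hg) ig hg' h1'
  have A3 := isAct_act (L := L) (hy := hk) ik hk' ha'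
  generalize L.data.act ik hk' hk a = e at *
  generalize L.data.act ig hg' hg (L.data.act ih hh' hh a) = f at *
  generalize L.data.act ih hh' hh a = a1 at *
  have hE : f ∈ D g hg ⊓ D k hk := ⟨hf, hf'⟩
  refine ClosedIdeal.eq_conj _ hE ⟨he', he⟩ fun v hv => ?_
  have hs := s_eq_of_inv ig hg'
  refine (L.induction_mulTriv c hs hg hh hk (p := fun v => v ∈ D g hg ⊓ D k hk ∧
    L.data.mulw c hg hk (v * f) = L.data.mulw c hg hk v * e) ?_ ?_ ?_ hv).2
  · rw [zero_mul, mulw_zero, zero_mul]; exact ⟨zero_mem _, rfl⟩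
  · rintro v v' ⟨h1, h2⟩ ⟨h1', h2'⟩
    refine ⟨add_mem h1 h1', ?_⟩
    rw [add_mul, mulw_add c (ClosedIdeal.mul_mem_l _ _ hE) (ClosedIdeal.mul_mem_l _ _ hE), h2, h2',
      mulw_add c h1 h1', add_mul]
  · intro m n
    refine ⟨L.mulTriv_mem c _ _ _ _ _ _, ?_⟩
    have cr := comp_u_right_of (s_eq_of_inv ih hh')
    -- Right multiplication by `f` is right multiplication by `a1` on the fibre at `g`, and `Ψ(n) a1
    -- = Ψ(n a)`.
    have e1 : L.mulTriv hs hg hh m n * f = L.mulTriv hs hg hh m (A.mul cr n (A.ofU a)) := by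
      rw [mulTriv, ← A2, A.mul_assoc _ _ (𝒢.comp_u_u y) (comp_u_right_of hs), ← A.ofU_mul, ← A1]
      rfl
    rw [e1, L.mulw_mulTriv, L.mulw_mulTriv, ← A3,
      A.mul_assoc c (comp_u_right_of (s_eq_of_inv ik hk')) cr c]

/-- For a generator `e = Ψ(a Ψ(b))`, both sides become `Ψ(m a b)`; the cocycle identity is
associativity of the bundle. -/
theorem mulw_cocycle {gh hk ghk : G} (c : 𝒢.IsComp g h gh) (d : 𝒢.IsComp gh k ghk)
    (c' : 𝒢.IsComp h k hk) (d' : 𝒢.IsComp g hk ghk) (hs : 𝒢.s g = x)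
    (hh : 𝒢.r h = x) (hhk : 𝒢.r hk = x) (hg : 𝒢.r g = y) (hgh : 𝒢.r gh = y)
    (hghk : 𝒢.r ghk = y) (m : A.fib g) {e : A.UFib x} (he : e ∈ D h hh ⊓ D hk hhk) :
    L.data.mulw d' hg hghk (L.toFun hg
        (A.mul (comp_u_right_of hs) m (A.ofU (L.data.mulw c' hh hhk e)))) =
      L.data.mulw d hgh hghk (L.data.mulw c hg hgh
        (L.toFun hg (A.mul (comp_u_right_of hs) m (A.ofU e)))) := by
  have cr := comp_u_right_of hs
  refine (L.induction_mulTriv c' rfl hh c'.1.symm hhk (p := fun e => e ∈ D h hh ⊓ D hk hhk ∧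
    L.data.mulw d' hg hghk (L.toFun hg (A.mul cr m (A.ofU (L.data.mulw c' hh hhk e)))) =
      L.data.mulw d hgh hghk (L.data.mulw c hg hgh
        (L.toFun hg (A.mul cr m (A.ofU e))))) ?_ ?_ ?_ he).2
  · refine ⟨zero_mem _, ?_⟩
    rw [mulw_zero, A.ofU_zero, A.mul_zero, L.map_zero, mulw_zero, mulw_zero, mulw_zero]
  · rintro e e' ⟨h1, h2⟩ ⟨h1', h2'⟩
    refine ⟨add_mem h1 h1', ?_⟩
    have m1 := fun e (he : e ∈ D h hh ⊓ D hk hhk) => L.toFun_mul_mem_right c hs hg hh hgh m he.1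
    have m2 := fun e (he : e ∈ D h hh ⊓ D hk hhk) => L.toFun_mul_mem_right d' hs hg hhk hghk m he.2
    rw [mulw_add c' h1 h1', A.ofU_add, A.mul_add, L.map_add, A.ofU_add, A.mul_add, L.map_add,
      mulw_add d' (m2 _ (mulw_mem c' e)) (m2 _ (mulw_mem c' e')),
      mulw_add c (m1 e h1) (m1 e' h1'),
      mulw_add d ⟨(mulw_mem c _).2, mulw_mem_of_mem c (m1 e h1) (m2 e h1).2⟩
        ⟨(mulw_mem c _).2, mulw_mem_of_mem c (m1 e' h1') (m2 e' h1').2⟩, h2, h2']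
  · intro a b
    refine ⟨L.mulTriv_mem c' _ _ _ _ _ _, ?_⟩
    have hsgh : 𝒢.s gh = 𝒢.s h := c.s_eq
    have e1 : L.toFun hg (A.mul cr m (A.ofU (L.data.mulw c' hh hhk
        (L.mulTriv rfl hh c'.1.symm a b)))) = L.mulTriv hs hg hhk m (A.mul c' a b) := by
      rw [L.mulw_mulTriv]; rfl
    have e2 : L.toFun hg (A.mul cr m (A.ofU (L.mulTriv rfl hh c'.1.symm a b))) =
      L.mulTriv hs hg hh m
        (A.mul (comp_u_right_of rfl) a (A.ofU (L.toFun c'.1.symm b))) := rfl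
    have e3 : L.toFun hgh (A.mul c m
        (A.mul (comp_u_right_of rfl) a (A.ofU (L.toFun c'.1.symm b)))) =
        L.mulTriv hsgh hgh c'.1.symm (A.mul c m a) b := by
      rw [mulTriv, A.mul_assoc c (comp_u_right_of hsgh) (comp_u_right_of rfl) c]
    rw [e1, e2, L.mulw_mulTriv, L.mulw_mulTriv, e3, L.mulw_mulTriv, A.mul_assoc c d c' d']

/-- For a product `a b` with `α_g(a) = Ψ(m)`, one has `α_g(a b) = Ψ(m b)` and `(a b) w = a (b w)`,
which reduces the claim to `mulw_cocycle`. -/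
theorem cocycle {gh hk ghk : G} (c : 𝒢.IsComp g h gh) (d : 𝒢.IsComp gh k ghk)
    (c' : 𝒢.IsComp h k hk) (d' : 𝒢.IsComp g hk ghk) (i : g' = 𝒢.inv g)
    (hg' : 𝒢.r g' = x) (hh : 𝒢.r h = x) (hhk : 𝒢.r hk = x)
    (hg : 𝒢.r g = y) (hgh : 𝒢.r gh = y) (hghk : 𝒢.r ghk = y) (a : A.UFib x)
    (h1 : a ∈ D g' hg') (h2 : a ∈ D h hh) (h3 : a ∈ D hk hhk) :
    L.data.mulw d' hg hghk (L.data.act i hg' hg (L.data.mulw c' hh hhk a)) =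
      L.data.mulw d hgh hghk (L.data.mulw c hg hgh (L.data.act i hg' hg a)) := by
  -- The partial maps have the value `0` outside their domains, so additivity needs membership at
  -- every stage.
  have m1 : ∀ {a}, a ∈ D g' hg' ⊓ (D h hh ⊓ D hk hhk) →
      L.data.mulw c' hh hhk a ∈ D g' hg' := fun h => mulw_mem_of_mem c' h.2 h.1
  have m2 : ∀ {a}, a ∈ D g' hg' ⊓ (D h hh ⊓ D hk hhk) →
      L.data.act i hg' hg (L.data.mulw c' hh hhk a) ∈ D g hg ⊓ D ghk hghk := fun h =>
    ⟨act_mem i hg' (m1 h), L.act_mem_of_comp d' i hg' hhk hg hghk (m1 h) (mulw_mem c' _).2⟩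
  have m3 : ∀ {a}, a ∈ D g' hg' ⊓ (D h hh ⊓ D hk hhk) →
      L.data.act i hg' hg a ∈ D g hg ⊓ D gh hgh := fun h =>
    ⟨act_mem i hg' h.1, L.act_mem_of_comp c i hg' hh hg hgh h.1 h.2.1⟩
  have m4 : ∀ {a}, a ∈ D g' hg' ⊓ (D h hh ⊓ D hk hhk) →
      L.data.mulw c hg hgh (L.data.act i hg' hg a) ∈ D gh hgh ⊓ D ghk hghk := fun h =>
    ⟨(mulw_mem c _).2, mulw_mem_of_mem c (m3 h)
      (L.act_mem_of_comp d' i hg' hhk hg hghk h.1 h.2.2)⟩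
  refine ((D g' hg' ⊓ (D h hh ⊓ D hk hhk)).induction (p := fun a =>
    L.data.mulw d' hg hghk (L.data.act i hg' hg (L.data.mulw c' hh hhk a)) =
      L.data.mulw d hgh hghk (L.data.mulw c hg hgh (L.data.act i hg' hg a))) ?_ ?_ ?_
    (⟨h1, h2, h3⟩ : a ∈ D g' hg' ⊓ (D h hh ⊓ D hk hhk)))
  · rw [mulw_zero, act_zero, mulw_zero, mulw_zero, mulw_zero]
  · intro a b ha hb h h'
    rw [mulw_add c' ha.2 hb.2, act_add i hg' (m1 ha) (m1 hb), mulw_add d' (m2 ha) (m2 hb), h, h',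
      act_add i hg' ha.1 hb.1, mulw_add c (m3 ha) (m3 hb), mulw_add d (m4 ha) (m4 hb)]
  · intro a b ha hb
    obtain ⟨m, hm⟩ := L.surj hg (act_mem (L := L) (hy := hg) i hg' ha.1)
    have H := isAct_act (L := L) (hy := hg) i hg' ha.1
    rw [← hm] at H
    have e1 : L.data.mulw c' hh hhk (a * b) = a * L.data.mulw c' hh hhk b :=
      ClosedIdeal.rmul_mul _ a hb.2
    rw [e1, (H.mul_right _).act_eq i hg' ((D g' hg').mul_mem_r _ ha.1) (L.mem _ _),
      (H.mul_right _).act_eq i hg' ((D g' hg').mul_mem_r _ ha.1) (L.mem _ _)]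
    exact L.mulw_cocycle c d c' d' (s_eq_of_inv i hg') hh hhk hg hgh hghk m hb.2

theorem twist_eq_one (c : 𝒢.IsComp g h k) (hx : 𝒢.s g = x) (hy : 𝒢.r g = y) (hh : 𝒢.r h = x)
    (hk : 𝒢.r k = y)
    (H : ∀ a b, L.mulTriv hx hy hh a b = L.toFun hk (A.mul c a b)) : L.data.w c hy hk = 1 := by
  refine unitary_multiplier_eq_one fun e => Subtype.ext ?_
  rw [← ClosedIdeal.rmul_of_mem]
  refine (L.induction_mulTriv c hx hy hh hk (p := fun e => e ∈ D g hy ⊓ D k hk ∧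
    L.data.mulw c hy hk e = e) ⟨zero_mem _, mulw_zero c⟩ ?_ ?_ e.2).2
  · rintro a b ⟨h1, h2⟩ ⟨h1', h2'⟩
    exact ⟨add_mem h1 h1', by rw [mulw_add c h1 h1', h2, h2']⟩
  · intro a b
    exact ⟨L.mulTriv_mem c _ _ _ _ _ _, by rw [L.mulw_mulTriv, H]⟩

section Unital

variable {L}


theorem IsUnital.act_unit (hL : L.IsUnital) (i : 𝒢.u x = 𝒢.inv (𝒢.u x)) (h : 𝒢.r (𝒢.u x) = x) (a : A.UFib x) :
    L.data.act i h h a = a :=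
  IsAct.act_eq i h (fun m => by rw [hL.toFun_eq, hL.toFun_eq]; rfl) (L.unit_mem a) (L.unit_mem a)

/-- Over the unit, `Ψ(b) = b`, so the two families that define the twist coincide. -/
theorem IsUnital.twist_right (hL : L.IsUnital) (g : G) (y : X) (hg : 𝒢.r g = y) :
    L.data.w (𝒢.comp_u_right g) hg hg = 1 :=
  L.twist_eq_one _ rfl hg (𝒢.r_u _) hg fun a b => by rw [mulTriv, hL.toFun_eq]; rfl

/-- Here both families equal `a Ψ(b)`, by unitality and left linearity. -/
theorem IsUnital.twist_left (hL : L.IsUnital) (g : G) (y : X) (hu : 𝒢.r (𝒢.u (𝒢.r g)) = y) (hg : 𝒢.r g = y) :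
    L.data.w (𝒢.comp_u_left g) hu hg = 1 := by
  subst hg
  refine L.twist_eq_one _ (𝒢.s_u _) hu rfl rfl fun a b => ?_
  rw [mulTriv, hL.toFun_eq]
  exact (L.map_smul rfl (𝒢.comp_u_left g) (A.toU a) b).symm

end Unital

end LeftTriv

namespace LeftTriv

variable {D : IdealFamily 𝒢.r A.UFib} (L : LeftTriv A D)

variable {g h k g' h' k' : G} {x y z : X}

/-! ### Continuity of the twisted partial action -/

variable {L} in
theorem IsAct.norm_eq {hx : 𝒢.s g = x} (hx' : 𝒢.r g' = x) {hy : 𝒢.r g = y} (i : g' = 𝒢.inv g)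
    {c : A.UFib x} {d : A.UFib y} (H : L.IsAct hx hy c d) (hc : c ∈ D g' hx') (hd : d ∈ D g hy) :
    ‖d‖ = ‖c‖ := by
  rw [H.unique (L.isAct_actEquiv hx' hy i ⟨c, hc⟩) hd (SetLike.coe_mem _)]
  exact StarAlgEquiv.norm_map (L.actEquiv hx' hy i) ⟨c, hc⟩

variable {L} in
theorem IsAct.sub {hx : 𝒢.s g = x} {hy : 𝒢.r g = y} {c c' : A.UFib x} {d d' : A.UFib y}
    (h : L.IsAct hx hy c d) (h' : L.IsAct hx hy c' d') :
    L.IsAct hx hy (c - c') (d - d') := by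
  have := h.add (h'.smul (-1))
  rwa [neg_one_smul, neg_one_smul, ← sub_eq_add_neg, ← sub_eq_add_neg] at this

/-- For `c = a⋆ b`, extend `a` and `b` to continuous sections `σ`, `τ` of the bundle and take `σ⋆ τ`
and `Ψ(σ)⋆ Ψ(τ)`. Continuity at the one point `g` suffices. -/
theorem exists_isAct_section (g : G) {c : A.UFib (𝒢.r (𝒢.inv g))} (hc : c ∈ D (𝒢.inv g) rfl) :
    ∃ (ξ : ∀ g, A.UFib (𝒢.r (𝒢.inv g))) (η : ∀ g, A.UFib (𝒢.r g)),
      (∀ g, ξ g ∈ D (𝒢.inv g) rfl ∧ η g ∈ D g rfl ∧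
        L.IsAct (s_eq_of_inv rfl rfl) rfl (ξ g) (η g)) ∧ ξ g = c ∧
      Tendsto (fun g => (⟨𝒢.r (𝒢.inv g), ξ g⟩ : Tot A.UFib)) (𝓝 g) (𝓝 ⟨𝒢.r (𝒢.inv g), ξ g⟩) ∧
      Tendsto (fun g => (⟨𝒢.r g, η g⟩ : Tot A.UFib)) (𝓝 g) (𝓝 ⟨𝒢.r g, η g⟩) := by
  have hB := A.isCStarField_UFib
  have cc : ∀ g, 𝒢.IsComp (𝒢.inv g) g (𝒢.u (𝒢.r (𝒢.inv g))) := fun g => comp_inv_mul_of rfl rfl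
  refine L.induction_inner rfl rfl (cc g) (p := fun c =>
    ∃ (ξ : ∀ g, A.UFib (𝒢.r (𝒢.inv g))) (η : ∀ g, A.UFib (𝒢.r g)),
      (∀ g, ξ g ∈ D (𝒢.inv g) rfl ∧ η g ∈ D g rfl ∧
        L.IsAct (s_eq_of_inv rfl rfl) rfl (ξ g) (η g)) ∧ ξ g = c ∧
      Tendsto (fun g => (⟨𝒢.r (𝒢.inv g), ξ g⟩ : Tot A.UFib)) (𝓝 g) (𝓝 ⟨𝒢.r (𝒢.inv g), ξ g⟩) ∧
      Tendsto (fun g => (⟨𝒢.r g, η g⟩ : Tot A.UFib)) (𝓝 g) (𝓝 ⟨𝒢.r g, η g⟩)) ?_ ?_ ?_ hc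
  · refine ⟨fun _ => 0, fun _ => 0, fun g => ⟨zero_mem _, zero_mem _, IsAct.zero⟩, rfl, ?_, ?_⟩
    · exact hB.tendsto_zero ((𝒢.continuous_r.comp 𝒢.continuous_inv).tendsto g) (by simp)
    · exact hB.tendsto_zero (𝒢.continuous_r.tendsto g) (by simp)
  · rintro a b - - ⟨ξ, η, h1, rfl, h2, h3⟩ ⟨ξ', η', h1', rfl, h2', h3'⟩
    exact ⟨fun g => ξ g + ξ' g, fun g => η g + η' g, fun g => ⟨add_mem (h1 g).1 (h1' g).1,
      add_mem (h1 g).2.1 (h1' g).2.1, (h1 g).2.2.add (h1' g).2.2⟩, rfl, hB.tendsto_add h2 h2',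
      hB.tendsto_add h3 h3'⟩
  · intro a b
    obtain ⟨σ, hσ, rfl⟩ := A.isBanachField.exists_section g a
    obtain ⟨τ, hτ, rfl⟩ := A.isBanachField.exists_section g b
    have hσ' := Continuous.tendsto hσ g
    have hτ' := Continuous.tendsto hτ g
    refine ⟨fun g => A.toU (A.mul (cc g) (A.star rfl (σ g)) (τ g)),
      fun g => star (L.toFun rfl (σ g)) * L.toFun rfl (τ g), fun g =>
      ⟨L.mul_mem_of_inner _ _ _ _ _, mul_mem (star_mem (L.mem _ _)) (L.mem _ _),
        L.isAct_inner _ _ _ _ _ _⟩, rfl, ?_, ?_⟩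
    · exact A.tendsto_UFib.2 (A.tendsto_mul cc (cc g) (A.tendsto_star (fun _ => rfl) rfl hσ') hτ')
    · exact hB.tendsto_mul
        (hB.tendsto_star ((L.tendsto_iff (fun _ => rfl) rfl).1 hσ').2)
        ((L.tendsto_iff (fun _ => rfl) rfl).1 hτ').2

/-- Compare with a pair `ξ`, `η` of related families through the limit point. Since `α` is
isometric, `‖d - η‖ = ‖c - ξ‖`, so each convergence implies the other. -/
theorem tendsto_isAct {Z : Type*} {l : Filter Z} {γ : Z → G} {g : G} (hγ : Tendsto γ l (𝓝 g))
    {c : ∀ z, A.UFib (𝒢.r (𝒢.inv (γ z)))} {d : ∀ z, A.UFib (𝒢.r (γ z))}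
    {c0 : A.UFib (𝒢.r (𝒢.inv g))} {d0 : A.UFib (𝒢.r g)}
    (H : ∀ z, c z ∈ D (𝒢.inv (γ z)) rfl ∧ d z ∈ D (γ z) rfl ∧
        L.IsAct (s_eq_of_inv rfl rfl) rfl (c z) (d z))
    (H0 : c0 ∈ D (𝒢.inv g) rfl ∧ d0 ∈ D g rfl ∧ L.IsAct (s_eq_of_inv rfl rfl) rfl c0 d0) :
    Tendsto (fun z => (⟨𝒢.r (𝒢.inv (γ z)), c z⟩ : Tot A.UFib)) l (𝓝 ⟨𝒢.r (𝒢.inv g), c0⟩) ↔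
      Tendsto (fun z => (⟨𝒢.r (γ z), d z⟩ : Tot A.UFib)) l (𝓝 ⟨𝒢.r g, d0⟩) := by
  have hB := A.isCStarField_UFib
  obtain ⟨ξ, η, h1, h2, h3, h4⟩ := L.exists_isAct_section g H0.1
  have hη : η g = d0 := by
    have := (h1 g).2.2
    rw [h2] at this
    exact this.unique H0.2.2 (h1 g).2.1 H0.2.1
  rw [h2] at h3
  rw [hη] at h4
  have e : ∀ z, ‖d z - η (γ z)‖ = ‖c z - ξ (γ z)‖ := fun z =>
    ((H z).2.2.sub (h1 (γ z)).2.2).norm_eq rfl rfl (sub_mem (H z).1 (h1 _).1)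
      (sub_mem (H z).2.1 (h1 _).2.1)
  have h3' := h3.comp hγ
  have h4' := h4.comp hγ
  constructor
  · intro hc
    refine hB.tendsto_of_norm_sub h4' ?_
    simp only [e]
    exact hB.tendsto_norm_sub hc h3'
  · intro hd
    refine hB.tendsto_of_norm_sub h3' ?_
    simp only [← e]
    exact hB.tendsto_norm_sub hd h4'

theorem continuous_act : Continuous[L.data.invD.totTop, D.totTop]
    fun p : Tot L.data.invD.Fib => (⟨p.base, L.actEquiv rfl rfl rfl p.val⟩ : Tot D.Fib) :=
  (@continuous_iff_continuousAt _ _ L.data.invD.totTop D.totTop _).2 fun p => by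
    have h := IdealFamily.tendsto_totTop.1 (@tendsto_id _ (@nhds _ L.data.invD.totTop p))
    refine IdealFamily.tendsto_totTop.2 ⟨h.1, ?_⟩
    refine (L.tendsto_isAct h.1 (fun z => ⟨?_, ?_, ?_⟩) ⟨?_, ?_, ?_⟩).1 h.2
    · exact z.val.2
    · exact SetLike.coe_mem _
    · exact L.isAct_actEquiv rfl rfl rfl z.val
    · exact p.val.2
    · exact SetLike.coe_mem _
    · exact L.isAct_actEquiv rfl rfl rfl p.val

theorem isAct_actEquiv_symm (hx : 𝒢.r g' = x) (hy : 𝒢.r g = y) (i : g' = 𝒢.inv g) (d : D g hy) :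
    L.IsAct (s_eq_of_inv i hx) hy ((L.actEquiv hx hy i).symm d : D g' hx) d := by
  have := L.isAct_actEquiv hx hy i ((L.actEquiv hx hy i).symm d)
  rwa [StarAlgEquiv.apply_symm_apply] at this

theorem continuous_act_symm : Continuous[D.totTop, L.data.invD.totTop]
    fun p : Tot D.Fib =>
      (⟨p.base, (L.actEquiv rfl rfl rfl).symm p.val⟩ : Tot L.data.invD.Fib) :=
  (@continuous_iff_continuousAt _ _ D.totTop L.data.invD.totTop _).2 fun p => by
    have h := IdealFamily.tendsto_totTop.1 (@tendsto_id _ (@nhds _ D.totTop p))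
    refine IdealFamily.tendsto_totTop.2 ⟨h.1, ?_⟩
    refine (L.tendsto_isAct h.1 (fun z => ⟨?_, ?_, ?_⟩) ⟨?_, ?_, ?_⟩).2 h.2
    · exact SetLike.coe_mem _
    · exact z.val.2
    · exact L.isAct_actEquiv_symm rfl rfl rfl z.val
    · exact SetLike.coe_mem _
    · exact p.val.2
    · exact L.isAct_actEquiv_symm rfl rfl rfl p.val

/-- The ideal `D_g ∩ D_{gh}` for a composable pair. -/
noncomputable abbrev pairIdeal (D : IdealFamily 𝒢.r A.UFib) (p : 𝒢.Pairs) : ClosedIdeal (A.UFib (𝒢.r p.1.1)) :=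
  D p.1.1 rfl ⊓ D (𝒢.mul p.1.1 p.1.2 p.2) (𝒢.r_mul _ _ _)

/-- The twist at a composable pair. -/
noncomputable abbrev pairTwist (p : 𝒢.Pairs) : unitary 𝓜(ℂ, ↥(pairIdeal D p)) :=
  L.data.w ⟨p.2, rfl⟩ rfl (𝒢.r_mul _ _ _)

/-- On generators, sections `σ`, `τ` of the bundle give the pair `Ψ(σ Ψ(τ))`, `Ψ(σ τ)`, which the
twist relates. -/
theorem exists_twist_section (p : 𝒢.Pairs) {e : A.UFib (𝒢.r p.1.1)} (he : e ∈ pairIdeal D p) :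
    ∃ (ξ η : ∀ p : 𝒢.Pairs, A.UFib (𝒢.r p.1.1)),
      (∀ p, ξ p ∈ pairIdeal D p ∧ (pairIdeal D p).rmul (L.pairTwist p : 𝓜(ℂ, _)) (ξ p) = η p) ∧
      ξ p = e ∧
      Tendsto (fun p => (⟨𝒢.r p.1.1, ξ p⟩ : Tot A.UFib)) (𝓝 p) (𝓝 ⟨𝒢.r p.1.1, ξ p⟩) ∧
      Tendsto (fun p => (⟨𝒢.r p.1.1, η p⟩ : Tot A.UFib)) (𝓝 p) (𝓝 ⟨𝒢.r p.1.1, η p⟩) := by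
  have hB := A.isCStarField_UFib
  have t1 : Tendsto (fun p : 𝒢.Pairs => p.1.1) (𝓝 p) (𝓝 p.1.1) :=
    (continuous_fst.comp continuous_subtype_val).tendsto p
  have t2 : Tendsto (fun p : 𝒢.Pairs => p.1.2) (𝓝 p) (𝓝 p.1.2) :=
    (continuous_snd.comp continuous_subtype_val).tendsto p
  refine L.induction_mulTriv ⟨p.2, rfl⟩ p.2 rfl rfl (𝒢.r_mul _ _ _) (p := fun e =>
    ∃ (ξ η : ∀ p : 𝒢.Pairs, A.UFib (𝒢.r p.1.1)),
      (∀ p, ξ p ∈ pairIdeal D p ∧ (pairIdeal D p).rmul (L.pairTwist p : 𝓜(ℂ, _)) (ξ p) = η p) ∧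
      ξ p = e ∧
      Tendsto (fun p => (⟨𝒢.r p.1.1, ξ p⟩ : Tot A.UFib)) (𝓝 p) (𝓝 ⟨𝒢.r p.1.1, ξ p⟩) ∧
      Tendsto (fun p => (⟨𝒢.r p.1.1, η p⟩ : Tot A.UFib)) (𝓝 p) (𝓝 ⟨𝒢.r p.1.1, η p⟩)) ?_ ?_ ?_ he
  · have := hB.tendsto_zero (a := fun _ => 0) ((𝒢.continuous_r.tendsto _).comp t1) (by simp)
    exact ⟨fun _ => 0, fun _ => 0, fun p => ⟨zero_mem _, ClosedIdeal.rmul_zero _⟩, rfl, this, this⟩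
  · rintro a b ⟨ξ, η, h1, rfl, h2, h3⟩ ⟨ξ', η', h1', rfl, h2', h3'⟩
    refine ⟨fun g => ξ g + ξ' g, fun g => η g + η' g, fun g => ⟨add_mem (h1 g).1 (h1' g).1, ?_⟩,
      rfl, hB.tendsto_add h2 h2', hB.tendsto_add h3 h3'⟩
    rw [ClosedIdeal.rmul_add _ (h1 g).1 (h1' g).1, (h1 g).2, (h1' g).2]
  · intro a b
    obtain ⟨σ, hσ, rfl⟩ := A.isBanachField.exists_section p.1.1 a
    obtain ⟨τ, hτ, rfl⟩ := A.isBanachField.exists_section p.1.2 b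
    have hσ' := (Continuous.tendsto hσ p.1.1).comp t1
    have hτ' := (Continuous.tendsto hτ p.1.2).comp t2
    refine ⟨fun p => L.mulTriv p.2 rfl rfl (σ p.1.1) (τ p.1.2),
      fun p => L.toFun (𝒢.r_mul _ _ p.2) (A.mul ⟨p.2, rfl⟩ (σ p.1.1) (τ p.1.2)), fun p => ⟨?_, ?_⟩,
      rfl, ?_, ?_⟩
    · exact L.mulTriv_mem ⟨p.2, rfl⟩ _ _ _ _ _ _
    · exact L.mulw_mulTriv ⟨p.2, rfl⟩ p.2 rfl rfl (𝒢.r_mul _ _ _) _ _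
    · refine ((L.tendsto_iff (fun _ => rfl) rfl).1 (A.tendsto_mul
        (fun p : 𝒢.Pairs => comp_u_right_of p.2) (comp_u_right_of p.2) hσ' ?_)).2
      exact A.tendsto_UFib.1 ((L.tendsto_iff (fun _ => rfl) rfl).1 hτ').2
    · exact ((L.tendsto_iff (fun p : 𝒢.Pairs => 𝒢.r_mul _ _ p.2) (𝒢.r_mul _ _ p.2)).1
        (A.tendsto_mul (fun p : 𝒢.Pairs => ⟨p.2, rfl⟩) ⟨p.2, rfl⟩ hσ' hτ')).2

theorem continuous_mulw {σ : ∀ p : 𝒢.Pairs, A.UFib (𝒢.r p.1.1)}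
    (hσ : IsContSection (fun p : 𝒢.Pairs => 𝒢.r p.1.1) A.UFib σ)
    (hσ' : ∀ p, σ p ∈ pairIdeal D p) : IsContSection (fun p : 𝒢.Pairs => 𝒢.r p.1.1) A.UFib
      fun p => (pairIdeal D p).rmul (L.pairTwist p : 𝓜(ℂ, _)) (σ p) := by
  have hB := A.isCStarField_UFib
  refine continuous_iff_continuousAt.2 fun p => ?_
  obtain ⟨ξ, η, h1, h2, h3, h4⟩ := L.exists_twist_section p (hσ' p)
  rw [← (h1 p).2, h2] at h4
  rw [h2] at h3
  refine hB.tendsto_of_norm_sub h4 ?_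
  have e : ∀ q, ‖(pairIdeal D q).rmul (L.pairTwist q : 𝓜(ℂ, _)) (σ q) - η q‖ = ‖σ q - ξ q‖ :=
    fun q => by
      rw [← (h1 q).2, ← ClosedIdeal.rmul_sub _ (hσ' q) (h1 q).1,
        ClosedIdeal.norm_rmul _ (sub_mem (hσ' q) (h1 q).1)]
  simp only [e]
  exact hB.tendsto_norm_sub (Continuous.tendsto hσ p) h3

/-- Take `ξ` through `σ(p) w⋆`, so that `η = ξ w` passes through `σ(p)`. Unitarity then gives `‖σ w⋆
- ξ‖ = ‖σ - η‖`. -/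
theorem continuous_mulwStar {σ : ∀ p : 𝒢.Pairs, A.UFib (𝒢.r p.1.1)}
    (hσ : IsContSection (fun p : 𝒢.Pairs => 𝒢.r p.1.1) A.UFib σ)
    (hσ' : ∀ p, σ p ∈ pairIdeal D p) : IsContSection (fun p : 𝒢.Pairs => 𝒢.r p.1.1) A.UFib
      fun p => (pairIdeal D p).rmul (star (L.pairTwist p : 𝓜(ℂ, _))) (σ p) := by
  have hB := A.isCStarField_UFib
  refine continuous_iff_continuousAt.2 fun p => ?_
  obtain ⟨ξ, η, h1, h2, h3, h4⟩ := L.exists_twist_section p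
    (ClosedIdeal.rmul_mem (pairIdeal D p) (star (L.pairTwist p : 𝓜(ℂ, _))) (σ p))
  rw [← (h1 p).2, h2, ClosedIdeal.rmul_rmul_star _ (hσ' p)] at h4
  rw [h2] at h3
  refine hB.tendsto_of_norm_sub h3 ?_
  have e : ∀ q, ‖(pairIdeal D q).rmul (star (L.pairTwist q : 𝓜(ℂ, _))) (σ q) - ξ q‖ =
      ‖σ q - η q‖ := fun q => by
    rw [← (h1 q).2, ← ClosedIdeal.norm_rmul (L.pairTwist q)
      (sub_mem (ClosedIdeal.rmul_mem _ _ _) (h1 q).1),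
      ClosedIdeal.rmul_sub _ (ClosedIdeal.rmul_mem _ _ _) (h1 q).1,
      ClosedIdeal.rmul_rmul_star _ (hσ' q)]
  simp only [e]
  exact hB.tendsto_norm_sub (Continuous.tendsto hσ p) h4

/-- Left multiplication by `w` is the adjoint of right multiplication by `w⋆`; both preserve norms,
hence vanishing at infinity. -/
theorem isC0Section_twist {σ : ∀ p : 𝒢.Pairs, A.UFib (𝒢.r p.1.1)}
    (hσ : IsC0Section (fun p : 𝒢.Pairs => 𝒢.r p.1.1) A.UFib σ)
    (hσ' : ∀ p, σ p ∈ pairIdeal D p) :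
    IsC0Section (fun p : 𝒢.Pairs => 𝒢.r p.1.1) A.UFib
      (fun p => (pairIdeal D p).lmul (L.pairTwist p : 𝓜(ℂ, _)) (σ p)) ∧
    IsC0Section (fun p : 𝒢.Pairs => 𝒢.r p.1.1) A.UFib
      (fun p => (pairIdeal D p).rmul (L.pairTwist p : 𝓜(ℂ, _)) (σ p)) := by
  have hB := A.isCStarField_UFib
  refine ⟨⟨?_, ?_⟩, L.continuous_mulw hσ.1 hσ', ?_⟩
  · have h := L.continuous_mulwStar (σ := fun p => star (σ p))
      (hB.continuous_star.comp hσ.1) fun p => star_mem (hσ' p)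
    have e : ∀ p, (pairIdeal D p).lmul (L.pairTwist p : 𝓜(ℂ, _)) (σ p) =
        star ((pairIdeal D p).rmul (star (L.pairTwist p : 𝓜(ℂ, _))) (star (σ p))) := fun p =>
      ClosedIdeal.lmul_eq_star _ (hσ' p)
    simp only [e]
    exact hB.continuous_star.comp h
  · exact hσ.2.congr fun p => (ClosedIdeal.norm_lmul _ (hσ' p)).symm
  · exact hσ.2.congr fun p => (ClosedIdeal.norm_rmul _ (hσ' p)).symm

/-- The twisted partial action defined by a unital trivialisation by a continuous field of
ideals. -/
noncomputable def action (hL : L.IsUnital) (hD : D.IsCont) :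
    TwistedPartialAction.{uG, uX, w} 𝒢 where
  toTwistedPartialActionData := L.data
  D_unit _ _ := SetLike.ext fun a => ⟨fun _ => trivial, fun _ => L.unit_mem a⟩
  act_unit _ i h a := hL.act_unit i h a
  w_unit_right := hL.twist_right
  w_unit_left := hL.twist_left
  act_mem c i hx hh hy hk _ ha ha' := L.act_mem_of_comp c i hx hh hy hk ha ha'
  act_act c ig ih ih' ik hg hk hg' hh hh' hk' a b hb hb' hab :=
    L.act_act c ig ih ih' ik hg hk hg' hh hh' hk' a b hb hb' hab
  cocycle c d c' d' i hg' hh hhk hg hgh hghk a h1 h2 h3 :=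
    L.cocycle c d c' d' i hg' hh hhk hg hgh hghk a h1 h2 h3
  D_cont := hD
  continuous_act := L.continuous_act
  continuous_actInv := L.continuous_act_symm
  w_cont _ h1 h2 := L.isC0Section_twist h1 h2

/-! ### The Fell bundle of the twisted partial action -/

variable {L} in
theorem IsAct.congr_base {hx : 𝒢.s g = x} {hy : 𝒢.r g = y} (hz : 𝒢.r g = z) {c : A.UFib x}
    {a : A.fib g} (H : L.IsAct hx hy c (L.toFun hy a)) : L.IsAct hx hz c (L.toFun hz a) := by
  subst hy hz
  exact H

/-- With `c' = α_g⁻¹(Ψ(a))`, the element `α_g(c' Ψ(b))` is `Ψ(a Ψ(b))`, which the twist sends to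
`Ψ(a b)`. -/
theorem toFun_mul (c : 𝒢.IsComp g h k) (a : A.fib g) (b : A.fib h) :
    L.toFun rfl (A.mul c a b) = L.data.mulw c c.r_eq.symm rfl
      (L.data.act rfl ((𝒢.r_inv g).trans c.1) c.r_eq.symm
        (L.data.actInv rfl ((𝒢.r_inv g).trans c.1) rfl (L.toFun rfl a) * L.toFun rfl b)) := by
  have hx := (𝒢.r_inv g).trans c.1
  have hd := L.mem rfl a
  have H := (isAct_actInv (L := L) rfl hx hd).congr_base (z := 𝒢.r k) c.r_eq.symm
  rw [(H.mul_right (L.toFun rfl b)).act_eq rfl hx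
    ((D _ _).mul_mem_r _ (actInv_mem rfl hx hd)) (L.mem _ _)]
  exact (L.mulw_mulTriv c c.1 _ rfl _ a b).symm

variable {L} in
-- Unitality turns the defining property of `w(g⁻¹, g)` into `Ψ(n Ψ(b)) w = n b`. Hence `m (Ψ(a⋆)
-- w)` is sent to `m a⋆ = Ψ(m) Ψ(a)⋆`.
theorem IsUnital.isAct_mulw (hL : L.IsUnital) (c : 𝒢.IsComp h g k) (hk : k = 𝒢.u x)
    (i : h = 𝒢.inv g) (hx : 𝒢.s g = x) (hy : 𝒢.r g = y) (hh : 𝒢.r h = x) (hkx : 𝒢.r k = x)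
    (a : A.fib g) :
    L.IsAct hx hy (L.data.mulw c hh hkx (L.toFun hh (A.star i a))) (star (L.toFun hy a)) := by
  subst hk
  intro m
  have cg := comp_mul_inv_of i hy
  have hsh : 𝒢.s h = y := by rw [i, 𝒢.s_inv, hy]
  -- The claim is generalised from `a⋆` to arbitrary `n` in the fibre at `g⁻¹`, so that it can be
  -- checked on generators.
  suffices H : ∀ e ∈ D h hh ⊓ D _ hkx, e ∈ D h hh ⊓ D _ hkx ∧ ∀ n, L.toFun hh n = e →
      L.toFun hy (A.mul (comp_u_right_of hx) m (A.ofU (L.data.mulw c hh hkx e))) =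
        A.toU (A.mul cg m n) by
    rw [(H _ ⟨L.mem _ _, L.unit_mem _⟩).2 _ rfl]
    exact (L.map_inner hy i cg m a).symm
  intro e he
  refine L.induction_mulTriv c hsh hh hy hkx (p := fun e => e ∈ D h hh ⊓ D _ hkx ∧
    ∀ n, L.toFun hh n = e →
      L.toFun hy (A.mul (comp_u_right_of hx) m (A.ofU (L.data.mulw c hh hkx e))) =
        A.toU (A.mul cg m n)) ?_ ?_ ?_ he
  · refine ⟨zero_mem _, fun n hn => ?_⟩
    rw [L.inj hh (hn.trans (L.map_zero hh).symm), mulw_zero, A.ofU_zero, A.mul_zero, A.mul_zero,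
      L.map_zero]
    rfl
  · rintro e e' ⟨h1, h2⟩ ⟨h1', h2'⟩
    refine ⟨add_mem h1 h1', fun n hn => ?_⟩
    obtain ⟨n1, rfl⟩ := L.surj hh h1.1
    obtain ⟨n2, rfl⟩ := L.surj hh h1'.1
    rw [L.inj hh (hn.trans (L.map_add hh _ _).symm), mulw_add c h1 h1', A.ofU_add, A.mul_add,
      L.map_add, h2 _ rfl, h2' _ rfl, A.mul_add]
    rfl
  · intro n b
    refine ⟨L.mulTriv_mem c _ _ _ _ _ _, fun n' hn' => ?_⟩
    rw [L.inj hh hn', L.mulw_mulTriv, hL.toFun_eq, A.ofU_toU,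
      ← A.mul_assoc cg (comp_u_left_of hy) c (comp_u_right_of hx),
      ← A.mul_assoc cg (𝒢.comp_u_u y) (comp_u_right_of hsh) cg]
    exact L.map_smul hy (comp_u_left_of hy) (A.toU (A.mul cg m n)) b

variable {L} in
theorem IsUnital.toFun_star (hL : L.IsUnital) (c : 𝒢.IsComp h g k) (hk : k = 𝒢.u x)
    (i : h = 𝒢.inv g) (hy : 𝒢.r g = y) (hh : 𝒢.r h = x) (hkx : 𝒢.r k = x) (a : A.fib g) :
    L.toFun hh (A.star i a) = L.data.mulwStar c hh hkx
      (L.data.actInv i hh hy (star (L.toFun hy a))) := by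
  have hm : L.toFun hh (A.star i a) ∈ D h hh ⊓ D k hkx := ⟨L.mem _ _, by
    subst hk; exact L.unit_mem _⟩
  rw [(hL.isAct_mulw c hk i (s_eq_of_inv i hh) hy hh hkx a).actInv_eq i hh
    (mulw_mem c _).1 (star_mem (L.mem hy a))]
  exact (ClosedIdeal.rmul_star_rmul _ hm).symm

/-- The Fell bundle is isomorphic to that of the twisted partial action of its trivialisation. -/
noncomputable def iso (hL : L.IsUnital) (hD : D.IsCont) :
    A.toFellData.Iso (L.action hL hD).fell where
  φ g :=
    { L.equiv g with
      norm_map' := fun a => L.norm_map rfl a }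
  map_mul c a b := Subtype.ext (L.toFun_mul c a b)
  map_star {g k} i a := Subtype.ext (by
    refine hL.toFun_star (h := k) (k := 𝒢.u (𝒢.s g)) (by rw [i]; exact 𝒢.comp_inv_mul g) ?_ i rfl
      rfl (by rw [𝒢.r_u, i, 𝒢.r_inv]) a
    rw [i, 𝒢.r_inv])
  continuous_toFun := L.continuous_equiv
  continuous_invFun := L.continuous_equiv_symm

end LeftTriv

/-! ### Consequences of the laws of a twisted partial action -/

namespace TwistedPartialAction

variable (T : TwistedPartialAction.{uG, uX, w} 𝒢) {g h k g' h' k' : G} {x y z : X}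

theorem act_of_mem (i : g' = 𝒢.inv g) (hx : 𝒢.r g' = x) (hy : 𝒢.r g = y) {a : T.B x}
    (h : a ∈ T.D g' hx) : T.act i hx hy a = (T.α i hx hy ⟨a, h⟩ : T.D g hy) := dif_pos h

theorem act_mem_self (i : g' = 𝒢.inv g) (hx : 𝒢.r g' = x) (hy : 𝒢.r g = y) {a : T.B x}
    (h : a ∈ T.D g' hx) : T.act i hx hy a ∈ T.D g hy := by
  rw [T.act_of_mem i hx hy h]; exact SetLike.coe_mem _

theorem actInv_of_mem (i : g' = 𝒢.inv g) (hx : 𝒢.r g' = x) (hy : 𝒢.r g = y) {a : T.B y}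
    (h : a ∈ T.D g hy) : T.actInv i hx hy a = ((T.α i hx hy).symm ⟨a, h⟩ : T.D g' hx) := dif_pos h

theorem actInv_mem (i : g' = 𝒢.inv g) (hx : 𝒢.r g' = x) (hy : 𝒢.r g = y) {a : T.B y}
    (h : a ∈ T.D g hy) : T.actInv i hx hy a ∈ T.D g' hx := by
  rw [T.actInv_of_mem i hx hy h]; exact SetLike.coe_mem _

theorem act_actInv (i : g' = 𝒢.inv g) (hx : 𝒢.r g' = x) (hy : 𝒢.r g = y) {a : T.B y}
    (h : a ∈ T.D g hy) : T.act i hx hy (T.actInv i hx hy a) = a := by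
  rw [T.act_of_mem i hx hy (T.actInv_mem i hx hy h)]
  simp only [T.actInv_of_mem i hx hy h, Subtype.coe_eta, StarAlgEquiv.apply_symm_apply]

theorem act_mul (i : g' = 𝒢.inv g) (hx : 𝒢.r g' = x) (hy : 𝒢.r g = y) {a b : T.B x}
    (ha : a ∈ T.D g' hx) (hb : b ∈ T.D g' hx) :
    T.act i hx hy (a * b) = T.act i hx hy a * T.act i hx hy b := by
  rw [T.act_of_mem i hx hy ha, T.act_of_mem i hx hy hb, T.act_of_mem i hx hy (mul_mem ha hb)]
  exact congrArg Subtype.val (map_mul (T.α i hx hy) ⟨a, ha⟩ ⟨b, hb⟩)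

theorem mem_of_unit (hg : g = 𝒢.u x) (hx : 𝒢.r g = x) (a : T.B x) : a ∈ T.D g hx := by
  subst hg
  rw [T.D_unit]
  trivial

theorem act_of_unit (hg : g = 𝒢.u x) (i : g' = 𝒢.inv g) (hx : 𝒢.r g' = x) (hy : 𝒢.r g = x)
    (a : T.B x) : T.act i hx hy a = a := by
  subst hg
  obtain rfl : g' = 𝒢.u x := by rw [i, ← 𝒢.u_eq_inv]
  exact T.act_unit x i hx a

theorem actInv_of_unit (hg : g = 𝒢.u x) (i : g' = 𝒢.inv g) (hx : 𝒢.r g' = x) (hy : 𝒢.r g = x)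
    (a : T.B x) : T.actInv i hx hy a = a := by
  have := T.act_actInv i hx hy (T.mem_of_unit hg hy a)
  rwa [T.act_of_unit hg] at this

theorem mulw_of_unit_right (c : 𝒢.IsComp g h k) (hh : h = 𝒢.u (𝒢.s g)) (hg : 𝒢.r g = y)
    (hk : 𝒢.r k = y) {d : T.B y} (hd : d ∈ T.D g hg) : T.mulw c hg hk d = d := by
  subst hh
  obtain rfl := c.eq (𝒢.comp_u_right g)
  unfold TwistedPartialActionData.mulw
  rw [T.w_unit_right k y hg]
  exact ClosedIdeal.rmul_one (I := T.D k hg ⊓ T.D k hk) ⟨hd, hd⟩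

theorem mulw_of_unit_left (c : 𝒢.IsComp h g k) (hh : h = 𝒢.u (𝒢.r g)) (hu : 𝒢.r h = y)
    (hk : 𝒢.r k = y) {d : T.B y} (hd : d ∈ T.D k hk) : T.mulw c hu hk d = d := by
  subst hh
  obtain rfl := c.eq (𝒢.comp_u_left g)
  unfold TwistedPartialActionData.mulw
  rw [T.w_unit_left k y hu hk]
  refine ClosedIdeal.rmul_one (I := T.D (𝒢.u (𝒢.r k)) hu ⊓ T.D k hk) ⟨?_, hd⟩
  exact T.mem_of_unit (by rw [hk]) hu d

/-- `α_g(c w(g⁻¹, g)⋆) w(g, g⁻¹) = α_g(c)`. -/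
theorem mulw_act_mulwStar (i : g' = 𝒢.inv g) (c : 𝒢.IsComp g' g h) (hh : h = 𝒢.u x)
    (c' : 𝒢.IsComp g g' k) (hk : k = 𝒢.u y) (hx : 𝒢.r g' = x) (hy : 𝒢.r g = y)
    (hhx : 𝒢.r h = x) (hky : 𝒢.r k = y) {a : T.B x} (ha : a ∈ T.D g' hx) :
    T.mulw c' hy hky (T.act i hx hy (T.mulwStar c hx hhx a)) = T.act i hx hy a := by
  have hE : a ∈ T.D g' hx ⊓ T.D h hhx := ⟨ha, T.mem_of_unit hh hhx a⟩
  have hm : T.mulwStar c hx hhx a ∈ T.D g' hx ⊓ T.D h hhx := ClosedIdeal.rmul_mem _ _ _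
  have hs : 𝒢.s g = x := s_eq_of_inv i hx
  have d : 𝒢.IsComp k g g := by rw [hk]; exact comp_u_left_of hy
  have d' : 𝒢.IsComp g h g := by rw [hh]; exact comp_u_right_of hs
  -- The cocycle identity for `(g, g⁻¹, g)`, applied to `a w(g⁻¹, g)⋆`; the two remaining twists
  -- involve a unit and disappear.
  have key := T.cocycle c' d c d' i hx hx hhx hy hky hy _ hm.1 hm.1 hm.2
  have e : T.mulw c hx hhx (T.mulwStar c hx hhx a) = a := ClosedIdeal.rmul_rmul_star _ hE
  have h1 := T.act_mem_self i hx hy hm.1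
  rw [e, T.mulw_of_unit_right d' (by rw [hh, hs]) _ _ (T.act_mem_self i hx hy ha),
    T.mulw_of_unit_left d (by rw [hk, hy])] at key
  · exact key.symm
  · exact ClosedIdeal.rmul_mem_of_mem (I := T.D g hy ⊓ T.D k hky) _
      ⟨h1, T.mem_of_unit hk hky _⟩ h1

end TwistedPartialAction

/-! ### The trivialisation of a Fell bundle defined by a twisted partial action -/

namespace TwistedPartialAction

variable {T : TwistedPartialAction.{uG, uX, w} 𝒢} (φ : A.toFellData.Iso T.fell)
  {g h k g' h' k' : G} {x y z : X}

/-- The values of an isomorphism to the Fell bundle of `T`. -/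
noncomputable def isoFun (hy : 𝒢.r g = y) (a : A.fib g) : T.B y :=
  hy ▸ (Subtype.val (p := (· ∈ T.D g rfl)) (φ.φ g a) : T.B (𝒢.r g))

theorem isoFun_add (hy : 𝒢.r g = y) (a b : A.fib g) :
    isoFun φ hy (a + b) = isoFun φ hy a + isoFun φ hy b := by
  subst hy; exact congrArg Subtype.val ((φ.φ g).map_add a b)

theorem isoFun_smul (hy : 𝒢.r g = y) (z : ℂ) (a : A.fib g) :
    isoFun φ hy (z • a) = z • isoFun φ hy a := by
  subst hy; exact congrArg Subtype.val ((φ.φ g).map_smul z a)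

theorem isoFun_mem (hy : 𝒢.r g = y) (a : A.fib g) : isoFun φ hy a ∈ T.D g hy := by
  subst hy; exact SetLike.coe_mem _

theorem isoFun_surj (hy : 𝒢.r g = y) {d : T.B y} (hd : d ∈ T.D g hy) :
    ∃ a, isoFun φ hy a = d := by
  subst hy
  exact ⟨(φ.φ g).symm ⟨d, hd⟩, congrArg Subtype.val ((φ.φ g).apply_symm_apply ⟨d, hd⟩)⟩

theorem norm_isoFun (hy : 𝒢.r g = y) (a : A.fib g) : ‖isoFun φ hy a‖ = ‖a‖ := by
  subst hy; exact (φ.φ g).norm_map a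

theorem isoFun_inj (hy : 𝒢.r g = y) {a b : A.fib g} (h : isoFun φ hy a = isoFun φ hy b) :
    a = b := by
  subst hy; exact (φ.φ g).injective (Subtype.ext h)

theorem tot_isoFun (hy : 𝒢.r g = y) (a : A.fib g) :
    (⟨𝒢.r g, isoFun φ rfl a⟩ : Tot T.B) = ⟨y, isoFun φ hy a⟩ := by
  subst hy; rfl

theorem actInv_isoFun (i : g' = 𝒢.inv g) (hx : 𝒢.r g' = x) (hy : 𝒢.r g = y) (a : A.fib g) :
    T.actInv i hx hy (isoFun φ hy a) = T.actInv i hx rfl (isoFun φ rfl a) := by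
  subst hy; rfl

theorem actInv_star_isoFun (i : g' = 𝒢.inv g) (hx : 𝒢.r g' = x) (hy : 𝒢.r g = y) (a : A.fib g) :
    T.actInv i hx hy (star (isoFun φ hy a)) = T.actInv i hx rfl (star (isoFun φ rfl a)) := by
  subst hy; rfl

theorem isoFun_mul (c : 𝒢.IsComp g h k) (hx : 𝒢.r (𝒢.inv g) = x) (hy : 𝒢.r g = y)
    (hh : 𝒢.r h = x) (hk : 𝒢.r k = y) (a : A.fib g) (b : A.fib h) :
    isoFun φ hk (A.mul c a b) = T.mulw c hy hk (T.act rfl hx hy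
      (T.actInv rfl hx hy (isoFun φ hy a) * isoFun φ hh b)) := by
  rw [actInv_isoFun]
  subst hh hk
  exact congrArg Subtype.val (φ.map_mul c a b)

theorem isoFun_star (i : h = 𝒢.inv g) (c : 𝒢.IsComp h g k) (hk : k = 𝒢.u x) (hy : 𝒢.r g = y)
    (hh : 𝒢.r h = x) (hkx : 𝒢.r k = x) (a : A.fib g) :
    isoFun φ hh (A.star i a) = T.mulwStar c hh hkx
      (T.actInv i hh hy (star (isoFun φ hy a))) := by
  rw [actInv_star_isoFun]
  obtain rfl : x = 𝒢.s g := (s_eq_of_inv i hh).symm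
  subst hk
  -- The involution is defined with particular base points and units; freeing these indices lets
  -- substitution match them.
  have key : ∀ (x : X) (e : 𝒢.r h = x) (k : G) (c : 𝒢.IsComp h g k) (e' : 𝒢.r k = x),
      k = 𝒢.u (𝒢.s g) → isoFun φ e (A.star i a) = T.mulwStar c e e'
        (T.actInv i e rfl (star (isoFun φ rfl a))) := by
    rintro x rfl k c e' rfl
    exact congrArg Subtype.val (φ.map_star i a)
  exact key _ hh _ c hkx rfl

/-- The isomorphism on unit fibres. -/
noncomputable def unitFun (y : X) (a : A.UFib y) : T.B y := isoFun φ (𝒢.r_u y) (A.ofU a)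

/-- At a unit both `α` and the twist are trivial, so the product of the associated bundle is that of
the C*-algebra. -/
theorem isoFun_unit_mul (c : 𝒢.IsComp (𝒢.u y) g g) (hy : 𝒢.r g = y) (b : A.UFib y)
    (a : A.fib g) : isoFun φ hy (A.mul c (A.ofU b) a) = unitFun φ y b * isoFun φ hy a := by
  have hx : 𝒢.r (𝒢.inv (𝒢.u y)) = y := by rw [𝒢.r_inv, 𝒢.s_u]
  rw [isoFun_mul φ c hx (𝒢.r_u y) hy hy, T.actInv_of_unit rfl, T.act_of_unit rfl,
    T.mulw_of_unit_left c (by rw [hy])]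
  · rfl
  · exact (T.D g hy).mul_mem_l _ (isoFun_mem φ hy a)

/-- The involution contributes `w(g⁻¹, g)⋆` and the product contributes `w(g, g⁻¹)`;
`mulw_act_mulwStar` cancels them. -/
theorem unitFun_inner (i : g' = 𝒢.inv g) (c : 𝒢.IsComp g g' (𝒢.u y)) (hy : 𝒢.r g = y)
    (a b : A.fib g) : unitFun φ y (A.toU (A.mul c a (A.star i b))) =
      isoFun φ hy a * star (isoFun φ hy b) := by
  subst i
  have hx : 𝒢.r (𝒢.inv g) = 𝒢.s g := 𝒢.r_inv g
  have ha := isoFun_mem φ hy a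
  have hb := star_mem (isoFun_mem φ hy b)
  have cg := 𝒢.comp_inv_mul g
  have ha' := T.actInv_mem rfl hx hy ha
  have hb' := T.actInv_mem rfl hx hy hb
  have hm : ∀ p q, q ∈ T.D (𝒢.inv g) hx → p * T.mulwStar cg hx (𝒢.r_u _) q =
      T.mulwStar cg hx (𝒢.r_u _) (p * q) := fun p q hq =>
    (ClosedIdeal.rmul_mul (I := T.D (𝒢.inv g) hx ⊓ T.D (𝒢.u (𝒢.s g)) (𝒢.r_u _)) _ p
      ⟨hq, T.mem_of_unit rfl _ q⟩).symm
  rw [unitFun, A.ofU_toU, isoFun_mul φ c hx hy hx (𝒢.r_u y),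
    isoFun_star φ rfl cg rfl hy hx (𝒢.r_u _), hm _ _ hb',
    T.mulw_act_mulwStar rfl cg rfl c rfl hx hy (𝒢.r_u _) (𝒢.r_u _) (mul_mem ha' hb'),
    T.act_mul rfl hx hy ha' hb', T.act_actInv rfl hx hy ha, T.act_actInv rfl hx hy hb]

theorem unitFun_surj (d : T.B y) : ∃ a, unitFun φ y a = d :=
  isoFun_surj φ (𝒢.r_u y) (T.mem_of_unit rfl _ d)

theorem unitFun_inj {a b : A.UFib y} (h : unitFun φ y a = unitFun φ y b) : a = b :=
  A.ofU_inj (isoFun_inj φ _ h)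

theorem unitFun_mul (a b : A.UFib y) : unitFun φ y (a * b) = unitFun φ y a * unitFun φ y b :=
  isoFun_unit_mul φ (𝒢.comp_u_u y) (𝒢.r_u y) a (A.ofU b)

/-- The inner product formula over a unit gives the identity after multiplication by any element,
and that element can be cancelled. -/
theorem unitFun_star (a : A.UFib y) : unitFun φ y (star a) = star (unitFun φ y a) := by
  refine eq_of_forall_mul_left fun z => ?_
  obtain ⟨c, rfl⟩ := unitFun_surj φ z
  rw [← unitFun_mul]
  exact unitFun_inner φ (𝒢.u_eq_inv y) (𝒢.comp_u_u y) (𝒢.r_u y) (A.ofU c) (A.ofU a)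

theorem unitFun_add (a b : A.UFib y) : unitFun φ y (a + b) = unitFun φ y a + unitFun φ y b :=
  isoFun_add φ _ _ _

theorem unitFun_smul (z : ℂ) (a : A.UFib y) : unitFun φ y (z • a) = z • unitFun φ y a :=
  isoFun_smul φ _ _ _

/-- The isomorphism from a unit fibre to the corresponding C*-algebra. -/
noncomputable def unitIso (y : X) : A.UFib y ≃ₗᵢ[ℂ] T.B y :=
  { LinearEquiv.ofBijective
      { toFun := unitFun φ y
        map_add' := unitFun_add φ
        map_smul' := unitFun_smul φ }
      ⟨fun _ _ h => unitFun_inj φ h, fun d => unitFun_surj φ d⟩ with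
    norm_map' := fun a => norm_isoFun φ _ (A.ofU a) }

theorem unitIso_apply (a : A.UFib y) : unitIso φ y a = unitFun φ y a := rfl

theorem unitIso_symm_mul (a b : T.B y) :
    (unitIso φ y).symm (a * b) = (unitIso φ y).symm a * (unitIso φ y).symm b :=
  (unitIso φ y).injective (by
    rw [LinearIsometryEquiv.apply_symm_apply, unitIso_apply, unitFun_mul, ← unitIso_apply,
      ← unitIso_apply, LinearIsometryEquiv.apply_symm_apply, LinearIsometryEquiv.apply_symm_apply])

theorem unitIso_symm_star (a : T.B y) :
    (unitIso φ y).symm (star a) = star ((unitIso φ y).symm a) :=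
  (unitIso φ y).injective (by
    rw [LinearIsometryEquiv.apply_symm_apply, unitIso_apply, unitFun_star, ← unitIso_apply,
      LinearIsometryEquiv.apply_symm_apply])

/-- The ideals in the unit fibres of the Fell bundle that correspond to the ideals of the partial
action. -/
noncomputable def idealFamily : IdealFamily 𝒢.r A.UFib := fun g y hy =>
  { carrier := {a | unitIso φ y a ∈ T.D g hy}
    add_mem' := fun {a b} ha hb => by
      change unitIso φ y (a + b) ∈ T.D g hy
      rw [map_add]; exact add_mem ha hb
    zero_mem' := by
      change unitIso φ y 0 ∈ T.D g hy
      rw [map_zero]; exact zero_mem _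
    smul_mem' := fun z a ha => by
      change unitIso φ y (z • a) ∈ T.D g hy
      rw [map_smul]; exact SMulMemClass.smul_mem z ha
    mul_mem' := fun {a b} ha hb => by
      change unitIso φ y (a * b) ∈ T.D g hy
      rw [unitIso_apply, unitFun_mul]; exact mul_mem ha hb
    star_mem' := fun {a} ha => by
      change unitIso φ y (star a) ∈ T.D g hy
      rw [unitIso_apply, unitFun_star]; exact star_mem ha
    mul_mem_left := fun b a ha => by
      change unitIso φ y (b * a) ∈ T.D g hy
      rw [unitIso_apply, unitFun_mul]; exact (T.D g hy).mul_mem_l _ ha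
    mul_mem_right := fun a b ha => by
      change unitIso φ y (a * b) ∈ T.D g hy
      rw [unitIso_apply, unitFun_mul]; exact (T.D g hy).mul_mem_r _ ha
    isClosed := (T.D g hy).isClosed.preimage (unitIso φ y).continuous }

theorem mem_idealFamily {hy : 𝒢.r g = y} {a : A.UFib y} :
    a ∈ idealFamily φ g hy ↔ unitIso φ y a ∈ T.D g hy := Iff.rfl

theorem isInducing_isoFun : Topology.IsInducing fun p : Tot A.fib =>
    (p.base, (⟨𝒢.r p.base, isoFun φ rfl p.val⟩ : Tot T.B)) :=
  IdealFamily.isInducing_of_inverse (D := T.D) φ.continuous_toFun φ.continuous_invFun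
    fun p => congrArg (Tot.mk p.base) ((φ.φ p.base).symm_apply_apply p.val)

theorem tendsto_isoFun {Z : Type*} {l : Filter Z} {γ : Z → G} {η : Z → X} {g : G} {y : X}
    (hη : ∀ z, 𝒢.r (γ z) = η z) (hy : 𝒢.r g = y) {a : ∀ z, A.fib (γ z)} {a0 : A.fib g} :
    Tendsto (fun z => (⟨γ z, a z⟩ : Tot A.fib)) l (𝓝 ⟨g, a0⟩) ↔
      Tendsto γ l (𝓝 g) ∧ Tendsto (fun z => (⟨η z, isoFun φ (hη z) (a z)⟩ : Tot T.B)) l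
        (𝓝 ⟨y, isoFun φ hy a0⟩) := by
  rw [(isInducing_isoFun φ).nhds_eq_comap, tendsto_comap_iff, nhds_prod_eq, tendsto_prod_iff']
  simp only [Function.comp_def, tot_isoFun φ hy, tot_isoFun φ (hη _)]

theorem continuous_unitIso_symm : Continuous
    fun p : Tot T.B => (⟨p.base, (unitIso φ p.base).symm p.val⟩ : Tot A.UFib) := by
  refine continuous_iff_continuousAt.2 fun p => A.tendsto_UFib.2 ?_
  refine (tendsto_isoFun φ (fun z => 𝒢.r_u _) (𝒢.r_u _) (γ := fun p : Tot T.B => 𝒢.u p.base)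
    (a := fun p => A.ofU ((unitIso φ p.base).symm p.val))
    (a0 := A.ofU ((unitIso φ p.base).symm p.val))).2 ⟨?_, ?_⟩
  · exact (𝒢.continuous_u.tendsto _).comp (T.isCStarField.tendsto_base tendsto_id)
  · have e : ∀ q : Tot T.B, isoFun φ (𝒢.r_u q.base) (A.ofU ((unitIso φ q.base).symm q.val)) =
        q.val := fun q => (unitIso φ q.base).apply_symm_apply q.val
    simp only [e]
    exact tendsto_id

theorem isInducing_unitIso_symm : Topology.IsInducing
    fun p : Tot T.B => (⟨p.base, (unitIso φ p.base).symm p.val⟩ : Tot A.UFib) := by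
  have h2 : Continuous fun p : Tot A.UFib => (⟨p.base, unitIso φ p.base p.val⟩ : Tot T.B) :=
    continuous_iff_continuousAt.2 fun p => ((tendsto_isoFun φ (fun z => 𝒢.r_u _) (𝒢.r_u _)).1
      (A.tendsto_UFib.1 (tendsto_id (x := 𝓝 p)))).2
  exact (Topology.IsEmbedding.of_leftInverse
    (fun p => congrArg (Tot.mk p.base) ((unitIso φ p.base).apply_symm_apply p.val)) h2
    (continuous_unitIso_symm φ)).isInducing

theorem isCont_idealFamily : (idealFamily φ).IsCont := by
  intro g a ha
  obtain ⟨σ, h1, h2, h3⟩ := T.D_cont g _ ((mem_idealFamily φ).1 ha)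
  refine ⟨fun g => (unitIso φ _).symm (σ g), (continuous_unitIso_symm φ).comp h1, ?_, fun g => ?_⟩
  · change (unitIso φ _).symm (σ g) = a
    rw [h2, LinearIsometryEquiv.symm_apply_apply]
  · rw [mem_idealFamily, LinearIsometryEquiv.apply_symm_apply]
    exact h3 g

/-- The trivialisation of a Fell bundle that is isomorphic to that of a twisted partial action. -/
noncomputable def trivialisation : LeftTriv A (idealFamily φ) where
  toFun {g y} hy a := (unitIso φ y).symm (isoFun φ hy a)
  map_add hy a b := by rw [isoFun_add, map_add]
  map_csmul hy z a := by rw [isoFun_smul, map_smul]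
  mem hy a := by
    rw [mem_idealFamily, LinearIsometryEquiv.apply_symm_apply]
    exact isoFun_mem φ hy a
  surj {g y} hy d hd := by
    obtain ⟨a, ha⟩ := isoFun_surj φ hy hd
    exact ⟨a, by rw [ha, LinearIsometryEquiv.symm_apply_apply]⟩
  map_smul {g y} hy c b a := by
    rw [isoFun_unit_mul, unitIso_symm_mul, ← unitIso_apply, LinearIsometryEquiv.symm_apply_apply]
  map_inner {g g' y} hy i c a b := by
    rw [← unitIso_symm_star, ← unitIso_symm_mul, ← unitFun_inner φ i c hy, ← unitIso_apply,
      LinearIsometryEquiv.symm_apply_apply, A.ofU_toU]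
  isInducing := (Topology.IsInducing.id.prodMap (isInducing_unitIso_symm φ)).comp
    (isInducing_isoFun φ)

theorem idealFamily_eq_whole (hT : T.IsGlobal) :
    idealFamily φ = IdealFamily.whole 𝒢.r A.UFib := by
  funext g y hy
  refine SetLike.ext fun a => ⟨fun _ => trivial, fun _ => ?_⟩
  subst hy
  rw [mem_idealFamily, hT g]
  trivial

end TwistedPartialAction

/-! ### The main theorem -/

namespace FellBundle

theorem isFromTwistedPartialAction_iff_left :
    A.IsFromTwistedPartialAction ↔
      ∃ D : IdealFamily 𝒢.r A.UFib, D.IsCont ∧ Nonempty (LeftTriv A D) := by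
  constructor
  · rintro ⟨T, ⟨φ⟩⟩
    exact ⟨_, TwistedPartialAction.isCont_idealFamily φ, ⟨TwistedPartialAction.trivialisation φ⟩⟩
  · rintro ⟨D, hD, ⟨L⟩⟩
    -- Normalisation keeps the same family `D`, so its continuity still applies.
    exact ⟨_, ⟨L.normalize.iso L.isUnital_normalize hD⟩⟩

theorem isFromTwistedAction_iff_left :
    A.IsFromTwistedAction ↔ Nonempty (LeftTriv A (IdealFamily.whole 𝒢.r A.UFib)) := by
  constructor
  · rintro ⟨T, hT, ⟨φ⟩⟩
    have L := TwistedPartialAction.trivialisation φ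
    rw [TwistedPartialAction.idealFamily_eq_whole φ hT] at L
    exact ⟨L⟩
  · rintro ⟨L⟩
    exact ⟨_, fun g => rfl, ⟨L.normalize.iso L.isUnital_normalize
      (IdealFamily.IsCont.whole A.isCStarField_UFib 𝒢.continuous_r)⟩⟩

end FellBundle

theorem mainTheorem8 {G : Type uG} {X : Type uX} [TopologicalSpace G] [TopologicalSpace X]
    [T2Space G] [LocallyCompactSpace G] (𝒢 : TopGroupoid G X) (A : FellBundle.{uG, uX, w} 𝒢) :
    (A.IsFromTwistedPartialAction ↔
      ∃ D : IdealFamily 𝒢.r A.UFib, D.IsCont ∧ Nonempty (A.LeftIso D)) ∧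
    (A.IsFromTwistedPartialAction ↔
      ∃ D : IdealFamily 𝒢.s A.UFib, D.IsCont ∧ Nonempty (A.RightIso D)) ∧
    (A.IsFromTwistedAction ↔ Nonempty (A.LeftIso (IdealFamily.whole 𝒢.r A.UFib))) ∧
    (A.IsFromTwistedAction ↔ Nonempty (A.RightIso (IdealFamily.whole 𝒢.s A.UFib))) := by
  rw [A.isFromTwistedPartialAction_iff_left, A.isFromTwistedAction_iff_left]
  refine ⟨⟨?_, ?_⟩, ⟨?_, ?_⟩, ⟨?_, ?_⟩, ⟨?_, ?_⟩⟩
  · rintro ⟨D, hD, ⟨L⟩⟩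
    exact ⟨D, hD, ⟨L.toLeftIso⟩⟩
  · rintro ⟨D, hD, ⟨Λ⟩⟩
    exact ⟨D, hD, ⟨.ofLeftIso Λ⟩⟩
  · rintro ⟨D, hD, ⟨L⟩⟩
    exact ⟨_, hD.reindex 𝒢.continuous_inv 𝒢.r_inv, ⟨L.toRightTriv.toRightIso⟩⟩
  · rintro ⟨D, hD, ⟨Λ⟩⟩
    exact ⟨_, hD.reindex 𝒢.continuous_inv 𝒢.s_inv, ⟨(RightTriv.ofRightIso Λ).toLeftTriv⟩⟩
  · rintro ⟨L⟩
    exact ⟨L.toLeftIso⟩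
  · rintro ⟨Λ⟩
    exact ⟨.ofLeftIso Λ⟩
  · rintro ⟨L⟩
    -- The family of whole fibres, pulled back along inversion, is by definition the family of whole
    -- fibres.
    exact ⟨L.toRightTriv.toRightIso⟩
  · rintro ⟨Λ⟩
    exact ⟨(RightTriv.ofRightIso Λ).toLeftTriv⟩
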